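/- Let $k$ be a field of characteristic $p>0$, $F=k((t))$, and let $D$ be a finite-dimensional central division algebra over $F$ with $[D:F]$ a power of $p$. Let $w$ be the unique extension to $D$ of the $t$-adic valuation, $O_D$ its valuation ring, $M_D$ the maximal ideal, $\bar D=O_D/M_D$, $\bar F=k$, and $\Gamma_D,\Gamma_F$ the value groups. A parameter of $D$ is an element $z$ with $w(z)>0$ generating $\Gamma_D$. An embedding is a ring homomorphism $u:\bar D\to O_D$ that is a section of the residue map $O_D\to\bar D$. Assume that $D$ is splittable, i.e. that an embedding exists, and that $Z(\bar D)=\bar F(s)$ is a simple extension of $\bar F$. For an embedding $u$, a parameter $z$, $l\in\mathbb Z$ and $a\in\bar D$ write $$z^l u(a) z^{-l}=\sum_{j\ge 0}u\big({}_l^{(z,u)}\delta_j(a)\big)z^j ,\qquad {}_l^{(z,u)}\delta_j:\bar D\to\bar D .$$ Then ${}_l^{(z,u)}\delta_0=\alpha^l$, where $\alpha={}^{(z)}\alpha$ is the automorphism of $\bar D$ induced by conjugation with $z$; $\alpha|_{Z(\bar D)}$ does not depend on $z$. The local height $i(u,z)$ is $\min_{a\in\bar D}w(zu(a)z^{-1}-u(a))$,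 where $w$ is normalised by $w(z)=1$. A parameter $z$ is appropriate (for $u$) if ${}^{(z)}\alpha=\mathrm{id}$ and, for $i=i(u,z)<\infty$, the map ${}_1^{(z,u)}\delta_i$ is not zero on $Z(\bar D)$. The number $i(u)=i(u,z)$, for an appropriate parameter $z$, is the semilocal height of $u$ (defined when an appropriate parameter exists). For $y\in D$ with $w(y)>0$ let $u(\bar D)((y))$ be the set of all sums $\sum_{j\ge N}u(c_j)y^j$, $N\in\mathbb Z$, $c_j\in\bar D$. Say that $u$ is determined by $s$ if each map ${}_l^{(z,u)}\delta_j|_{Z(\bar D)}$ (for all $z,l,j$) is determined by its values on the powers $s^n$, $n\ge0$: any two of these maps that agree on all $s^n$ agree on $Z(\bar D)$. Then: (i) There is an embedding $u$ that is determined by $s$. (ii) $[Z(\bar D):\bar F]=[\Gamma_D:\Gamma_F]$. (iii) Let $u$ be any embedding that is determined by $s$. * If $\alpha|_{Z(\bar D)}\neq\mathrm{id}$, put $n=|\mathrm{Gal}(Z(\bar D)/\bar F)|$, the order of the automorphism group of $Z(\bar D)$ over $\bar F$. Then there is a parameter $z$ such that $A=u(\bar D)((z^n))$ is a subalgebra of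 $D$ that contains $F$ (so $F\subseteq Z(A)$), and $Z(A)/F$ is a cyclic Galois field extension of degree $n$. * If the semilocal height $i(u)$ is defined and divisible by $p$, then there is an appropriate parameter $z$ such that $A=u(\bar D)((z^p))$ is a subalgebra of $D$ that contains $F$ (so $F\subseteq Z(A)$), and $Z(A)/F$ is a cyclic Galois field extension of degree $p$. -/

import Mathlib

open Polynomial Module
open scoped LaurentSeries WithZero

universe v

namespace SplitAlg

/-! Auxiliary facts: the norm of a finite dimensional division algebra over a complete
non-archimedean field yields a valuation. -/


theorem exists_algNorm_eq {K D : Type*} [Field K] [DivisionRing D] [Algebra K D]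
    [FiniteDimensional K D] (x : D) :
    ∃ d : ℕ, d ≠ 0 ∧ ∃ m : ℕ,
      Algebra.norm K x = ((-1) ^ m * (minpoly K x).coeff 0) ^ d := by
  have hint : IsIntegral K x := Algebra.IsIntegral.isIntegral x
  have hirr : Irreducible (minpoly K x) := minpoly.irreducible hint
  have : Fact (Irreducible (minpoly K x)) := ⟨hirr⟩
  let φ : AdjoinRoot (minpoly K x) →ₐ[K] D :=
    Ideal.Quotient.liftₐ _ (aeval x) (by
      intro a ha
      obtain ⟨b, rfl⟩ := Ideal.mem_span_singleton'.1 ha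
      simp)
  have hφ : φ (AdjoinRoot.root _) = x := by
    show (aeval x) (X : K[X]) = x
    simp
  let : Module (AdjoinRoot (minpoly K x)) D := Module.compHom D φ.toRingHom
  have hsm : ∀ (a : AdjoinRoot (minpoly K x)) (b : D), a • b = φ a * b := fun _ _ => rfl
  have : IsScalarTower K (AdjoinRoot (minpoly K x)) D := ⟨fun a b c => by
    rw [hsm, hsm, map_smul, smul_mul_assoc]⟩
  have : FiniteDimensional (AdjoinRoot (minpoly K x)) D :=
    Module.Finite.of_restrictScalars_finite K _ D
  refine ⟨finrank (AdjoinRoot (minpoly K x)) D, finrank_pos.ne',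
    (AdjoinRoot.powerBasis hirr.ne_zero).dim, ?_⟩
  have h1 : Algebra.lmul K D x = ((AdjoinRoot.root (minpoly K x)) •
      (LinearMap.id : D →ₗ[AdjoinRoot (minpoly K x)] D)).restrictScalars K := by
    ext b
    simp [hsm, hφ]
  rw [Algebra.norm_apply, h1, LinearMap.det_restrictScalars, LinearMap.det_smul, LinearMap.det_id,
    mul_one, map_pow]
  congr 1
  have h2 := Algebra.PowerBasis.norm_gen_eq_coeff_zero_minpoly (AdjoinRoot.powerBasis hirr.ne_zero)
  rw [AdjoinRoot.powerBasis_gen, AdjoinRoot.minpoly_root hirr.ne_zero,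
    (minpoly.monic hint).leadingCoeff] at h2
  simpa using h2

theorem norm_algNorm_le_one_iff {K D : Type*} [NontriviallyNormedField K] [IsUltrametricDist K]
    [CompleteSpace K] [DivisionRing D] [Algebra K D] [FiniteDimensional K D] (x : D) :
    ‖Algebra.norm K x‖ ≤ 1 ↔ spectralValue (minpoly K x) ≤ 1 := by
  obtain ⟨d, hd, m, h⟩ := exists_algNorm_eq (K := K) x
  have hint : IsIntegral K x := Algebra.IsIntegral.isIntegral x
  have hirr : Irreducible (minpoly K x) := minpoly.irreducible hint
  have : Fact (Irreducible (minpoly K x)) := ⟨hirr⟩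
  have hm : minpoly K (AdjoinRoot.root (minpoly K x)) = minpoly K x := by
    rw [AdjoinRoot.minpoly_root hirr.ne_zero, (minpoly.monic hint).leadingCoeff]; simp
  have : FiniteDimensional K (AdjoinRoot (minpoly K x)) :=
    (AdjoinRoot.powerBasis hirr.ne_zero).finite
  have hs := spectralNorm.spectralNorm_eq_norm_coeff_zero_rpow K (AdjoinRoot (minpoly K x))
    (AdjoinRoot.root (minpoly K x))
  rw [spectralNorm, hm] at hs
  have hdeg : (0 : ℝ) < 1 / ((minpoly K x).natDegree : ℝ) := by
    have := minpoly.natDegree_pos hint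
    positivity
  rw [hs, h, norm_pow, pow_le_one_iff_of_nonneg (norm_nonneg _) hd,
    ← Real.rpow_le_rpow_iff (norm_nonneg _) zero_le_one hdeg, Real.one_rpow]
  simp

theorem norm_algNorm_one_add_le {K D : Type*} [NontriviallyNormedField K] [IsUltrametricDist K]
    [CompleteSpace K] [DivisionRing D] [Algebra K D] [FiniteDimensional K D] (x : D)
    (hx : ‖Algebra.norm K x‖ ≤ 1) : ‖Algebra.norm K (1 + x)‖ ≤ 1 := by
  rw [norm_algNorm_le_one_iff] at hx ⊢
  have hint : IsIntegral K x := Algebra.IsIntegral.isIntegral x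
  have hirr : Irreducible (minpoly K x) := minpoly.irreducible hint
  have : Fact (Irreducible (minpoly K x)) := ⟨hirr⟩
  let φ : AdjoinRoot (minpoly K x) →ₐ[K] D :=
    Ideal.Quotient.liftₐ _ (aeval x) (by
      intro a ha
      obtain ⟨b, rfl⟩ := Ideal.mem_span_singleton'.1 ha
      simp)
  have hφ : φ (AdjoinRoot.root _) = x := by
    show (aeval x) (X : K[X]) = x
    simp
  have : FiniteDimensional K (AdjoinRoot (minpoly K x)) :=
    (AdjoinRoot.powerBasis hirr.ne_zero).finite
  have hinj : Function.Injective φ := φ.toRingHom.injective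
  have e1 := minpoly.algHom_eq φ hinj (AdjoinRoot.root _)
  have e2 := minpoly.algHom_eq φ hinj (1 + AdjoinRoot.root _)
  rw [hφ] at e1
  rw [map_add, map_one, hφ] at e2
  rw [e1] at hx
  rw [e2]
  change spectralNorm K (AdjoinRoot (minpoly K x)) _ ≤ 1
  refine (isNonarchimedean_spectralNorm _ _).trans (max_le ?_ hx)
  rw [spectralNorm_one]


theorem v_algNorm_one_add_le (k : Type*) [Field k] {D : Type*} [DivisionRing D] [Algebra k⸨X⸩ D]
    [FiniteDimensional k⸨X⸩ D] (x : D)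
    (hx : Valued.v (Algebra.norm k⸨X⸩ x) ≤ (1 : ℤᵐ⁰)) :
    Valued.v (Algebra.norm k⸨X⸩ (1 + x)) ≤ (1 : ℤᵐ⁰) := by
  have hnt : (Valued.v : Valuation k⸨X⸩ ℤᵐ⁰).IsNontrivial :=
    ⟨HahnSeries.single 1 1, by
      rw [LaurentSeries.valuation_single_zpow]
      exact ⟨WithZero.exp_ne_zero, by rw [← WithZero.exp_zero, Ne, WithZero.exp_inj]; decide⟩⟩
  obtain ⟨hr⟩ := Valuation.nonempty_rankOne_iff_mulArchimedean
    (v := (Valued.v : Valuation k⸨X⸩ ℤᵐ⁰)).2 inferInstance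
  let _ : NontriviallyNormedField k⸨X⸩ := Valued.toNontriviallyNormedField k⸨X⸩ ℤᵐ⁰
  have _ : @IsUltrametricDist k⸨X⸩ (Valued.toNormedField k⸨X⸩ ℤᵐ⁰).toDist := inferInstance
  have _ : @CompleteSpace k⸨X⸩ (Valued.toNormedField k⸨X⸩ ℤᵐ⁰).toUniformSpace :=
    LaurentSeries.instLaurentSeriesComplete
  have h := norm_algNorm_one_add_le (K := k⸨X⸩) x
  have h1 : (1 : ℝ) = ‖(1 : k⸨X⸩)‖ := by simp
  rw [h1, Valued.toNormedField.norm_le_iff, Valued.toNormedField.norm_le_iff, map_one] at h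
  exact h hx

/-- The valuation of a finite dimensional division algebra `D` over `k⸨X⸩`: the `X`-adic
valuation of the norm. Up to equivalence this is the unique extension of the `X`-adic valuation
to `D` (see `val_comap_isEquiv`); only its equivalence class is used below. As in Mathlib, it is
written multiplicatively, so `val x ≤ val y` means `w (x) ≥ w (y)`. -/
noncomputable def val (k : Type*) [Field k] (D : Type*) [DivisionRing D] [Algebra k⸨X⸩ D]
    [FiniteDimensional k⸨X⸩ D] : Valuation D ℤᵐ⁰ where
  toFun x := Valued.v (Algebra.norm k⸨X⸩ x)
  map_zero' := by simp
  map_one' := by simp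
  map_mul' x y := by simp
  map_add_le_max' x y := by
    have key : ∀ x y : D, Valued.v (Algebra.norm k⸨X⸩ x) ≤ (Valued.v (Algebra.norm k⸨X⸩ y) : ℤᵐ⁰) →
        Valued.v (Algebra.norm k⸨X⸩ (x + y)) ≤ (Valued.v (Algebra.norm k⸨X⸩ y) : ℤᵐ⁰) := by
      intro x y h
      rcases eq_or_ne y 0 with rfl | hy
      · have hx : x = 0 := by simpa using h
        simp [hx]
      · have hN : (Valued.v (Algebra.norm k⸨X⸩ y) : ℤᵐ⁰) ≠ 0 := by simpa using hy
        have h1 : Algebra.norm k⸨X⸩ x = Algebra.norm k⸨X⸩ (x * y⁻¹) * Algebra.norm k⸨X⸩ y := by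
          rw [← map_mul, inv_mul_cancel_right₀ hy]
        have h2 : x + y = (1 + x * y⁻¹) * y := by
          rw [add_mul, inv_mul_cancel_right₀ hy, one_mul, add_comm]
        have h3 : (Valued.v (Algebra.norm k⸨X⸩ (x * y⁻¹)) : ℤᵐ⁰) ≤ 1 := by
          rw [h1, map_mul] at h
          exact (mul_le_iff_le_one_left (zero_lt_iff.2 hN)).1 h
        rw [h2, map_mul, map_mul]
        exact (mul_le_iff_le_one_left (zero_lt_iff.2 hN)).2 (v_algNorm_one_add_le k _ h3)
    rcases le_total (Valued.v (Algebra.norm k⸨X⸩ x) : ℤᵐ⁰) (Valued.v (Algebra.norm k⸨X⸩ y)) with h | h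
    · exact (key x y h).trans (le_max_right _ _)
    · rw [add_comm]
      exact (key y x h).trans (le_max_left _ _)

section

variable (k : Type*) [Field k] (D : Type*) [DivisionRing D] [Algebra k⸨X⸩ D]
  [FiniteDimensional k⸨X⸩ D]

theorem val_apply (x : D) : val k D x = Valued.v (Algebra.norm k⸨X⸩ x) := rfl

theorem val_algebraMap (f : k⸨X⸩) :
    val k D (algebraMap k⸨X⸩ D f) = Valued.v f ^ finrank k⸨X⸩ D := by
  rw [val_apply, Algebra.norm_algebraMap, map_pow]

/-- `val` extends the `X`-adic valuation. -/
theorem val_comap_isEquiv :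
    ((val k D).comap (algebraMap k⸨X⸩ D)).IsEquiv (Valued.v : Valuation k⸨X⸩ ℤᵐ⁰) := by
  rw [Valuation.isEquiv_iff_val_le_one]
  intro f
  rw [Valuation.comap_apply, val_algebraMap]
  exact pow_le_one_iff finrank_pos.ne'

/-- The ideal `M_D` of the valuation ring `O_D`. -/
noncomputable def maxIdeal : Ideal (val k D).integer where
  carrier := {x | val k D x < 1}
  zero_mem' := by simp
  add_mem' {x y} hx hy := by
    have hx' : val k D (x : D) < 1 := hx
    have hy' : val k D (y : D) < 1 := hy
    change val k D ((x : D) + (y : D)) < 1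
    exact Valuation.map_add_lt _ hx' hy'
  smul_mem' c x hx := by
    have hx' : val k D (x : D) < 1 := hx
    change val k D ((c : D) * (x : D)) < 1
    rw [map_mul]
    exact mul_lt_one_of_nonneg_of_lt_one_right c.2 zero_le hx'

theorem mem_maxIdeal {x : (val k D).integer} : x ∈ maxIdeal k D ↔ val k D x < 1 := Iff.rfl

instance : (maxIdeal k D).IsTwoSided where
  mul_mem_of_left {x} b hx := by
    rw [mem_maxIdeal] at hx ⊢
    rw [Subring.coe_mul, map_mul]
    exact mul_lt_one_of_nonneg_of_lt_one_left zero_le hx b.2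

/-- The residue division algebra `O_D / M_D`. -/
abbrev Residue : Type _ := (val k D).integer ⧸ maxIdeal k D

theorem algebraMap_C_mem (c : k) :
    algebraMap k⸨X⸩ D (HahnSeries.C c) ∈ (val k D).integer := by
  rw [Valuation.mem_integer_iff, val_algebraMap]
  refine pow_le_one₀ zero_le ?_
  have h : (Valued.v (HahnSeries.single (0 : ℤ) c : k⸨X⸩) : ℤᵐ⁰) ≤ WithZero.exp (-(0 : ℤ)) := by
    rw [LaurentSeries.valuation_le_iff_coeff_lt_eq_zero]
    intro n hn
    exact HahnSeries.coeff_single_of_ne hn.ne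
  simpa using h

/-- Constants, as elements of the valuation ring. -/
noncomputable def constHom : k →+* (val k D).integer :=
  ((algebraMap k⸨X⸩ D).comp HahnSeries.C).codRestrict _ (algebraMap_C_mem k D)

/-- The residue field of `k⸨X⸩` is `k`, and the residue algebra of `D` is an algebra over it
through the constants. -/
noncomputable instance : Algebra k (Residue k D) :=
  RingHom.toAlgebra' ((Ideal.Quotient.mk (maxIdeal k D)).comp (constHom k D)) (by
    intro c x
    obtain ⟨x, rfl⟩ := Ideal.Quotient.mk_surjective x
    rw [RingHom.comp_apply, ← map_mul, ← map_mul]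
    congr 1
    exact Subtype.ext (Algebra.commutes (HahnSeries.C c : k⸨X⸩) (x : D)))

/-- The centre of the residue division algebra. -/
noncomputable abbrev ResidueCenter : Subalgebra k (Residue k D) :=
  Subalgebra.center k (Residue k D)

/-- The index `[Γ_D : Γ_F]` of the value group of `k⸨X⸩` in the value group of `D`. -/
noncomputable def ramificationIndex : ℕ :=
  (MonoidWithZeroHom.valueGroup (.ofClass ((val k D).comap (algebraMap k⸨X⸩ D)))).relIndex
    (MonoidWithZeroHom.valueGroup (.ofClass (val k D)))

end

section

variable {k : Type*} [Field k] {D : Type*} [DivisionRing D] [Algebra k⸨X⸩ D]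
  [FiniteDimensional k⸨X⸩ D]

open Classical in
/-- The residue class of an element of the valuation ring (and `0` outside of it). -/
noncomputable def res (x : D) : Residue k D :=
  if h : x ∈ (val k D).integer then Ideal.Quotient.mk (maxIdeal k D) ⟨x, h⟩ else 0

/-- An embedding: a section `u` of the residue homomorphism. -/
def IsSection (u : Residue k D →+* (val k D).integer) : Prop :=
  (Ideal.Quotient.mk (maxIdeal k D)).comp u = RingHom.id _

variable (k D) in
/-- `D` is splittable if the residue homomorphism has a section. -/
def Splittable : Prop := ∃ u : Residue k D →+* (val k D).integer, IsSection u

variable (k) in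
/-- A parameter `z` of `D`: `w (z) > 0` generates the value group. -/
def IsParameter (z : D) : Prop :=
  z ≠ 0 ∧ val k D z < 1 ∧ ∀ x : D, x ≠ 0 → ∃ n : ℤ, val k D x = val k D z ^ n

/-- The remainders in the expansion of `x` as a series in `z` with coefficients in the image
of `u`. -/
noncomputable def remainder (u : Residue k D →+* (val k D).integer) (z x : D) : ℕ → D
  | 0 => x
  | n + 1 => (remainder u z x n - u (res (remainder u z x n))) * z⁻¹

/-- The coefficients `c n` in `x = ∑ n, u (c n) * z ^ n`, for `x` in the valuation ring
(see `val_sub_sum_coeff_le` and `eq_coeff`). -/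
noncomputable def coeff (u : Residue k D →+* (val k D).integer) (z x : D) (n : ℕ) : Residue k D :=
  res (remainder u z x n)

theorem mk_section {u : Residue k D →+* (val k D).integer} (hu : IsSection u) (a : Residue k D) :
    Ideal.Quotient.mk (maxIdeal k D) (u a) = a :=
  RingHom.congr_fun hu a

theorem res_of_mem {x : D} (hx : x ∈ (val k D).integer) :
    res x = Ideal.Quotient.mk (maxIdeal k D) ⟨x, hx⟩ := dif_pos hx

theorem val_sub_res_lt {u : Residue k D →+* (val k D).integer} (hu : IsSection u) {x : D}
    (hx : val k D x ≤ 1) : val k D (x - u (res x)) < 1 := by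
  have h : (⟨x, hx⟩ : (val k D).integer) - u (res x) ∈ maxIdeal k D := by
    rw [← Ideal.Quotient.mk_eq_mk_iff_sub_mem, mk_section hu, res_of_mem hx]
  rw [mem_maxIdeal, AddSubgroupClass.coe_sub] at h
  exact h

theorem IsParameter.val_le {z x : D} (hz : IsParameter k z) (hx : val k D x < 1) :
    val k D x ≤ val k D z := by
  obtain ⟨hz0, hz1, hz2⟩ := hz
  rcases eq_or_ne x 0 with rfl | hx0
  · simp
  obtain ⟨n, hn⟩ := hz2 x hx0
  have hzp : 0 < val k D z := zero_lt_iff.2 ((Valuation.ne_zero_iff _).2 hz0)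
  have hn1 : 1 ≤ n := by
    by_contra hlt
    push Not at hlt
    have : val k D z ^ (0 : ℤ) ≤ val k D z ^ n :=
      (zpow_right_anti₀ hzp hz1.le) (by omega)
    rw [← hn, zpow_zero] at this
    exact absurd hx this.not_gt
  rw [hn]
  calc val k D z ^ n ≤ val k D z ^ (1 : ℤ) := (zpow_right_anti₀ hzp hz1.le) hn1
    _ = val k D z := zpow_one _

theorem val_remainder_le {u : Residue k D →+* (val k D).integer} (hu : IsSection u) {z x : D}
    (hz : IsParameter k z) (hx : val k D x ≤ 1) (n : ℕ) : val k D (remainder u z x n) ≤ 1 := by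
  induction n with
  | zero => exact hx
  | succ n ih =>
    have hz0 : val k D z ≠ 0 := (Valuation.ne_zero_iff _).2 hz.1
    rw [remainder, map_mul, map_inv₀]
    exact mul_inv_le_one_of_le₀ (hz.val_le (val_sub_res_lt hu ih)) zero_le

/-- An element `x` of the valuation ring is the sum of the series `∑ n, u (coeff n) * z ^ n`. -/
theorem val_sub_sum_coeff_le {u : Residue k D →+* (val k D).integer} (hu : IsSection u) {z x : D}
    (hz : IsParameter k z) (hx : val k D x ≤ 1) (n : ℕ) :
    val k D (x - ∑ j ∈ Finset.range n, (u (coeff u z x j) : D) * z ^ j) ≤ val k D z ^ n := by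
  have h : x - ∑ j ∈ Finset.range n, (u (coeff u z x j) : D) * z ^ j = remainder u z x n * z ^ n := by
    induction n with
    | zero => simp [remainder]
    | succ n ih =>
      rw [Finset.sum_range_succ, ← sub_sub, ih, ← sub_mul, remainder, pow_succ', ← mul_assoc,
        inv_mul_cancel_right₀ hz.1, coeff]
  rw [h, map_mul, map_pow]
  exact mul_le_of_le_one_left zero_le (val_remainder_le hu hz hx n)

/-- The coefficients of an expansion are unique. -/
theorem eq_coeff {u : Residue k D →+* (val k D).integer} (hu : IsSection u) {z x : D}
    (hz : IsParameter k z) {c : ℕ → Residue k D}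
    (hc : ∀ n, val k D (x - ∑ j ∈ Finset.range n, (u (c j) : D) * z ^ j) ≤ val k D z ^ n) (n : ℕ) :
    c n = coeff u z x n := by
  have hz0 : 0 < val k D z := zero_lt_iff.2 ((Valuation.ne_zero_iff _).2 hz.1)
  have step : ∀ n, x - ∑ j ∈ Finset.range n, (u (c j) : D) * z ^ j = remainder u z x n * z ^ n →
      c n = coeff u z x n := by
    intro n h
    have h1 := hc (n + 1)
    rw [Finset.sum_range_succ, ← sub_sub, h, ← sub_mul, map_mul, map_pow, pow_succ',
      mul_le_mul_iff_left₀ (pow_pos hz0 n)] at h1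
    have h2 : val k D (remainder u z x n - u (c n)) < 1 := h1.trans_lt hz.2.1
    have h3 : val k D (remainder u z x n) ≤ 1 := by
      have := Valuation.map_add_le (val k D) h2.le (u (c n)).2
      rwa [sub_add_cancel] at this
    rw [coeff, res_of_mem h3]
    conv_lhs => rw [← mk_section hu (c n)]
    rw [eq_comm, Ideal.Quotient.mk_eq_mk_iff_sub_mem, mem_maxIdeal, AddSubgroupClass.coe_sub]
    exact h2
  refine step n ?_
  induction n with
  | zero => simp [remainder]
  | succ n ih =>
    rw [Finset.sum_range_succ, ← sub_sub, ih, ← sub_mul, remainder, pow_succ', ← mul_assoc,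
      inv_mul_cancel_right₀ hz.1, step n ih, coeff]

/-- The maps `δ`: `z ^ l * u a * z ^ (-l) = ∑ j, u (delta u z l j a) * z ^ j`. Thus
`delta u z l 0` is the power `α ^ l` of the automorphism `α` of the residue algebra induced by
conjugation with `z`. -/
noncomputable def delta (u : Residue k D →+* (val k D).integer) (z : D) (l : ℤ) (j : ℕ)
    (a : Residue k D) : Residue k D :=
  coeff u z (z ^ l * (u a : D) * z ^ (-l)) j

/-- Each of the maps `delta u z l j` on the centre of the residue algebra is determined by its
values on the powers of `s`. -/
def DeltaDetermined (u : Residue k D →+* (val k D).integer) (s : Residue k D) : Prop :=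
  ∀ (z z' : D) (l l' : ℤ) (j j' : ℕ), IsParameter k z → IsParameter k z' →
    (∀ n : ℕ, delta u z l j (s ^ n) = delta u z' l' j' (s ^ n)) →
    ∀ a ∈ ResidueCenter k D, delta u z l j a = delta u z' l' j' a

/-- The local height: `i` is the minimum of `w (z * u a * z⁻¹ - u a)` over all `a`, where `w` is
normalised by `w (z) = 1`. -/
def IsLocalHeight (u : Residue k D →+* (val k D).integer) (z : D) (i : ℕ) : Prop :=
  (∀ a, val k D (z * (u a : D) * z⁻¹ - u a) ≤ val k D z ^ i) ∧
    ∃ a, val k D (z * (u a : D) * z⁻¹ - u a) = val k D z ^ i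

/-- `z` is an appropriate parameter, of local height `i`: conjugation by `z` is trivial on the
residue algebra, and `delta u z 1 i` is nonzero on its centre. -/
def IsAppropriate (u : Residue k D →+* (val k D).integer) (z : D) (i : ℕ) : Prop :=
  IsParameter k z ∧ (∀ a, delta u z 1 0 a = a) ∧ IsLocalHeight u z i ∧
    ∃ a ∈ ResidueCenter k D, delta u z 1 i a ≠ 0

/-- The semilocal height of `u`: the local height for an appropriate parameter. -/
def IsSemilocalHeight (u : Residue k D →+* (val k D).integer) (i : ℕ) : Prop :=
  ∃ z, IsAppropriate u z i

/-- The set `u(D̄)((y))` of the sums of all series `∑ j ≥ 0, u (c j) * y ^ (N + j)`. -/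
def laurentSet (u : Residue k D →+* (val k D).integer) (y : D) : Set D :=
  {x | ∃ (N : ℤ) (c : ℕ → Residue k D), ∀ n : ℕ,
    val k D (x - ∑ j ∈ Finset.range n, (u (c j) : D) * y ^ (N + j)) ≤ val k D y ^ (N + n)}

/-- The centre of the `F`-algebra `A` is (isomorphic over `F` to) a cyclic Galois field
extension of `F` of degree `n`. -/
def HasCyclicGaloisCenter (F : Type*) [Field F] (A : Type v) [Ring A] [Algebra F A] (n : ℕ) :
    Prop :=
  ∃ (E : Type v) (_ : Field E) (_ : Algebra F E),
    Nonempty (E ≃ₐ[F] Subalgebra.center F A) ∧ IsGalois F E ∧ IsCyclic Gal(E/F) ∧ finrank F E = n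

end

end SplitAlg

/-! Write `F = k⸨X⸩`, `D̄` for the residue algebra, `Z̄` for its centre, `e` and `f` for the
ramification index and residue degree. Everything rests on `[C : F] = e f` for subalgebras `C` of
`D`, on completeness of `D`, and on the dimension formula `[B : F] [C(B) : F] = [D : F]` for
centralizers.

Equality of `[Z̄ : k]` and `e`. The field `F(u(Z̄))` has degree at least `[Z̄ : k]` and its
centralizer contains `u(D̄)`, so `[Z̄ : k] ≤ e`. Conversely, Jacobson-Noether gives a separable `θ`
in `D̄` with commutative centralizer; a lift of `θ` by Hensel's lemma and bounds for commutative
subalgebras of `D` and of `D̄` give `e ≤ [Z̄ : k]`. A consequence is that the centralizer of `u(Z̄)`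
is unramified over `F`.

An embedding determined by `s`. Let `u₀` be any embedding. In this unramified centralizer a constant
`c` expands as `∑ u₀(c_j) X ^ j` with `c_j` in `Z̄`. Choose `b_i` in `k` whose differentials are
independent over `Z̄` and which, with `s` and `k ^ (p ^ N)`, generate `Z̄` for every `N`. A higher
derivation of `Z̄` sending each `b_i` to its expansion exists by formal smoothness, and extends to
`D̄` because the Hochschild obstructions of a central division algebra vanish. Composed with
evaluation at `X` it gives an embedding `u` that fixes all `b_i`. Each `δ_j` is then linear over the
`b_i` and over `k ^ (p ^ N)` for `p ^ N > j`, so its values on the powers of `s` determine it.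

The algebra in `z ^ n`. Let `θ` generate the separable closure of `k` in `Z̄`. Hensel's lemma lifts
`θ` to `x` with `F(x)` unramified and `u(D̄)` in `A = C(x)`. Counting values shows that a parameter
acts on `Z̄` with order exactly `n = deg θ`. A divided difference supplies a unit that corrects the
parameter so that it normalizes `F(x)`; its `n`-th power then commutes with `x` and generates the
values of `A`. Conjugation by it is an automorphism of `Z(A)` with fixed field `F`.

The algebra in `z ^ p`. Let `i` be the semilocal height, `p ∣ i`, and `δ = δ_i`, a derivation with
`δ s ≠ 0`. A parameter is improved until conjugation by it sends every `u a` to a series in `z ^ p`.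
The first offending coefficient `δ_J`, with `p ∤ J = m + i`, is a derivation. Replacing `z` by `z (1
+ u(b) z ^ m)`, with `b` in `Z̄`, adds `m b δ` to it, and `m` is invertible, so `δ_J s` can be made
zero. As `u` is determined by `s`, `δ_J` then vanishes on `Z̄`, hence is inner
(`exists_eq_commutator`), and a factor `1 - u(c) z ^ J` removes it (`IsNormal.exists_succ`). The
parameters converge (`IsNormal.exists_forall`). Elements commuting with `u s` turn out to be series
in `z ^ p` (`mem_powSpanMod_of_commute`), so `F` and the centralizer of the algebra lie in it; the
Galois argument is the same as before (`hasCyclicGaloisCenter_of_conj`). -/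

namespace SplitAlg

/-! ### Two-sided multiplications and centralizers in central division algebras -/

section Centralizer

variable {F D : Type*} [Field F] [DivisionRing D] [Algebra F D]

/-- Artin's independence of two-sided multiplications. -/
theorem eq_zero_of_sum_mul_mul_eq_zero [Algebra.IsCentral F D] {ι : Type*} (x : ι → D)
    (hx : LinearIndependent F x) (s : Finset ι) (y : ι → D)
    (h : ∀ d, ∑ i ∈ s, x i * d * y i = 0) : ∀ i ∈ s, y i = 0 := by
  classical
  induction s using Finset.induction_on generalizing y with
  | empty => simp
  | insert a s ha ih =>
    have key : y a = 0 := by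
      by_contra hya
      -- With the coefficient of `x a` normalised to `1`, the relation at `d * c` minus the relation
      -- at `d` times `c` is shorter. By induction the normalised coefficients commute with every
      -- `c`, so they lie in `F`, and `d = 1` contradicts independence.
      have h1 : ∀ d, x a * d + ∑ i ∈ s, x i * d * (y i * (y a)⁻¹) = 0 := by
        intro d
        have := congrArg (· * (y a)⁻¹) (h d)
        simpa [Finset.sum_insert ha, add_mul, Finset.sum_mul, mul_assoc, hya] using this
      have h2 : ∀ c, ∀ i ∈ s, c * (y i * (y a)⁻¹) - (y i * (y a)⁻¹) * c = 0 := by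
        intro c
        apply ih
        intro d
        have e1 := h1 (d * c)
        have e2 := congrArg (· * c) (h1 d)
        simp only [add_mul, zero_mul, Finset.sum_mul] at e2
        rw [← sub_eq_zero.2 (e1.trans e2.symm), mul_assoc (x a) d c, add_sub_add_left_eq_sub,
          ← Finset.sum_sub_distrib]
        refine Finset.sum_congr rfl fun i _ => ?_
        simp only [mul_sub, mul_assoc]
      have h3 : ∀ i ∈ s, ∃ f : F, algebraMap F D f = y i * (y a)⁻¹ := by
        intro i hi
        have : y i * (y a)⁻¹ ∈ Subalgebra.center F D := by
          rw [Subalgebra.mem_center_iff]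
          intro c
          exact sub_eq_zero.1 (h2 c i hi)
        exact Algebra.mem_bot.1 (Algebra.IsCentral.out this)
      choose! f hf using h3
      have h4 := h1 1
      have h5 : ∑ i ∈ insert a s, (if i = a then 1 else f i) • x i = 0 := by
        rw [Finset.sum_insert ha, ← h4]
        simp only [if_true, one_smul, mul_one]
        congr 1
        refine Finset.sum_congr rfl fun i hi => ?_
        rw [if_neg (by rintro rfl; exact ha hi), ← hf i hi, Algebra.smul_def, Algebra.commutes]
      have := linearIndependent_iff'.1 hx _ _ h5 a (Finset.mem_insert_self _ _)
      simp at this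
    intro i hi
    rcases Finset.mem_insert.1 hi with rfl | hi
    · exact key
    · refine ih y (fun d => ?_) i hi
      simpa [Finset.sum_insert ha, key] using h d

/-- The left factors of a sum of two-sided multiplications are unique, when the right factors form
a basis. -/
theorem eq_of_sum_mul_mul_eq [Algebra.IsCentral F D] {ι : Type*} [Fintype ι] (y : Basis ι F D)
    (x x' : ι → D) (h : ∀ d, ∑ i, x i * d * y i = ∑ i, x' i * d * y i) : x = x' := by
  -- Expanding the differences of the left factors in the basis puts independent elements on the
  -- left, where Artin's lemma applies.
  have h0 : ∀ d, ∑ j, y j * d * (∑ i, (y.repr (x i - x' i) j) • y i) = 0 := by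
    intro d
    have h1 : ∑ i, (x i - x' i) * d * y i = 0 := by
      simp only [sub_mul, Finset.sum_sub_distrib, h d, sub_self]
    rw [← h1]
    simp only [Finset.mul_sum]
    rw [Finset.sum_comm]
    refine Finset.sum_congr rfl fun i _ => ?_
    conv_rhs => rw [← y.sum_repr (x i - x' i)]
    rw [Finset.sum_mul, Finset.sum_mul]
    refine Finset.sum_congr rfl fun j _ => ?_
    simp
  have h2 := eq_zero_of_sum_mul_mul_eq_zero y y.linearIndependent Finset.univ _ h0
  ext i
  rw [← sub_eq_zero, ← y.sum_repr (x i - x' i)]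
  refine Finset.sum_eq_zero fun j _ => ?_
  have h3 := Fintype.linearIndependent_iff.1 y.linearIndependent _ (h2 j (Finset.mem_univ j)) i
  rw [h3, zero_smul]

variable [FiniteDimensional F D] [Algebra.IsCentral F D]

/-- Every linear endomorphism of a central division algebra is a sum of two-sided
multiplications. -/
theorem exists_eq_sum_mul_mul {ι : Type*} [Fintype ι] (y : Basis ι F D) (f : D →ₗ[F] D) :
    ∃ x : ι → D, ∀ d, f d = ∑ i, x i * d * y i := by
  let T : (ι → D) →ₗ[F] (D →ₗ[F] D) :=
    { toFun := fun x => ∑ i, (LinearMap.mulLeft F (x i)).comp (LinearMap.mulRight F (y i))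
      map_add' := fun a b => by
        ext d; simp [add_mul, Finset.sum_add_distrib]
      map_smul' := fun c a => by
        ext d; simp [Finset.smul_sum] }
  have hT : ∀ x d, T x d = ∑ i, x i * d * y i := fun x d => by simp [T, mul_assoc]
  have hinj : Function.Injective T := by
    intro x x' hx
    exact eq_of_sum_mul_mul_eq y x x' fun d => by rw [← hT, ← hT, hx]
  have hdim : finrank F (ι → D) = finrank F (D →ₗ[F] D) := by
    rw [Module.finrank_pi_fintype, Module.finrank_linearMap, Finset.sum_const, smul_eq_mul,
      Finset.card_univ, Module.finrank_eq_card_basis y]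
  obtain ⟨x, hx⟩ := (LinearMap.injective_iff_surjective_of_finrank_eq_finrank hdim).1 hinj f
  exact ⟨x, fun d => by rw [← hx, hT]⟩

/-- The dimension formula for centralizers. -/
theorem finrank_mul_finrank_centralizer (B : Subalgebra F D) :
    finrank F B * finrank F (Subalgebra.centralizer F (B : Set D)) = finrank F D := by
  classical
  let _ : DivisionRing B := divisionRingOfFiniteDimensional F B
  let _ : Module B D := inferInstance
  have : Module.Finite B D := Module.Finite.of_restrictScalars_finite F B D
  let C := Subalgebra.centralizer F (B : Set D)
  let y := Module.finBasis F D
  -- The space `End_B(D)` is computed twice: as `D ^ [D : B]`, and through `T` as `C ^ [D : F]`,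
  -- since a sum of two-sided multiplications is `B`-linear exactly when its left factors centralize
  -- `B`. Comparison gives `[C : F] = [D : B]`.
  let e1 : (Fin (finrank B D) → D) ≃ₗ[F] (D →ₗ[B] D) := (Module.finBasis B D).constr F
  let T : (Fin (finrank F D) → C) →ₗ[F] (D →ₗ[B] D) :=
    { toFun := fun x =>
        { toFun := fun d => ∑ i, (x i : D) * d * y i
          map_add' := fun a b => by simp [mul_add, add_mul, Finset.sum_add_distrib]
          map_smul' := fun b d => by
            simp only [RingHom.id_apply, Finset.smul_sum, Subalgebra.smul_def, smul_eq_mul]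
            refine Finset.sum_congr rfl fun i _ => ?_
            rw [← mul_assoc, ← mul_assoc, ← mul_assoc,
              ((Subalgebra.mem_centralizer_iff F).1 (x i).2 _ b.2)] }
      map_add' := fun a b => by
        ext d; simp [add_mul, Finset.sum_add_distrib]
      map_smul' := fun c a => by
        ext d; simp [Finset.smul_sum] }
  have hT : ∀ x d, T x d = ∑ i, (x i : D) * d * y i := fun _ _ => rfl
  have hbij : Function.Bijective T := by
    constructor
    · intro x x' h
      have := eq_of_sum_mul_mul_eq y (fun i => x i) (fun i => x' i) (fun d => by rw [← hT, ← hT, h])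
      funext i
      exact Subtype.ext (congrFun this i)
    · intro f
      obtain ⟨x, hx⟩ := exists_eq_sum_mul_mul y (f.restrictScalars F)
      have hx' : ∀ d, f d = ∑ i, x i * d * y i := hx
      have hc : ∀ i, x i ∈ C := by
        intro i
        rw [Subalgebra.mem_centralizer_iff]
        intro b hb
        have := eq_of_sum_mul_mul_eq y (fun i => b * x i) (fun i => x i * b) (fun d => by
          have e := f.map_smul ⟨b, hb⟩ d
          rw [Subalgebra.smul_def, Subalgebra.smul_def, smul_eq_mul, smul_eq_mul, hx', hx',
            Finset.mul_sum] at e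
          simp only [mul_assoc] at e ⊢
          exact e.symm)
        exact congrFun this i
      refine ⟨fun i => ⟨x i, hc i⟩, ?_⟩
      ext d
      rw [hT, hx']
  have h1 := (LinearEquiv.ofBijective T hbij).finrank_eq
  rw [← e1.finrank_eq, Module.finrank_pi_fintype, Module.finrank_pi_fintype] at h1
  simp only [Finset.sum_const, Finset.card_univ, Fintype.card_fin, smul_eq_mul] at h1
  have h2 : finrank F B * finrank B D = finrank F D := Module.finrank_mul_finrank F B D
  have h3 : 0 < finrank F D := finrank_pos
  have h4 : finrank F C = finrank B D := by
    apply Nat.eq_of_mul_eq_mul_left h3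
    rw [h1, mul_comm]
  rw [h4, h2]

/-- A commutative subalgebra is contained in its own centralizer. -/
theorem finrank_sq_le_of_commute (K : Subalgebra F D) (hK : ∀ x ∈ K, ∀ y ∈ K, x * y = y * x) :
    finrank F K ^ 2 ≤ finrank F D := by
  rw [← finrank_mul_finrank_centralizer K, sq]
  refine Nat.mul_le_mul_left _ (Submodule.finrank_mono (R := F)
    (s := Subalgebra.toSubmodule K)
    (t := Subalgebra.toSubmodule (Subalgebra.centralizer F (K : Set D))) ?_)
  intro x hx
  exact (Subalgebra.mem_centralizer_iff F).2 fun y hy => hK y hy x hx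

end Centralizer

/-! ### Separability idempotents and inner derivations -/

section Separable

variable {F D : Type*} [Field F] [DivisionRing D] [Algebra F D] [FiniteDimensional F D]
  [Algebra.IsCentral F D]

/-- A central division algebra has a separability idempotent: `∑ a i ⊗ b i`, with the elements
`b i` forming a basis; the second condition is phrased with bilinear maps. -/
theorem exists_separabilityIdempotent : ∃ (n : ℕ) (a b : Fin n → D), ∑ i, a i * b i = 1 ∧
    ∀ (G : Type v) [AddCommGroup G] [Module F G] (B : D →ₗ[F] D →ₗ[F] G) (x : D),
      ∑ i, B (x * a i) (b i) = ∑ i, B (a i) (b i * x) := by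
  classical
  let y := Module.finBasis F D
  obtain ⟨π, hπ⟩ : ∃ π : D →ₗ[F] F, π 1 = 1 := by
    obtain ⟨f, hf⟩ := Module.Projective.exists_dual_ne_zero F (one_ne_zero (α := D))
    exact ⟨(f 1)⁻¹ • f, by simp [hf]⟩
  -- A projection `π` onto the scalars is written as `d ↦ ∑ a i * d * y i`. Its value at `1` gives
  -- the normalisation, and `x * π d = π d * x` gives the exchange property by uniqueness of left
  -- factors.
  obtain ⟨a, ha⟩ := exists_eq_sum_mul_mul y ((Algebra.linearMap F D).comp π)
  refine ⟨_, a, y, by simpa [hπ] using (ha 1).symm, ?_⟩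
  intro G _ _ B x
  -- expand `y i * x` in the basis
  have h1 : ∀ j, x * a j = ∑ i, y.repr (y i * x) j • a i := by
    refine congrFun (eq_of_sum_mul_mul_eq y _ _ fun d => ?_)
    have e1 : x * ∑ j, a j * d * y j = (∑ j, a j * d * y j) * x := by
      rw [← ha d]; simp [Algebra.commutes]
    rw [Finset.mul_sum, Finset.sum_mul] at e1
    simp only [mul_assoc, Finset.sum_mul] at e1 ⊢
    rw [Finset.sum_comm, e1]
    refine Finset.sum_congr rfl fun i _ => ?_
    conv_lhs => rw [← y.sum_repr (y i * x)]
    simp only [Finset.mul_sum, smul_mul_assoc, mul_smul_comm]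
  simp only [h1, map_sum, LinearMap.sum_apply, map_smul, LinearMap.smul_apply]
  rw [Finset.sum_comm]
  refine Finset.sum_congr rfl fun i _ => ?_
  conv_rhs => rw [← y.sum_repr (y i * x)]
  simp only [map_sum, map_smul]

/-- Derivations of a central division algebra are inner. -/
theorem exists_eq_commutator (d : D →ₗ[F] D) (hd : ∀ x y, d (x * y) = x * d y + d x * y) :
    ∃ c, ∀ x, d x = c * x - x * c := by
  obtain ⟨n, a, b, h1, h2⟩ := exists_separabilityIdempotent (F := F) (D := D)
  refine ⟨∑ i, d (a i) * b i, fun x => ?_⟩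
  have h3 := h2 D ((LinearMap.mul F D).comp d) x
  simp only [LinearMap.comp_apply, LinearMap.mul_apply', hd, add_mul, Finset.sum_add_distrib] at h3
  have h4 : ∑ i, d x * a i * b i = d x := by
    simp only [mul_assoc, ← Finset.mul_sum, h1, mul_one]
  rw [h4] at h3
  rw [Finset.sum_mul, Finset.mul_sum, eq_sub_iff_add_eq']
  simp only [← mul_assoc] at h3 ⊢
  exact h3

end Separable

end SplitAlg

namespace SplitAlg

/-! ### Extension of higher derivations from the centre -/

section HasseSchmidt

theorem coeff_mul_of_coeff_right_eq_zero {R : Type*} [Semiring R] {n : ℕ} {g : PowerSeries R}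
    (hg : ∀ m < n, PowerSeries.coeff m g = 0) (w : PowerSeries R) :
    PowerSeries.coeff n (w * g) = PowerSeries.coeff 0 w * PowerSeries.coeff n g := by
  rw [PowerSeries.coeff_mul, Finset.sum_eq_single (0, n)]
  · rintro ⟨i, j⟩ hij hne
    rw [Finset.HasAntidiagonal.mem_antidiagonal] at hij
    have : j < n := by
      rcases Nat.eq_zero_or_pos i with rfl | hi
      · exact absurd (by simpa using hij) hne
      · simp only at hij; omega
    simp [hg j this]
  · intro h; simp at h

theorem coeff_mul_of_coeff_left_eq_zero {R : Type*} [Semiring R] {n : ℕ} {g : PowerSeries R}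
    (hg : ∀ m < n, PowerSeries.coeff m g = 0) (w : PowerSeries R) :
    PowerSeries.coeff n (g * w) = PowerSeries.coeff n g * PowerSeries.coeff 0 w := by
  rw [PowerSeries.coeff_mul, Finset.sum_eq_single (n, 0)]
  · rintro ⟨i, j⟩ hij hne
    rw [Finset.HasAntidiagonal.mem_antidiagonal] at hij
    have : i < n := by
      rcases Nat.eq_zero_or_pos j with rfl | hi
      · exact absurd (by simpa using hij) hne
      · simp only at hij; omega
    simp [hg i this]
  · intro h; simp at h

theorem coeff_mul_congr {R : Type*} [Semiring R] {n : ℕ} {f f' g g' : PowerSeries R}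
    (hf : ∀ m ≤ n, PowerSeries.coeff m f = PowerSeries.coeff m f') (hg : ∀ m ≤ n, PowerSeries.coeff m g = PowerSeries.coeff m g') :
    PowerSeries.coeff n (f * g) = PowerSeries.coeff n (f' * g') := by
  rw [PowerSeries.coeff_mul, PowerSeries.coeff_mul]
  refine Finset.sum_congr rfl fun ij hij => ?_
  rw [Finset.HasAntidiagonal.mem_antidiagonal] at hij
  rw [hf _ (by omega), hg _ (by omega)]

variable {Z D : Type*} [Field Z] [DivisionRing D] [Algebra Z D]

theorem map_algebraMap_mul_comm (f : PowerSeries Z) (g : PowerSeries D) :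
    PowerSeries.map (algebraMap Z D) f * g = g * PowerSeries.map (algebraMap Z D) f := by
  ext n
  rw [PowerSeries.coeff_mul, PowerSeries.coeff_mul, ← Finset.Nat.sum_antidiagonal_swap]
  refine Finset.sum_congr rfl fun ij _ => ?_
  simp [Algebra.commutes]

/-- `U` extends the family of higher derivations `V` of `Z` and is multiplicative modulo
`X ^ n`. -/
structure IsHasseSchmidtMod (V : Z →+* PowerSeries Z) (U : D →+ PowerSeries D) (n : ℕ) :
    Prop where
  coeff_zero : ∀ x, PowerSeries.coeff 0 (U x) = x
  smul : ∀ z x, U (z • x) = PowerSeries.map (algebraMap Z D) (V z) * U x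
  mul : ∀ x y, ∀ m < n, PowerSeries.coeff m (U (x * y)) = PowerSeries.coeff m (U x * U y)

/-- The semilinear map with given values on a basis. -/
noncomputable def semilinearExt {ι : Type*} [Fintype ι] (V : Z →+* PowerSeries Z)
    (y : Basis ι Z D) (h : ι → PowerSeries D) : D →+ PowerSeries D where
  toFun x := ∑ i, PowerSeries.map (algebraMap Z D) (V (y.repr x i)) * h i
  map_zero' := by simp
  map_add' a b := by simp [add_mul, Finset.sum_add_distrib]

theorem semilinearExt_apply {ι : Type*} [Fintype ι] (V : Z →+* PowerSeries Z)
    (y : Basis ι Z D) (h : ι → PowerSeries D) (x : D) :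
    semilinearExt V y h x = ∑ i, PowerSeries.map (algebraMap Z D) (V (y.repr x i)) * h i := rfl

theorem semilinearExt_smul {ι : Type*} [Fintype ι] (V : Z →+* PowerSeries Z)
    (y : Basis ι Z D) (h : ι → PowerSeries D) (z : Z) (x : D) :
    semilinearExt V y h (z • x) =
      PowerSeries.map (algebraMap Z D) (V z) * semilinearExt V y h x := by
  simp [semilinearExt_apply, Finset.mul_sum, mul_assoc]

theorem coeff_semilinearExt {ι : Type*} [Fintype ι] {V : Z →+* PowerSeries Z}
    (hV : ∀ z, PowerSeries.constantCoeff (V z) = z) (y : Basis ι Z D) {h : ι → PowerSeries D} {n : ℕ}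
    (g : D →ₗ[Z] D) (h0 : ∀ i, ∀ m < n, PowerSeries.coeff m (h i) = 0) (h1 : ∀ i, PowerSeries.coeff n (h i) = g (y i))
    (x : D) :
    (∀ m < n, PowerSeries.coeff m (semilinearExt V y h x) = 0) ∧ PowerSeries.coeff n (semilinearExt V y h x) = g x := by
  constructor
  · intro m hm
    rw [semilinearExt_apply, map_sum]
    refine Finset.sum_eq_zero fun i _ => ?_
    rw [coeff_mul_of_coeff_right_eq_zero (fun m' hm' => h0 i m' (hm'.trans hm)), h0 i m hm,
      mul_zero]
  · rw [semilinearExt_apply, map_sum]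
    conv_rhs => rw [← y.sum_repr x]
    rw [map_sum]
    refine Finset.sum_congr rfl fun i _ => ?_
    rw [coeff_mul_of_coeff_right_eq_zero (h0 i), h1 i, map_smul, Algebra.smul_def]
    simp [hV]

variable [FiniteDimensional Z D]

theorem exists_isHasseSchmidtMod_zero {V : Z →+* PowerSeries Z}
    (hV : ∀ z, PowerSeries.constantCoeff (V z) = z) : ∃ U : D →+ PowerSeries D, IsHasseSchmidtMod V U 0 := by
  refine ⟨semilinearExt V (Module.finBasis Z D) fun i => PowerSeries.C (Module.finBasis Z D i), ?_,
    semilinearExt_smul V _ _, fun _ _ _ hm => absurd hm (Nat.not_lt_zero _)⟩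
  intro x
  exact (coeff_semilinearExt hV (Module.finBasis Z D) (n := 0) LinearMap.id
    (fun _ _ hm => absurd hm (Nat.not_lt_zero _)) (fun i => by simp) x).2

/-- The first coefficient of the failure of multiplicativity, `U x * U y - U (x * y)`, is a bilinear
Hochschild 2-cocycle. Cocycles of a central division algebra are coboundaries, and subtracting a
semilinear map with the bounding cochain as leading coefficient removes the failure. -/
theorem IsHasseSchmidtMod.exists_succ [Algebra.IsCentral Z D] {V : Z →+* PowerSeries Z}
    (hV : ∀ z, PowerSeries.constantCoeff (V z) = z) {U : D →+ PowerSeries D} {n : ℕ}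
    (hU : IsHasseSchmidtMod V U n) (hn : n ≠ 0) : ∃ U' : D →+ PowerSeries D,
      IsHasseSchmidtMod V U' (n + 1) ∧ ∀ x, ∀ m < n, PowerSeries.coeff m (U' x) = PowerSeries.coeff m (U x) := by
  let E : D → D → PowerSeries D := fun x y => U x * U y - U (x * y)
  have hE : ∀ x y, ∀ m < n, PowerSeries.coeff m (E x y) = 0 := fun x y m hm => by
    simp only [E, map_sub, hU.mul x y m hm, sub_self]
  have cVz : ∀ z, PowerSeries.coeff 0 (PowerSeries.map (algebraMap Z D) (V z)) = algebraMap Z D z := by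
    intro z; simp [hV]
  let f : D →ₗ[Z] D →ₗ[Z] D := LinearMap.mk₂ Z (fun x y => PowerSeries.coeff n (E x y))
    (fun a b c => by simp only [E, map_add, add_mul, map_sub]; abel)
    (fun z a b => by
      have : E (z • a) b = PowerSeries.map (algebraMap Z D) (V z) * E a b := by
        simp only [E, hU.smul, smul_mul_assoc, mul_sub, mul_assoc]
      rw [this, coeff_mul_of_coeff_right_eq_zero (hE a b), cVz, Algebra.smul_def])
    (fun a b c => by simp only [E, map_add, mul_add, map_sub]; abel)
    (fun z a b => by
      have : E a (z • b) = PowerSeries.map (algebraMap Z D) (V z) * E a b := by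
        simp only [E, hU.smul, mul_smul_comm, mul_sub]
        rw [← mul_assoc, ← mul_assoc, map_algebraMap_mul_comm _ (U a)]
      rw [this, coeff_mul_of_coeff_right_eq_zero (hE a b), cVz, Algebra.smul_def])
  have hf : ∀ x y, f x y = PowerSeries.coeff n (E x y) := fun _ _ => rfl
  have cocycle : ∀ x y w, x * f y w - f (x * y) w + f x (y * w) - f x y * w = 0 := by
    intro x y w
    have e : U x * E y w - E (x * y) w + E x (y * w) - E x y * U w = 0 := by
      simp only [E, mul_sub, sub_mul, mul_assoc]; abel
    have e' := congrArg (PowerSeries.coeff n) e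
    simp only [map_sub, map_add, coeff_mul_of_coeff_right_eq_zero (hE y w),
      coeff_mul_of_coeff_left_eq_zero (hE x y), hU.coeff_zero, map_zero] at e'
    simpa only [hf, map_sub] using e'
  -- Contracting the cocycle with the separability idempotent, `g x = ∑ a i * f (b i) x`, bounds it.
  obtain ⟨N, a, b, hab, hsep⟩ := exists_separabilityIdempotent (F := Z) (D := D)
  let g : D →ₗ[Z] D := ∑ i, (LinearMap.mulLeft Z (a i)).comp (f (b i))
  have hg : ∀ x, g x = ∑ i, a i * f (b i) x := fun x => by simp [g]
  have hfg : ∀ x y, f x y = x * g y + g x * y - g (x * y) := by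
    intro x y
    have e1 := hsep D ((LinearMap.mul Z D).compl₂ (f.flip y)) x
    simp only [LinearMap.compl₂_apply, LinearMap.mul_apply', LinearMap.flip_apply] at e1
    have e2 : ∑ i, a i * (b i * f x y - f (b i * x) y + f (b i) (x * y) - f (b i) x * y) = 0 :=
      Finset.sum_eq_zero fun i _ => by rw [cocycle, mul_zero]
    simp only [mul_sub, mul_add, Finset.sum_sub_distrib, Finset.sum_add_distrib, ← mul_assoc,
      ← Finset.sum_mul, hab, one_mul] at e2
    rw [← e1] at e2
    simp only [hg, Finset.mul_sum, ← mul_assoc]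
    rw [sub_eq_zero] at e2
    rw [Finset.sum_mul] at e2 ⊢
    rw [← e2]
    abel
  let y := Module.finBasis Z D
  let h : Fin (finrank Z D) → PowerSeries D := fun i => PowerSeries.monomial n (g (y i))
  have hh := coeff_semilinearExt hV y (h := h) (n := n) g
    (fun i m hm => by simp [h, PowerSeries.coeff_monomial, hm.ne]) (fun i => by simp [h])
  refine ⟨U - semilinearExt V y h, ⟨?_, ?_, ?_⟩, ?_⟩
  · intro x
    rw [AddMonoidHom.sub_apply, map_sub, hU.coeff_zero, (hh x).1 0 (Nat.pos_of_ne_zero hn),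
      sub_zero]
  · intro z x
    rw [AddMonoidHom.sub_apply, hU.smul, semilinearExt_smul, ← mul_sub, AddMonoidHom.sub_apply]
  · intro x w m hm
    have low : ∀ x, ∀ m < n, PowerSeries.coeff m ((U - semilinearExt V y h) x) = PowerSeries.coeff m (U x) := by
      intro x m hm
      rw [AddMonoidHom.sub_apply, map_sub, (hh x).1 m hm, sub_zero]
    rcases Nat.lt_succ_iff_lt_or_eq.1 hm with hm | rfl
    · rw [low _ m hm, hU.mul x w m hm]
      exact coeff_mul_congr (fun i hi => (low x i (by omega)).symm)
        (fun i hi => (low w i (by omega)).symm)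
    · simp only [AddMonoidHom.sub_apply]
      rw [sub_mul, mul_sub, map_sub, map_sub, map_sub, (hh _).2, mul_sub, map_sub,
        coeff_mul_of_coeff_right_eq_zero (hh w).1, coeff_mul_of_coeff_left_eq_zero (hh x).1,
        coeff_mul_of_coeff_left_eq_zero (hh x).1, (hh w).1 0 (Nat.pos_of_ne_zero hn),
        hU.coeff_zero, hU.coeff_zero, (hh x).2, (hh w).2, mul_zero, sub_zero]
      have e := hfg x w
      rw [hf] at e
      simp only [E, map_sub] at e
      rw [sub_eq_iff_eq_add] at e
      rw [e]
      abel
  · intro x m hm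
    rw [AddMonoidHom.sub_apply, map_sub, (hh x).1 m hm, sub_zero]

/-- A higher derivation of the centre extends to the division algebra. -/
theorem exists_hasseSchmidt_extension [Algebra.IsCentral Z D] {V : Z →+* PowerSeries Z}
    (hV : ∀ z, PowerSeries.constantCoeff (V z) = z) : ∃ U : D →+* PowerSeries D,
      (∀ x, PowerSeries.constantCoeff (U x) = x) ∧
      ∀ z, U (algebraMap Z D z) = PowerSeries.map (algebraMap Z D) (V z) := by
  obtain ⟨U0, hU0⟩ := exists_isHasseSchmidtMod_zero (D := D) hV
  -- Modulo `X` multiplicativity is automatic, since `U0` has constant term the identity. Starting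
  -- at `1` provides the condition `n ≠ 0` of the inductive step.
  have hU1 : IsHasseSchmidtMod V U0 1 := ⟨hU0.1, hU0.2, fun x y m hm => by
    obtain rfl : m = 0 := by omega
    rw [coeff_mul_of_coeff_right_eq_zero (by omega), hU0.1, hU0.1, hU0.1]⟩
  choose nxt hnxt using fun (n : ℕ) (U : {U : D →+ PowerSeries D // IsHasseSchmidtMod V U (n + 1)}) =>
    U.2.exists_succ hV (Nat.succ_ne_zero n)
  let S : ∀ n : ℕ, {U : D →+ PowerSeries D // IsHasseSchmidtMod V U (n + 1)} := fun n =>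
    Nat.rec ⟨U0, hU1⟩ (fun n U => ⟨nxt n U, (hnxt n U).1⟩) n
  have hS : ∀ n x, ∀ m < n + 1, PowerSeries.coeff m ((S (n + 1)).1 x) = PowerSeries.coeff m ((S n).1 x) :=
    fun n => (hnxt n (S n)).2
  have hS' : ∀ m d x, PowerSeries.coeff m ((S (m + d)).1 x) = PowerSeries.coeff m ((S m).1 x) := by
    intro m d x
    induction d with
    | zero => rfl
    | succ d ih => rw [← add_assoc, hS (m + d) x m (by omega), ih]
  -- The coefficients of order at most `m` no longer change after stage `m`, so the diagonal is the
  -- limit.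
  let T : D → PowerSeries D := fun x => PowerSeries.mk fun m => PowerSeries.coeff m ((S m).1 x)
  have hT : ∀ n x, ∀ m ≤ n, PowerSeries.coeff m (T x) = PowerSeries.coeff m ((S n).1 x) := by
    intro n x m hm
    obtain ⟨d, rfl⟩ := Nat.exists_eq_add_of_le hm
    rw [hS', PowerSeries.coeff_mk]
  have Tadd : ∀ x y, T (x + y) = T x + T y := fun x y => by ext m; simp [T]
  have Tmul : ∀ x y, T (x * y) = T x * T y := by
    intro x y
    ext m
    rw [hT m _ m le_rfl, (S m).2.mul x y m (Nat.lt_succ_self m)]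
    exact coeff_mul_congr (fun i hi => (hT m x i hi).symm) (fun i hi => (hT m y i hi).symm)
  have T0 : ∀ x, PowerSeries.constantCoeff (T x) = x := by
    intro x
    rw [← PowerSeries.coeff_zero_eq_constantCoeff_apply, hT 0 x 0 le_rfl, (S 0).2.coeff_zero]
  -- Unitality is not part of the approximations; it follows by cancelling the nonzero idempotent `T
  -- 1` in a domain.
  have Tone : T 1 = 1 := by
    have h1 : T 1 * T 1 = T 1 * 1 := by rw [← Tmul, mul_one, mul_one]
    have h2 : T 1 ≠ 0 := fun h => by simpa [h] using T0 1
    exact mul_left_cancel₀ h2 h1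
  let U : D →+* PowerSeries D :=
    { toFun := T
      map_one' := Tone
      map_mul' := Tmul
      map_zero' := by simpa using Tadd 0 0
      map_add' := Tadd }
  refine ⟨U, T0, fun z => ?_⟩
  have h1 : T (z • 1) = PowerSeries.map (algebraMap Z D) (V z) * T 1 := by
    ext m
    rw [hT m _ m le_rfl, (S m).2.smul]
    exact coeff_mul_congr (fun i hi => rfl) (fun i hi => (hT m 1 i hi).symm)
  rw [Tone, mul_one] at h1
  rw [← h1, Algebra.smul_def, mul_one]
  rfl

end HasseSchmidt

end SplitAlg

namespace SplitAlg

/-! ### Formal smoothness and prescribed higher derivations of fields -/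

section Smooth

open KaehlerDifferential TensorProduct

/-- The differentials of the variables form a basis, and the coordinates of `D f` are the partial
derivatives of `f`. -/
theorem one_tmul_D_eq_zero_iff {R σ A : Type*} [CommRing R] [CommRing A]
    [Algebra (MvPolynomial σ R) A] (f : MvPolynomial σ R) :
    (1 : A) ⊗ₜ[MvPolynomial σ R] D R (MvPolynomial σ R) f = 0 ↔
      ∀ i, algebraMap (MvPolynomial σ R) A (MvPolynomial.pderiv i f) = 0 := by
  rw [← ((mvPolynomialBasis R σ).baseChange A).repr.map_eq_zero_iff, Finsupp.ext_iff]
  refine forall_congr' fun i => ?_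
  rw [Basis.baseChange_repr_tmul, mvPolynomialBasis_repr_apply, Algebra.smul_def, mul_one]
  rfl

/-- Arbitrary extensions of a perfect field are formally smooth. -/
theorem formallySmooth_of_perfectField (K L : Type*) [Field K] [PerfectField K] [Field L]
    [Algebra K L] : Algebra.FormallySmooth K L := by
  refine ⟨inferInstance, ?_⟩
  let _ : Algebra (MvPolynomial L K) L := (MvPolynomial.aeval (id : L → L)).toAlgebra
  have ha : ∀ f, algebraMap (MvPolynomial L K) L f = MvPolynomial.aeval (id : L → L) f :=
    fun _ => rfl
  have : IsScalarTower K (MvPolynomial L K) L :=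
    IsScalarTower.of_algebraMap_eq fun c => by rw [ha, MvPolynomial.algebraMap_eq]; simp
  have hsurj : Function.Surjective (algebraMap (MvPolynomial L K) L) := fun x =>
    ⟨MvPolynomial.X x, by simp [ha]⟩
  -- For the presentation with one variable per element of `L`, the claim is that a relation whose
  -- partial derivatives all vanish in `L` lies in the square of the ideal of relations. A relation
  -- involves finitely many variables, so it comes from a finitely generated subfield `L0`, which is
  -- known to be formally smooth; the conclusion is then carried back to `L`.
  rw [← Algebra.FormallySmooth.kerCotangentToTensor_injective_iff hsurj,
    injective_iff_map_eq_zero]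
  intro x hx
  obtain ⟨⟨f, hf⟩, rfl⟩ := Ideal.toCotangent_surjective _ x
  rw [Ideal.toCotangent_eq_zero]
  rw [kerCotangentToTensor_toCotangent, one_tmul_D_eq_zero_iff] at hx
  change f ∈ _
  change ∀ i, algebraMap _ L (MvPolynomial.pderiv i f) = 0 at hx
  rw [RingHom.mem_ker] at hf
  obtain ⟨S, q, rfl⟩ := MvPolynomial.exists_finset_rename f
  let L0 := IntermediateField.adjoin K (S : Set L)
  let j : S → L0 := fun x => ⟨x, IntermediateField.subset_adjoin K _ x.2⟩
  have : Algebra.EssFiniteType K L0 :=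
    IntermediateField.essFiniteType_iff.2 (IntermediateField.fg_adjoin_finset S)
  let _ : Algebra (MvPolynomial L0 K) L0 := (MvPolynomial.aeval (id : L0 → L0)).toAlgebra
  have ha0 : ∀ f, algebraMap (MvPolynomial L0 K) L0 f = MvPolynomial.aeval (id : L0 → L0) f :=
    fun _ => rfl
  have : IsScalarTower K (MvPolynomial L0 K) L0 :=
    IsScalarTower.of_algebraMap_eq fun c => by rw [ha0, MvPolynomial.algebraMap_eq]; simp
  have hsurj0 : Function.Surjective (algebraMap (MvPolynomial L0 K) L0) := fun x =>
    ⟨MvPolynomial.X x, by simp [ha0]⟩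
  have hinj := (Algebra.FormallySmooth.kerCotangentToTensor_injective_iff hsurj0).2
    (Algebra.FormallySmooth.of_perfectField (K := K) (L := L0)).subsingleton_h1Cotangent
  have hcomm : ∀ g : MvPolynomial L0 K,
      algebraMap (MvPolynomial L K) L (MvPolynomial.rename (Subtype.val : L0 → L) g) =
        (algebraMap (MvPolynomial L0 K) L0 g : L) := by
    intro g
    rw [ha, ha0, MvPolynomial.aeval_rename]
    have := MvPolynomial.map_aeval (id : L0 → L0) (algebraMap L0 L) g
    rw [← IntermediateField.algebraMap_apply, this]
    rfl
  have hren : MvPolynomial.rename (Subtype.val : S → L) q =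
      MvPolynomial.rename (Subtype.val : L0 → L) (MvPolynomial.rename j q) := by
    rw [MvPolynomial.rename_rename]; rfl
  set g := MvPolynomial.rename j q
  rw [hren] at hf hx ⊢
  have hg : g ∈ RingHom.ker (algebraMap (MvPolynomial L0 K) L0) := by
    rw [RingHom.mem_ker]
    rw [hcomm] at hf
    exact_mod_cast hf
  have h0 : kerCotangentToTensor K (MvPolynomial L0 K) L0 (Ideal.toCotangent _ ⟨g, hg⟩) = 0 := by
    rw [kerCotangentToTensor_toCotangent, one_tmul_D_eq_zero_iff]
    intro i
    have := hx (i : L)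
    rw [MvPolynomial.pderiv_rename Subtype.val_injective, hcomm] at this
    exact_mod_cast this
  have h1 := (injective_iff_map_eq_zero _).1 hinj _ h0
  rw [Ideal.toCotangent_eq_zero] at h1
  have h2 := Ideal.mem_map_of_mem (MvPolynomial.rename (R := K) (Subtype.val : L0 → L)) h1
  rw [Ideal.map_pow] at h2
  refine Ideal.pow_right_mono ?_ 2 h2
  rw [Ideal.map_le_iff_le_comap]
  intro r hr
  rw [RingHom.mem_ker] at hr
  rw [Ideal.mem_comap, RingHom.mem_ker, hcomm, hr]
  rfl

variable (p : ℕ) [Fact p.Prime] {Z : Type*} [Field Z] [Algebra (ZMod p) Z]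

/-- A higher derivation of a field may be prescribed on a family of elements with linearly
independent differentials. -/
theorem exists_hasseSchmidt_of_linearIndependent {ι : Type*} (b : ι → Z)
    (hb : LinearIndependent Z fun i => D (ZMod p) Z (b i)) (φ : ι → PowerSeries Z)
    (hφ : ∀ i, PowerSeries.constantCoeff (φ i) = b i) :
    ∃ V : Z →+* PowerSeries Z, (∀ z, PowerSeries.constantCoeff (V z) = z) ∧
      ∀ i, V (b i) = φ i := by
  let P := MvPolynomial ι (ZMod p)
  let _ : Algebra P Z := (MvPolynomial.aeval b).toAlgebra
  have ha : ∀ f : P, algebraMap P Z f = MvPolynomial.aeval b f := fun _ => rfl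
  have _ : IsScalarTower (ZMod p) P Z :=
    IsScalarTower.of_algebraMap_eq fun c => ((MvPolynomial.aeval b).commutes c).symm
  have hsm : Algebra.FormallySmooth (ZMod p) Z := formallySmooth_of_perfectField _ _
  have hinj : Function.Injective (mapBaseChange (ZMod p) P Z) := by
    let B := (mvPolynomialBasis (ZMod p) ι).baseChange Z
    have h1 : mapBaseChange (ZMod p) P Z =
        (Finsupp.linearCombination Z fun i => D (ZMod p) Z (b i)) ∘ₗ B.repr.toLinearMap := by
      refine B.ext fun i => ?_
      rw [LinearMap.comp_apply, LinearEquiv.coe_coe, Basis.repr_self,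
        Finsupp.linearCombination_single, one_smul, Basis.baseChange_apply,
        mvPolynomialBasis_apply, mapBaseChange_tmul, map_D, one_smul, ha]
      simp
    rw [h1]
    exact Function.Injective.comp (g := Finsupp.linearCombination Z _) hb B.repr.injective
  -- In the Jacobi-Zariski sequence of `ZMod p → P → Z`, injectivity of the map on differentials
  -- kills the connecting map, and the first cotangent homology of `Z` over `ZMod p` is zero.
  have hsmooth : Algebra.FormallySmooth P Z := by
    refine ⟨inferInstance, ⟨fun x y => ?_⟩⟩
    have hδ : ∀ x, Algebra.H1Cotangent.δ (ZMod p) P Z x = 0 := by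
      intro x
      apply hinj
      rw [map_zero]
      exact (Algebra.H1Cotangent.exact_δ_mapBaseChange (ZMod p) P Z).apply_apply_eq_zero x
    have h0 : ∀ x : Algebra.H1Cotangent P Z, x = 0 := by
      intro x
      obtain ⟨w, rfl⟩ := (Algebra.H1Cotangent.exact_map_δ (ZMod p) P Z x).1 (hδ x)
      have := hsm.subsingleton_h1Cotangent
      rw [Subsingleton.elim w 0, map_zero]
    rw [h0 x, h0 y]
  let _ : Algebra P (PowerSeries Z) := (MvPolynomial.aeval φ).toAlgebra
  have ha' : ∀ f : P, algebraMap P (PowerSeries Z) f = MvPolynomial.aeval φ f := fun _ => rfl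
  let I : Ideal (PowerSeries Z) := Ideal.span {PowerSeries.X}
  have hI : ∀ f g : PowerSeries Z, Ideal.Quotient.mk I f = Ideal.Quotient.mk I g ↔
      PowerSeries.constantCoeff f = PowerSeries.constantCoeff g := by
    intro f g
    rw [Ideal.Quotient.eq, Ideal.mem_span_singleton, PowerSeries.X_dvd_iff, map_sub, sub_eq_zero]
  let f0 : Z →ₐ[P] PowerSeries Z ⧸ I :=
    { (Ideal.Quotient.mk I).comp (PowerSeries.C (R := Z)) with
      commutes' := fun q => by
        change Ideal.Quotient.mk I (PowerSeries.C (algebraMap P Z q)) =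
          Ideal.Quotient.mk I (algebraMap P (PowerSeries Z) q)
        rw [hI, PowerSeries.constantCoeff_C, ha, ha', MvPolynomial.map_aeval,
          MvPolynomial.aeval_def, MvPolynomial.eval₂_eq]
        rw [MvPolynomial.coe_eval₂Hom, MvPolynomial.eval₂_eq]
        refine Finset.sum_congr rfl fun d _ => ?_
        congr 1
        exact Finset.prod_congr rfl fun i _ => by rw [hφ] }
  -- The power series are a `P`-algebra through `φ`, so a lift over `P` of the identity modulo `X`
  -- has the prescribed values at the `b i`.
  obtain ⟨g, hg⟩ := Algebra.FormallySmooth.exists_mkₐ_comp_eq_of_isAdicComplete f0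
  refine ⟨g, fun z => ?_, fun i => ?_⟩
  · have h1 : Ideal.Quotient.mk I (g z) = Ideal.Quotient.mk I (PowerSeries.C z) :=
      AlgHom.congr_fun hg z
    rw [hI, PowerSeries.constantCoeff_C] at h1
    exact h1
  · have h1 : g (algebraMap P Z (MvPolynomial.X i)) =
        algebraMap P (PowerSeries Z) (MvPolynomial.X i) := g.commutes _
    rw [ha, ha'] at h1
    simpa using h1

end Smooth

/-! ### Generators over high Frobenius powers -/

section PBasis

variable (p : ℕ) [Fact p.Prime] {Z : Type*} [Field Z] [CharP Z p]

/-- A subfield containing the `p`-th powers, all of whose derivations vanish, is the whole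
field. -/
theorem subfield_eq_top_of_derivation (K₁ : Subfield Z) (hK : ∀ x : Z, x ^ p ∈ K₁)
    (h : ∀ d : Derivation ℤ Z Z, (∀ x ∈ K₁, d x = 0) → d = 0) : K₁ = ⊤ := by
  have hp : p.Prime := Fact.out
  by_contra hne
  obtain ⟨x, -, hx⟩ := SetLike.exists_of_lt (lt_top_iff_ne_top.2 hne)
  -- A subfield maximal among those avoiding `x` makes `Z` a simple extension of degree `p`.
  obtain ⟨K₂, hle, hmax⟩ := zorn_le_nonempty₀ {K : Subfield Z | x ∉ K} (by
    intro c hc hchain y hy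
    refine ⟨sSup c, ?_, fun z hz => le_sSup hz⟩
    intro hxs
    rw [Subfield.mem_sSup_of_directedOn ⟨y, hy⟩ hchain.directedOn] at hxs
    obtain ⟨K, hK, hxK⟩ := hxs
    exact hc hK hxK) K₁ hx
  have hx2 : x ∉ K₂ := hmax.prop
  have hpow : ∀ y : Z, y ^ p ∈ K₂ := fun y => hle (hK y)
  have hdeg : ∀ y : Z, y ∉ K₂ → finrank K₂ (IntermediateField.adjoin K₂ {y}) = p ∧
      IsIntegral K₂ y := by
    intro y hy
    have hirr : Irreducible (X ^ p - C (⟨y ^ p, hpow y⟩ : K₂)) := by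
      refine X_pow_sub_C_irreducible_of_prime hp fun b hb => hy ?_
      have h1 : (b : Z) ^ p = y ^ p := congrArg Subtype.val hb
      rw [← frobenius_def, ← frobenius_def] at h1
      rw [← frobenius_inj Z p h1]
      exact b.2
    have hmon : (X ^ p - C (⟨y ^ p, hpow y⟩ : K₂)).Monic := monic_X_pow_sub_C _ hp.ne_zero
    have hroot : aeval y (X ^ p - C (⟨y ^ p, hpow y⟩ : K₂)) = 0 := by
      rw [map_sub, map_pow, aeval_X, aeval_C, sub_eq_zero]; rfl
    have hint : IsIntegral K₂ y := ⟨_, hmon, by rwa [← aeval_def]⟩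
    refine ⟨?_, hint⟩
    rw [IntermediateField.adjoin.finrank hint, ← minpoly.eq_of_irreducible_of_monic hirr hroot hmon,
      natDegree_X_pow_sub_C]
  -- For `y` outside `K₂`, maximality puts `x` in `K₂(y)`; both simple extensions have degree `p`,
  -- so they coincide.
  have htop : IntermediateField.adjoin K₂ {x} = ⊤ := by
    rw [eq_top_iff]
    intro y _
    by_cases hy : y ∈ K₂
    · exact (IntermediateField.adjoin K₂ {x}).algebraMap_mem ⟨y, hy⟩
    have hxy : x ∈ IntermediateField.adjoin K₂ {y} := by
      by_contra hxy
      have h1 : K₂ ≤ (IntermediateField.adjoin K₂ {y}).toSubfield := fun a ha =>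
        (IntermediateField.adjoin K₂ {y}).algebraMap_mem ⟨a, ha⟩
      exact hy (hmax.le_of_ge (y := (IntermediateField.adjoin K₂ {y}).toSubfield) hxy h1
        (IntermediateField.mem_adjoin_simple_self K₂ y))
    have h1 : IntermediateField.adjoin K₂ {x} ≤ IntermediateField.adjoin K₂ {y} := by
      rw [IntermediateField.adjoin_simple_le_iff]; exact hxy
    have : FiniteDimensional K₂ (IntermediateField.adjoin K₂ {y}) :=
      IntermediateField.adjoin.finiteDimensional (hdeg y hy).2
    rw [IntermediateField.eq_of_le_of_finrank_eq h1 ((hdeg x hx2).1.trans (hdeg y hy).1.symm)]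
    exact IntermediateField.mem_adjoin_simple_self K₂ y
  have hess : Algebra.EssFiniteType K₂ Z := by
    have : FiniteDimensional K₂ (⊤ : IntermediateField K₂ Z) := by
      rw [← htop]
      exact IntermediateField.adjoin.finiteDimensional (hdeg x hx2).2
    have := Module.Finite.equiv (IntermediateField.topEquiv (F := K₂) (E := Z)).toLinearEquiv
    infer_instance
  -- A nonzero differential would be detected by a linear form, hence by a nonzero derivation over
  -- `K₂`. The resulting separability contradicts `x ^ p ∈ K₂`.
  have hunr : Algebra.FormallyUnramified K₂ Z := by
    rw [Algebra.formallyUnramified_iff]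
    by_contra hns
    rw [not_subsingleton_iff_nontrivial] at hns
    obtain ⟨ω, hω⟩ := exists_ne (0 : Ω[Z⁄K₂])
    obtain ⟨l, hl⟩ := Module.Projective.exists_dual_ne_zero Z hω
    let d : Derivation K₂ Z Z := l.compDer (KaehlerDifferential.D K₂ Z)
    have hd := h (d.restrictScalars ℤ) (fun a ha => d.map_algebraMap (⟨a, hle ha⟩ : K₂))
    have hd' : ∀ a, l (KaehlerDifferential.D K₂ Z a) = 0 := fun a => Derivation.congr_fun hd a
    apply hl
    have : ω ∈ Submodule.span Z (Set.range (KaehlerDifferential.D K₂ Z)) := by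
      rw [KaehlerDifferential.span_range_derivation]; trivial
    refine Submodule.span_induction ?_ (map_zero l) ?_ ?_ this
    · rintro _ ⟨a, rfl⟩; exact hd' a
    · intro a b _ _ ha hb; rw [map_add, ha, hb, add_zero]
    · intro c a _ ha; rw [map_smul, ha, smul_zero]
  have hsep := Algebra.FormallyUnramified.isSeparable K₂ Z
  have : ExpChar K₂ p := ExpChar.prime hp
  have h1 := (minpoly.natSepDegree_eq_one_iff_pow_mem p (F := K₂) (x := x)).2
    ⟨1, ⟨⟨x ^ p, hpow x⟩, by rw [pow_one]; rfl⟩⟩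
  rw [Separable.natSepDegree_eq_natDegree (Algebra.IsSeparable.isSeparable K₂ x)] at h1
  obtain ⟨y, hy⟩ := minpoly.mem_range_of_degree_eq_one K₂ x (by
    rw [degree_eq_natDegree (minpoly.ne_zero (hdeg x hx2).2), h1]; rfl)
  exact hx2 (hy ▸ y.2)

/-- If `Z` is generated over `k` by `s`, there are elements of `k` with independent differentials
over `Z`, which generate `Z` together with `s` and arbitrarily high `p`-power of `k`. -/
theorem exists_pBasis_of_adjoin_eq_top [Algebra (ZMod p) Z] {k : Type v} [Field k] [Algebra k Z]
    (s : Z) (hs : Algebra.adjoin k {s} = ⊤) :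
    ∃ (ι : Type v) (b : ι → k),
      (LinearIndependent Z fun i => KaehlerDifferential.D (ZMod p) Z (algebraMap k Z (b i))) ∧
      ∀ (N : ℕ) (T : Subring Z), (∀ c : k, algebraMap k Z c ^ p ^ N ∈ T) →
        (∀ i, algebraMap k Z (b i) ∈ T) → s ∈ T → T = ⊤ := by
  have hp : p.Prime := Fact.out
  let d := KaehlerDifferential.D (ZMod p) Z
  let S : Submodule Z Ω[Z⁄ZMod p] := Submodule.span Z {d s}
  -- Independence is taken modulo `d s`, so that `s` together with the `b i` controls all
  -- derivations: one that kills them kills `k` and `s`, hence `Z = k[s]`.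
  obtain ⟨ι, b, -, hspan, hli⟩ := exists_linearIndependent' Z
    (fun c : k => S.mkQ (d (algebraMap k Z c)))
  refine ⟨ι, b, LinearIndependent.of_comp S.mkQ hli, ?_⟩
  -- a derivation killing the given elements vanishes
  have key : ∀ δ : Derivation ℤ Z Z, (∀ i, δ (algebraMap k Z (b i)) = 0) → δ s = 0 → δ = 0 := by
    intro δ hδ hδs
    let δ' : Derivation (ZMod p) Z Z :=
      { toLinearMap := δ.toLinearMap.toAddMonoidHom.toZModLinearMap p
        map_one_eq_zero' := δ.map_one_eq_zero
        leibniz' := δ.leibniz }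
    have hδ' : ∀ x, δ' x = δ x := fun _ => rfl
    let l := δ'.liftKaehlerDifferential
    have hl : ∀ x, l (d x) = δ x := fun x => by
      rw [← hδ' x]; exact Derivation.liftKaehlerDifferential_comp_D _ _
    have hS : S ≤ LinearMap.ker l := by
      rw [Submodule.span_le, Set.singleton_subset_iff]
      change l (d s) = 0
      rw [hl, hδs]
    let l' := S.liftQ l hS
    have h1 : Submodule.span Z (Set.range ((fun c : k => S.mkQ (d (algebraMap k Z c))) ∘ b)) ≤
        LinearMap.ker l' := by
      rw [Submodule.span_le]
      rintro _ ⟨i, rfl⟩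
      change l' (S.mkQ (d (algebraMap k Z (b i)))) = 0
      rw [Submodule.mkQ_apply, Submodule.liftQ_apply, hl, hδ]
    rw [hspan] at h1
    have h2 : ∀ c : k, δ (algebraMap k Z c) = 0 := by
      intro c
      have := h1 (Submodule.subset_span ⟨c, rfl⟩)
      change l' (S.mkQ (d (algebraMap k Z c))) = 0 at this
      rwa [Submodule.mkQ_apply, Submodule.liftQ_apply, hl] at this
    ext x
    have hx : x ∈ Algebra.adjoin k {s} := by rw [hs]; trivial
    rw [Derivation.zero_apply]
    induction hx using Algebra.adjoin_induction with
    | mem x hx => rw [Set.mem_singleton_iff.1 hx, hδs]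
    | algebraMap r => exact h2 r
    | add x y _ _ hx hy => rw [map_add, hx, hy, add_zero]
    | mul x y _ _ hx hy => rw [Derivation.leibniz, hx, hy, smul_zero, smul_zero, add_zero]
  have step1 : ∀ T : Subring Z, (∀ x : Z, x ^ p ∈ T) → (∀ i, algebraMap k Z (b i) ∈ T) → s ∈ T →
      T = ⊤ := by
    intro T hT hb hsT
    let K : Subfield Z :=
      { T with
        inv_mem' := fun x hx => by
          rcases eq_or_ne x 0 with rfl | hx0
          · rw [inv_zero]; exact T.zero_mem
          -- A subring containing all `p`-th powers is closed under inverses.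
          · have : x⁻¹ = x ^ (p - 1) * (x⁻¹) ^ p := by
              conv_rhs => rw [← Nat.sub_add_cancel hp.one_le, pow_succ x⁻¹]
              rw [Nat.add_sub_cancel, ← mul_assoc, ← mul_pow, mul_inv_cancel₀ hx0, one_pow, one_mul]
            change x⁻¹ ∈ T
            rw [this]
            exact T.mul_mem (T.pow_mem hx _) (hT _) }
    have hK : K = ⊤ := subfield_eq_top_of_derivation p K hT fun δ hδ =>
      key δ (fun i => hδ _ (hb i)) (hδ s hsT)
    rw [eq_top_iff]
    intro x _
    have : x ∈ K := by rw [hK]; trivial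
    exact this
  have step2 : ∀ (N : ℕ) (T : Subring Z), (∀ x : Z, x ^ p ^ N ∈ T) →
      (∀ i, algebraMap k Z (b i) ∈ T) → s ∈ T → T = ⊤ := by
    intro N
    induction N with
    | zero =>
      intro T hT _ _
      rw [eq_top_iff]
      intro x _
      simpa using hT x
    | succ N ih =>
      intro T hT hb hsT
      -- The preimage of `T` under Frobenius contains the `p ^ N`-th powers; that it is everything
      -- means that `T` contains all `p`-th powers.
      have h1 := ih (T.comap (frobenius Z p))
        (fun x => by
          rw [Subring.mem_comap, frobenius_def, ← pow_mul, ← pow_succ]; exact hT x)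
        (fun i => by rw [Subring.mem_comap, frobenius_def]; exact T.pow_mem (hb i) _)
        (by rw [Subring.mem_comap, frobenius_def]; exact T.pow_mem hsT _)
      refine step1 T (fun x => ?_) hb hsT
      have : x ∈ T.comap (frobenius Z p) := by rw [h1]; trivial
      rwa [Subring.mem_comap, frobenius_def] at this
  intro N T hT hb hsT
  refine step2 N T (fun x => ?_) hb hsT
  have hx : x ∈ Algebra.adjoin k {s} := by rw [hs]; trivial
  rw [← iterateFrobenius_def]
  induction hx using Algebra.adjoin_induction with
  | mem x hx => rw [Set.mem_singleton_iff.1 hx, iterateFrobenius_def]; exact T.pow_mem hsT _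
  | algebraMap r => rw [iterateFrobenius_def]; exact hT r
  | add x y _ _ hx hy => rw [map_add]; exact T.add_mem hx hy
  | mul x y _ _ hx hy => rw [map_mul]; exact T.mul_mem hx hy

end PBasis

end SplitAlg

namespace SplitAlg

/-! ### Cyclic centres from conjugation -/

section Galois

/-- Conjugation by a nonzero element. -/
noncomputable def conjAlgHom (F : Type*) [Field F] {D : Type v} [DivisionRing D] [Algebra F D]
    {z : D} (hz : z ≠ 0) : D →ₐ[F] D where
  toFun x := z * x * z⁻¹
  map_one' := by rw [mul_one, mul_inv_cancel₀ hz]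
  map_mul' x y := by
    simp only [mul_assoc, inv_mul_cancel_left₀ hz]
  map_zero' := by simp
  map_add' x y := by simp [mul_add, add_mul]
  commutes' r := by rw [← Algebra.commutes, mul_assoc, mul_inv_cancel₀ hz, mul_one]

theorem conjAlgHom_apply (F : Type*) [Field F] {D : Type v} [DivisionRing D] [Algebra F D]
    {z : D} (hz : z ≠ 0) (x : D) : conjAlgHom F hz x = z * x * z⁻¹ :=
  rfl

variable {F : Type*} [Field F] {D : Type v} [DivisionRing D] [Algebra F D] [FiniteDimensional F D]

/-- A subspace stable under conjugation is mapped onto itself. -/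
theorem exists_conj_eq_of_conj_mem {z : D} (hz : z ≠ 0) (A : Submodule F D)
    (hA : ∀ a ∈ A, z * a * z⁻¹ ∈ A) {a : D} (ha : a ∈ A) : ∃ b ∈ A, z * b * z⁻¹ = a := by
  let f : A →ₗ[F] A := ((conjAlgHom F hz).toLinearMap.restrict hA)
  have hinj : Function.Injective f := by
    intro x y h
    have h1 : conjAlgHom F hz x = conjAlgHom F hz y := congrArg Subtype.val h
    exact Subtype.ext ((conjAlgHom F hz).toRingHom.injective h1)
  obtain ⟨b, hb⟩ := LinearMap.injective_iff_surjective.1 hinj ⟨a, ha⟩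
  exact ⟨b, b.2, congrArg Subtype.val hb⟩

/-- The centralizer of `A` lies in `A`, so it is the centre of `A`. Conjugation by `z` restricts to
an automorphism of this field whose fixed elements lie in `F`; by Galois theory the field is Galois
over `F` with group generated by that automorphism. -/
theorem hasCyclicGaloisCenter_of_conj (A : Subalgebra F D) {z : D} (hz : z ≠ 0)
    (hA : ∀ a ∈ A, z * a * z⁻¹ ∈ A) (hC : Subalgebra.centralizer F (A : Set D) ≤ A)
    (hF : ∀ x : D, (∀ a ∈ A, a * x = x * a) → z * x = x * z → x ∈ (⊥ : Subalgebra F D))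
    {n : ℕ} (hn : finrank F (Subalgebra.centralizer F (A : Set D)) = n) :
    HasCyclicGaloisCenter F A n := by
  let E := Subalgebra.center F A
  let _ : Field E := fieldOfFiniteDimensional F E
  have hE : ∀ x : E, ∀ a ∈ A, a * ((x : A) : D) = ((x : A) : D) * a := fun x a ha =>
    congrArg Subtype.val ((Subalgebra.mem_center_iff.1 x.2) ⟨a, ha⟩)
  let e : E →ₗ[F] Subalgebra.centralizer F (A : Set D) :=
    { toFun := fun x => ⟨((x : A) : D), (Subalgebra.mem_centralizer_iff F).2 (hE x)⟩
      map_add' := fun _ _ => rfl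
      map_smul' := fun _ _ => rfl }
  have he : Function.Bijective e := by
    refine ⟨fun x y h => Subtype.ext (Subtype.ext (congrArg (fun t : Subalgebra.centralizer F (A : Set D) => (t : D)) h)), fun x => ?_⟩
    refine ⟨⟨⟨x, hC x.2⟩, Subalgebra.mem_center_iff.2 fun a => Subtype.ext ?_⟩, rfl⟩
    exact (Subalgebra.mem_centralizer_iff F).1 x.2 _ a.2
  have hfin : finrank F E = n := by rw [← hn, (LinearEquiv.ofBijective e he).finrank_eq]
  let c : A →ₐ[F] A := ((conjAlgHom F hz).comp A.val).codRestrict A fun a => hA a a.2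
  have hc : ∀ a : A, (c a : D) = z * a * z⁻¹ := fun _ => rfl
  let f : E →ₐ[F] E := (c.comp E.val).codRestrict E fun x => by
    rw [Subalgebra.mem_center_iff]
    intro a
    obtain ⟨b, hb, hba⟩ := exists_conj_eq_of_conj_mem hz (Subalgebra.toSubmodule A) hA a.2
    apply Subtype.ext
    rw [Subalgebra.coe_mul, Subalgebra.coe_mul]
    change (a : D) * (conjAlgHom F hz ((x : A) : D)) = conjAlgHom F hz ((x : A) : D) * (a : D)
    rw [← hba, ← conjAlgHom_apply F hz, ← map_mul, ← map_mul, hE x b hb]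
  have hf : ∀ x : E, ((f x : A) : D) = z * ((x : A) : D) * z⁻¹ := fun _ => rfl
  let σ : Gal(E/F) := AlgEquiv.ofBijective f
    ⟨f.toRingHom.injective, LinearMap.injective_iff_surjective (f := f.toLinearMap).1
      f.toRingHom.injective⟩
  have hfix : IntermediateField.fixedField (Subgroup.zpowers σ) = ⊥ := by
    rw [eq_bot_iff]
    intro x hx
    have h1 : σ x = x := hx ⟨σ, Subgroup.mem_zpowers σ⟩
    have h2 : z * ((x : A) : D) * z⁻¹ = ((x : A) : D) := by
      rw [← hf]; exact congrArg (fun y : E => ((y : A) : D)) h1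
    have h3 : z * ((x : A) : D) = ((x : A) : D) * z := by
      conv_rhs => rw [← h2]
      rw [inv_mul_cancel_right₀ hz]
    obtain ⟨r, hr⟩ := Algebra.mem_bot.1 (hF _ (hE x) h3)
    rw [IntermediateField.mem_bot]
    exact ⟨r, Subtype.ext (Subtype.ext hr)⟩
  have : FiniteDimensional F E := inferInstance
  have hgal : IsGalois F E := by
    refine IsGalois.of_fixedField_eq_bot F E ?_
    rw [eq_bot_iff, ← hfix]
    exact IntermediateField.fixedField_antitone le_top
  have htop : Subgroup.zpowers σ = ⊤ := by
    rw [← IntermediateField.fixingSubgroup_fixedField (Subgroup.zpowers σ), hfix,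
      IntermediateField.fixingSubgroup_bot]
  refine ⟨E, inferInstance, inferInstance, ⟨AlgEquiv.refl⟩, hgal, ?_, hfin⟩
  exact ⟨σ, fun x => by
    change x ∈ Subgroup.zpowers σ
    rw [htop]
    trivial⟩

end Galois

/-! ### Separable elements with commutative centralizer -/

section Separable

/-- The power condition says that the minimal polynomial has separable degree `1`; separability
makes this its degree. -/
theorem mem_range_of_isSeparable_of_pow_mem {F E : Type*} [Field F] [Ring E] [IsDomain E]
    [Algebra F E] (q : ℕ) [ExpChar F q] {x : E} (hx : IsSeparable F x) {n : ℕ}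
    (h : x ^ q ^ n ∈ (algebraMap F E).range) : x ∈ (algebraMap F E).range := by
  have h1 := (minpoly.natSepDegree_eq_one_iff_pow_mem q).2 ⟨n, h⟩
  rw [Separable.natSepDegree_eq_natDegree hx] at h1
  refine minpoly.mem_range_of_degree_eq_one F x ?_
  rw [degree_eq_natDegree (minpoly.ne_zero hx.isIntegral), h1]; rfl

variable {F R : Type*} [Field F] [DivisionRing R] [Algebra F R] [FiniteDimensional F R]

/-- For a pair of commuting elements, of which the first is separable of maximal degree, some
`p`-power of the second lies in the field generated by the first. -/
theorem pow_mem_adjoin_of_maximal (q : ℕ) [ExpChar F q] {θ x : R} (hθ : IsSeparable F θ)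
    (hmax : ∀ η : R, IsSeparable F η → (minpoly F η).natDegree ≤ (minpoly F θ).natDegree)
    (hx : θ * x = x * θ) : ∃ n, x ^ q ^ n ∈ Algebra.adjoin F {θ} := by
  let K := Algebra.adjoin F ({θ, x} : Set R)
  have hcomm : ∀ a ∈ ({θ, x} : Set R), ∀ b ∈ ({θ, x} : Set R), a * b = b * a := by
    rintro a (rfl | rfl) b (rfl | rfl)
    · rfl
    · exact hx
    · exact hx.symm
    · rfl
  have hK := Algebra.isMulCommutative_adjoin F hcomm
  let _ : CommRing K := { (inferInstance : Ring K) with mul_comm := hK.is_comm.comm }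
  let _ : Field K := fieldOfFiniteDimensional F K
  let θ' : K := ⟨θ, Algebra.subset_adjoin (by simp)⟩
  let x' : K := ⟨x, Algebra.subset_adjoin (by simp)⟩
  have hmin : ∀ y : K, minpoly F (y : R) = minpoly F y := fun y =>
    minpoly.algHom_eq K.val Subtype.val_injective y
  let L := separableClosure F K
  obtain ⟨η, hη⟩ := Field.exists_primitive_element F L
  have hηsep : IsSeparable F ((η : K) : R) := by
    have h1 : IsSeparable F (η : K) := (mem_separableClosure_iff).1 η.2
    rw [IsSeparable, hmin]; exact h1
  have hθL : θ' ∈ L := by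
    rw [mem_separableClosure_iff, IsSeparable, ← hmin]; exact hθ
  have h1 : finrank F L = (minpoly F ((η : K) : R)).natDegree := by
    rw [hmin, ← IntermediateField.minpoly_eq, ← IntermediateField.adjoin.finrank
      (Algebra.IsIntegral.isIntegral η), hη, IntermediateField.finrank_top']
  have h2 : finrank F (IntermediateField.adjoin F {θ'}) = (minpoly F θ).natDegree := by
    rw [IntermediateField.adjoin.finrank (Algebra.IsIntegral.isIntegral θ')]
    exact congrArg natDegree (hmin θ').symm
  -- A primitive element of the separable closure of `F` in `F(θ, x)` has degree at most that of
  -- `θ`, so `θ` already generates it and the rest is purely inseparable.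
  have h3 : IntermediateField.adjoin F {θ'} = L := by
    have hle : IntermediateField.adjoin F {θ'} ≤ L := by
      rw [IntermediateField.adjoin_simple_le_iff]; exact hθL
    refine IntermediateField.eq_of_le_of_finrank_eq hle (le_antisymm
      (Submodule.finrank_mono (R := F) (s := Subalgebra.toSubmodule
        (IntermediateField.adjoin F {θ'}).toSubalgebra)
        (t := Subalgebra.toSubmodule L.toSubalgebra) hle) ?_)
    rw [h1, h2]
    exact hmax _ hηsep
  have hpi := separableClosure.isPurelyInseparable F K
  have : ExpChar L q := expChar_of_injective_algebraMap (algebraMap F L).injective q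
  obtain ⟨n, y, hy⟩ := IsPurelyInseparable.pow_mem L q x'
  refine ⟨n, ?_⟩
  have h4 : (y : K) ∈ IntermediateField.adjoin F {θ'} := by rw [h3]; exact y.2
  rw [← IntermediateField.mem_toSubalgebra,
    IntermediateField.adjoin_simple_toSubalgebra_of_isAlgebraic
      (Algebra.IsAlgebraic.isAlgebraic θ')] at h4
  have h5 : K.val (y : K) ∈ (Algebra.adjoin F {θ'}).map K.val := ⟨_, h4, rfl⟩
  rw [AlgHom.map_adjoin, Set.image_singleton] at h5
  have h6 : K.val (y : K) = x ^ q ^ n := by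
    have : (y : K) = x' ^ q ^ n := hy
    rw [this, map_pow]; rfl
  rwa [h6] at h5

/-- A finite dimensional division algebra contains a separable element with commutative
centralizer. -/
theorem exists_isSeparable_centralizer_comm : ∃ θ : R, IsSeparable F θ ∧
    ∀ x y : R, θ * x = x * θ → θ * y = y * θ → x * y = y * x := by
  obtain ⟨q, hq⟩ := ExpChar.exists F
  obtain ⟨θ, hθ, hmax⟩ : ∃ θ : R, IsSeparable F θ ∧
      ∀ η : R, IsSeparable F η → (minpoly F η).natDegree ≤ (minpoly F θ).natDegree := by
    let P : ℕ → Prop := fun m => ∃ η : R, IsSeparable F η ∧ (minpoly F η).natDegree = m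
    have hP : ∃ m, P m := ⟨_, algebraMap F R 0, isSeparable_algebraMap 0, rfl⟩
    have hb : ∀ m, P m → m ≤ finrank F R := by
      rintro m ⟨η, -, rfl⟩
      exact minpoly.natDegree_le η
    classical
    obtain ⟨θ, hθ, h⟩ := Nat.findGreatest_spec (P := P) (hb _ hP.choose_spec) hP.choose_spec
    refine ⟨θ, hθ, fun η hη => ?_⟩
    rw [h]
    exact Nat.le_findGreatest (hb _ ⟨η, hη, rfl⟩) ⟨η, hη, rfl⟩
  refine ⟨θ, hθ, ?_⟩
  let C := Subalgebra.centralizer F {θ}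
  have hC : ∀ x, x ∈ C ↔ θ * x = x * θ := fun x => by
    rw [Subalgebra.mem_centralizer_iff]; simp
  let _ : DivisionRing C := divisionRingOfFiniteDimensional F C
  let Y := Subring.center C
  have halg : Algebra.IsAlgebraic Y C := by
    refine ⟨fun x => ?_⟩
    obtain ⟨f, hf0, hf⟩ := Algebra.IsAlgebraic.isAlgebraic (R := F) x
    let j : F →+* Y := (algebraMap F C).codRestrict Y fun r =>
      Subring.mem_center_iff.2 fun g => (Algebra.commutes r g).symm
    refine ⟨f.map j, (Polynomial.map_ne_zero_iff j.injective).2 hf0, ?_⟩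
    rw [aeval_def, eval₂_map]
    exact hf
  by_cases htop : Y = ⊤
  · intro x y hx hy
    have h1 : (⟨y, (hC y).2 hy⟩ : C) ∈ Y := by rw [htop]; trivial
    exact congrArg Subtype.val (Subring.mem_center_iff.1 h1 ⟨x, (hC x).2 hx⟩)
  · exfalso
    -- In a noncommutative centralizer there would be a noncentral `x` separable over the centre. A
    -- `q`-power of `x` lies in `F[θ]`, which is central there, so `x` would be purely inseparable
    -- as well.
    obtain ⟨x, hxY, hxs⟩ := JacobsonNoether.exists_separable_and_not_isCentral C htop
    obtain ⟨n, hn⟩ := pow_mem_adjoin_of_maximal q hθ hmax ((hC x).1 x.2)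
    apply hxY
    have hj : ExpChar Y q := by
      let j : F →+* Y := (algebraMap F C).codRestrict Y fun r =>
        Subring.mem_center_iff.2 fun g => (Algebra.commutes r g).symm
      exact expChar_of_injective_ringHom j.injective q
    obtain ⟨y, hy⟩ := mem_range_of_isSeparable_of_pow_mem q hxs (n := n) (by
      refine ⟨⟨x ^ q ^ n, Subring.mem_center_iff.2 fun g => Subtype.ext ?_⟩, rfl⟩
      have h1 : Algebra.adjoin F {θ} ≤ Subalgebra.centralizer F (C : Set R) := by
        rw [Algebra.adjoin_le_iff, Set.singleton_subset_iff, SetLike.mem_coe,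
          Subalgebra.mem_centralizer_iff]
        intro g hg
        exact ((hC g).1 hg).symm
      exact (Subalgebra.mem_centralizer_iff F).1 (h1 hn) g g.2)
    rw [← hy]
    exact y.2

end Separable

end SplitAlg

namespace SplitAlg

/-! ### The uniformizer of the base field and the residue algebra -/

section Uniformizer

variable (k : Type*) [Field k] (D : Type*) [DivisionRing D] [Algebra k⸨X⸩ D]
  [FiniteDimensional k⸨X⸩ D]

/-- The element `X` of the centre `k⸨X⸩`. -/
noncomputable def unif : D := algebraMap k⸨X⸩ D (HahnSeries.single 1 1)

theorem val_unif : val k D (unif k D) = WithZero.exp (-1 : ℤ) ^ finrank k⸨X⸩ D := by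
  rw [unif, val_algebraMap, LaurentSeries.valuation_single_zpow]

theorem val_unif_lt_one : val k D (unif k D) < 1 := by
  rw [val_unif]
  refine pow_lt_one₀ zero_le ?_ finrank_pos.ne'
  rw [← WithZero.exp_zero, WithZero.exp_lt_exp]
  decide

theorem val_unif_ne_zero : val k D (unif k D) ≠ 0 := by
  rw [val_unif]; exact pow_ne_zero _ WithZero.exp_ne_zero

theorem unif_ne_zero : unif k D ≠ 0 := (Valuation.ne_zero_iff _).1 (val_unif_ne_zero k D)

omit [FiniteDimensional k⸨X⸩ D] in
theorem unif_mul_comm (x : D) : unif k D * x = x * unif k D := Algebra.commutes _ x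

theorem val_algebraMap_le_iff (f : k⸨X⸩) (n : ℤ) :
    val k D (algebraMap k⸨X⸩ D f) ≤ val k D (unif k D) ^ n ↔ ∀ m < n, f.coeff m = 0 := by
  rw [← LaurentSeries.valuation_le_iff_coeff_lt_eq_zero, val_algebraMap, val_unif, ← zpow_natCast,
    ← zpow_natCast (WithZero.exp (-1 : ℤ)), ← zpow_mul, mul_comm, zpow_mul, ← WithZero.exp_zsmul,
    zpow_natCast, zpow_natCast, smul_eq_mul, mul_neg_one]
  exact pow_le_pow_iff_left₀ zero_le zero_le finrank_pos.ne'

theorem exists_val_algebraMap_eq {f : k⸨X⸩} (hf : f ≠ 0) :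
    ∃ n : ℤ, val k D (algebraMap k⸨X⸩ D f) = val k D (unif k D) ^ n := by
  have h0 : (Valued.v f : ℤᵐ⁰) ≠ 0 := (Valuation.ne_zero_iff _).2 hf
  refine ⟨-(Valued.v f : ℤᵐ⁰).log, ?_⟩
  rw [val_algebraMap, val_unif, ← zpow_natCast, ← zpow_natCast (WithZero.exp (-1 : ℤ)),
    ← zpow_mul, mul_comm, zpow_mul, ← WithZero.exp_zsmul]
  simp [WithZero.exp_log h0]

theorem coe_constHom (c : k) : (constHom k D c : D) = algebraMap k⸨X⸩ D (HahnSeries.C c) := rfl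

end Uniformizer

section Residue

variable {k : Type*} [Field k] {D : Type*} [DivisionRing D] [Algebra k⸨X⸩ D]
  [FiniteDimensional k⸨X⸩ D]

theorem res_add {x y : D} (hx : val k D x ≤ 1) (hy : val k D y ≤ 1) :
    (res (x + y) : Residue k D) = res x + res y := by
  rw [res_of_mem hx, res_of_mem hy, res_of_mem (Subring.add_mem _ hx hy), ← map_add]; rfl

theorem res_sub {x y : D} (hx : val k D x ≤ 1) (hy : val k D y ≤ 1) :
    (res (x - y) : Residue k D) = res x - res y := by
  rw [res_of_mem hx, res_of_mem hy, res_of_mem (Subring.sub_mem _ hx hy), ← map_sub]; rfl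

theorem res_mul {x y : D} (hx : val k D x ≤ 1) (hy : val k D y ≤ 1) :
    (res (x * y) : Residue k D) = res x * res y := by
  rw [res_of_mem hx, res_of_mem hy, res_of_mem (Subring.mul_mem _ hx hy), ← map_mul]; rfl

theorem res_coe (x : (val k D).integer) : res (x : D) = Ideal.Quotient.mk (maxIdeal k D) x :=
  res_of_mem x.2

theorem res_zero : (res (0 : D) : Residue k D) = 0 := by
  simpa using res_coe (0 : (val k D).integer)

theorem res_one : (res (1 : D) : Residue k D) = 1 := by
  simpa using res_coe (1 : (val k D).integer)

theorem res_eq_zero_iff {x : D} (hx : val k D x ≤ 1) :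
    (res x : Residue k D) = 0 ↔ val k D x < 1 := by
  rw [res_of_mem hx, Ideal.Quotient.eq_zero_iff_mem, mem_maxIdeal]

theorem res_eq_res_iff {x y : D} (hx : val k D x ≤ 1) (hy : val k D y ≤ 1) :
    (res x : Residue k D) = res y ↔ val k D (x - y) < 1 := by
  rw [← sub_eq_zero, ← res_sub hx hy, res_eq_zero_iff]
  exact Subring.sub_mem (val k D).integer hx hy

theorem res_surjective (a : Residue k D) : ∃ x : D, val k D x ≤ 1 ∧ res x = a := by
  obtain ⟨x, rfl⟩ := Ideal.Quotient.mk_surjective a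
  exact ⟨x, x.2, res_coe x⟩

theorem res_constHom (c : k) : res (constHom k D c : D) = algebraMap k (Residue k D) c :=
  res_coe _

theorem res_section {u : Residue k D →+* (val k D).integer} (hu : IsSection u) (a : Residue k D) :
    res (u a : D) = a := by rw [res_coe, mk_section hu]

theorem res_sum {ι : Type*} (s : Finset ι) (f : ι → D) (h : ∀ i ∈ s, val k D (f i) ≤ 1) :
    (res (∑ i ∈ s, f i) : Residue k D) = ∑ i ∈ s, res (f i) := by
  classical
  induction s using Finset.induction_on with
  | empty => simp [res_zero]
  | insert a s ha ih =>
    rw [Finset.sum_insert ha, Finset.sum_insert ha, res_add (h a (Finset.mem_insert_self _ _)),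
      ih fun i hi => h i (Finset.mem_insert_of_mem hi)]
    exact Valuation.map_sum_le _ fun i hi => h i (Finset.mem_insert_of_mem hi)

theorem val_section {u : Residue k D →+* (val k D).integer} (hu : IsSection u) {a : Residue k D}
    (ha : a ≠ 0) : val k D (u a) = 1 := by
  refine le_antisymm (u a).2 (not_lt.1 fun h => ha ?_)
  rw [← res_section hu a, res_eq_zero_iff (u a).2]
  exact h

theorem val_algebraMap_sub_const_lt {f : k⸨X⸩} (hf : val k D (algebraMap k⸨X⸩ D f) ≤ 1) :
    val k D (algebraMap k⸨X⸩ D f - constHom k D (f.coeff 0)) < 1 := by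
  rw [coe_constHom, ← map_sub]
  have h1 := (val_algebraMap_le_iff k D f 0).1 (by simpa using hf)
  have h2 : val k D (algebraMap k⸨X⸩ D (f - HahnSeries.C (f.coeff 0))) ≤
      val k D (unif k D) ^ (1 : ℤ) := by
    rw [val_algebraMap_le_iff]
    intro m hm
    rw [HahnSeries.coeff_sub]
    rcases lt_or_eq_of_le (by omega : m ≤ 0) with h | rfl
    · rw [h1 m h, HahnSeries.C_apply, HahnSeries.coeff_single_of_ne h.ne, sub_zero]
    · rw [HahnSeries.C_apply, HahnSeries.coeff_single_same, sub_self]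
  refine h2.trans_lt ?_
  rw [zpow_one]
  exact val_unif_lt_one k D

theorem res_algebraMap {f : k⸨X⸩} (hf : val k D (algebraMap k⸨X⸩ D f) ≤ 1) :
    res (algebraMap k⸨X⸩ D f) = algebraMap k (Residue k D) (f.coeff 0) := by
  rw [← res_constHom, res_eq_res_iff hf (constHom k D _).2]
  exact val_algebraMap_sub_const_lt hf

instance : Nontrivial (Residue k D) := by
  refine ⟨0, 1, fun h => ?_⟩
  rw [← res_one, eq_comm, res_eq_zero_iff (by rw [map_one]), map_one] at h
  exact lt_irrefl _ h

/-- The residue algebra is a division algebra. -/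
noncomputable abbrev residueDivisionRing : DivisionRing (Residue k D) :=
  DivisionRing.ofIsUnitOrEqZero fun a => by
    obtain ⟨x, hx, rfl⟩ := res_surjective a
    by_cases h : val k D x < 1
    · exact Or.inr ((res_eq_zero_iff hx).2 h)
    · left
      have h1 : val k D x = 1 := le_antisymm hx (not_lt.1 h)
      have hx0 : x ≠ 0 := fun h0 => by rw [h0, map_zero] at h1; exact zero_ne_one h1
      have h2 : val k D x⁻¹ ≤ 1 := by rw [map_inv₀, h1, inv_one]
      exact ⟨⟨res x, res x⁻¹, by rw [← res_mul hx h2, mul_inv_cancel₀ hx0, res_one],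
        by rw [← res_mul h2 hx, inv_mul_cancel₀ hx0, res_one]⟩, rfl⟩

attribute [local instance] residueDivisionRing

theorem smul_eq_res (c : k) {x : D} (hx : val k D x ≤ 1) :
    c • (res x : Residue k D) = res ((constHom k D c : D) * x) := by
  rw [Algebra.smul_def, ← res_constHom, res_mul (constHom k D c).2 hx]

end Residue

/-! ### Lower bounds for dimensions from values and residues -/

section Independence

variable {k : Type*} [Field k] {D : Type*} [DivisionRing D] [Algebra k⸨X⸩ D]
  [FiniteDimensional k⸨X⸩ D]

theorem zpow_val_injective {y : D} (hy0 : y ≠ 0) (hy1 : val k D y < 1) :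
    Function.Injective fun n : ℤ => val k D y ^ n :=
  zpow_right_injective₀ (zero_lt_iff.2 ((Valuation.ne_zero_iff _).2 hy0)) hy1.ne

/-- The value of a combination of elements with independent residues. -/
theorem exists_val_sum_smul_eq {ι : Type*} [Fintype ι] {x : ι → D} (hx : ∀ i, val k D (x i) ≤ 1)
    (hli : LinearIndependent k fun i => (res (x i) : Residue k D)) {g : ι → k⸨X⸩} (hg : g ≠ 0) :
    ∃ n : ℤ, val k D (∑ i, g i • x i) = val k D (unif k D) ^ n := by
  obtain ⟨i1, hi1⟩ := Function.ne_iff.1 hg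
  obtain ⟨i0, -, hmax⟩ := Finset.exists_max_image Finset.univ
    (fun i => val k D (algebraMap k⸨X⸩ D (g i))) ⟨i1, Finset.mem_univ _⟩
  have hg0 : g i0 ≠ 0 := by
    intro h0
    have := hmax i1 (Finset.mem_univ _)
    rw [h0, map_zero, map_zero, le_zero_iff, Valuation.zero_iff] at this
    exact hi1 ((map_eq_zero _).1 this)
  obtain ⟨n, hn⟩ := exists_val_algebraMap_eq k D hg0
  refine ⟨n, ?_⟩
  have hle : ∀ i, val k D (algebraMap k⸨X⸩ D ((g i0)⁻¹ * g i)) ≤ 1 := by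
    intro i
    rw [map_mul, map_mul, map_inv₀, map_inv₀]
    exact inv_mul_le_one_of_le₀ (hmax i (Finset.mem_univ _)) zero_le
  -- After division by a coefficient of largest `val`, all coefficients are integral and one equals
  -- `1`, so the residue is a nontrivial combination of independent elements.
  have h1 : ∑ i, g i • x i = algebraMap k⸨X⸩ D (g i0) *
      ∑ i, algebraMap k⸨X⸩ D ((g i0)⁻¹ * g i) * x i := by
    rw [Finset.mul_sum]
    refine Finset.sum_congr rfl fun i _ => ?_
    rw [← mul_assoc, ← map_mul, mul_inv_cancel_left₀ hg0, Algebra.smul_def]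
  have hle' : ∀ i ∈ Finset.univ, val k D (algebraMap k⸨X⸩ D ((g i0)⁻¹ * g i) * x i) ≤ 1 :=
    fun i _ => by rw [map_mul]; exact mul_le_one' (hle i) (hx i)
  have h2 : val k D (∑ i, algebraMap k⸨X⸩ D ((g i0)⁻¹ * g i) * x i) = 1 := by
    have hs := Valuation.map_sum_le (val k D) hle'
    refine le_antisymm hs (not_lt.1 fun hlt => ?_)
    rw [← res_eq_zero_iff hs, res_sum _ _ hle'] at hlt
    have h3 : ∀ i, res (algebraMap k⸨X⸩ D ((g i0)⁻¹ * g i) * x i) =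
        ((g i0)⁻¹ * g i).coeff 0 • (res (x i) : Residue k D) := fun i => by
      rw [res_mul (hle i) (hx i), res_algebraMap (hle i), Algebra.smul_def]
    simp only [h3] at hlt
    have := Fintype.linearIndependent_iff.1 hli _ hlt i0
    rw [inv_mul_cancel₀ hg0] at this
    simp at this
  rw [h1, map_mul, h2, mul_one, hn]

/-- Lower bound for the dimension of a subalgebra by ramification index times residue degree. -/
theorem card_mul_le_finrank (C : Subalgebra k⸨X⸩ D) {y : D} (hyC : y ∈ C) (hy1 : val k D y < 1)
    {e : ℕ} (he : val k D (unif k D) = val k D y ^ e)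
    {ι : Type*} [Fintype ι] {x : ι → D} (hxC : ∀ i, x i ∈ C) (hx : ∀ i, val k D (x i) ≤ 1)
    (hli : LinearIndependent k fun i => (res (x i) : Residue k D)) :
    e * Fintype.card ι ≤ finrank k⸨X⸩ C := by
  classical
  rcases Nat.eq_zero_or_pos e with rfl | hepos
  · simp
  have hy0 : y ≠ 0 := by
    rintro rfl
    rw [map_zero, zero_pow hepos.ne'] at he
    exact val_unif_ne_zero k D he
  have hli2 : LinearIndependent k⸨X⸩ fun ij : Fin e × ι => x ij.2 * y ^ (ij.1 : ℕ) := by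
    rw [Fintype.linearIndependent_iff]
    intro g hg
    by_contra hne
    push Not at hne
    obtain ⟨⟨j1, i1⟩, h1⟩ := hne
    rw [Fintype.sum_prod_type] at hg
    let P : Fin e → D := fun j => ∑ i, g (j, i) • x i
    have hP : ∀ j, ∑ i, g (j, i) • (x i * y ^ (j : ℕ)) = P j * y ^ (j : ℕ) := fun j => by
      simp only [P, Finset.sum_mul, smul_mul_assoc]
    simp only [hP] at hg
    -- The exponent of the `j`-th block is congruent to `j` modulo `e`; different nonzero blocks
    -- have different values and cannot cancel.
    have hval : ∀ j, P j = 0 ∨ ∃ n : ℤ, val k D (P j * y ^ (j : ℕ)) = val k D y ^ (e * n + j) := by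
      intro j
      by_cases hgj : (fun i => g (j, i)) = 0
      · left
        simp only [P]
        refine Finset.sum_eq_zero fun i _ => ?_
        rw [show g (j, i) = 0 from congrFun hgj i, zero_smul]
      · right
        obtain ⟨n, hn⟩ := exists_val_sum_smul_eq hx hli hgj
        refine ⟨n, ?_⟩
        rw [map_mul, hn, he, map_pow, zpow_add₀ ((Valuation.ne_zero_iff _).2 hy0), zpow_mul,
          zpow_natCast, zpow_natCast]
    have hPj1 : P j1 * y ^ (j1 : ℕ) ≠ 0 := by
      obtain ⟨n, hn⟩ := exists_val_sum_smul_eq hx hli (g := fun i => g (j1, i))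
        (fun h => h1 (congrFun h i1))
      have : P j1 ≠ 0 := by
        intro h0
        simp only [P] at h0
        rw [h0, map_zero] at hn
        exact (zpow_ne_zero n (val_unif_ne_zero k D)) hn.symm
      exact mul_ne_zero this (pow_ne_zero _ hy0)
    obtain ⟨j0, -, hmax⟩ := Finset.exists_max_image Finset.univ
      (fun j => val k D (P j * y ^ (j : ℕ))) ⟨j1, Finset.mem_univ _⟩
    have hj0 : val k D (P j0 * y ^ (j0 : ℕ)) ≠ 0 := by
      have := hmax j1 (Finset.mem_univ _)
      exact ((zero_lt_iff.2 ((Valuation.ne_zero_iff _).2 hPj1)).trans_le this).ne'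
    have hsum := Valuation.map_sum_eq_of_lt (val k D) (Finset.mem_univ j0)
      (f := fun j => P j * y ^ (j : ℕ)) (fun j hj => by
        refine lt_of_le_of_ne (hmax j (Finset.mem_univ _)) fun heq => ?_
        rcases hval j with h | ⟨n, hn⟩
        · simp only [h, zero_mul, map_zero] at heq
          exact hj0 heq.symm
        rcases hval j0 with h | ⟨n0, hn0⟩
        · simp only [h, zero_mul, map_zero] at hj0
          exact hj0 rfl
        simp only [hn, hn0] at heq
        have h3 := zpow_val_injective hy0 hy1 heq
        have h4 : (j : ℕ) = j0 := by
          have l1 := j.2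
          have l2 := j0.2
          have : ((e : ℤ) * n + (j : ℕ)) % e = ((e : ℤ) * n0 + (j0 : ℕ)) % e := by rw [h3]
          rw [Int.mul_add_emod_self_left, Int.mul_add_emod_self_left,
            Int.emod_eq_of_lt (by omega) (by omega), Int.emod_eq_of_lt (by omega) (by omega)] at this
          exact_mod_cast this
        have h5 : j = j0 := Fin.ext h4
        simp [h5] at hj)
    rw [hg, map_zero] at hsum
    exact hj0 hsum.symm
  let w : Fin e × ι → C := fun ij => ⟨x ij.2 * y ^ (ij.1 : ℕ),
    C.mul_mem (hxC _) (C.pow_mem hyC _)⟩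
  have hw : LinearIndependent k⸨X⸩ w :=
    LinearIndependent.of_comp C.val.toLinearMap hli2
  have := hw.fintype_card_le_finrank
  rwa [Fintype.card_prod, Fintype.card_fin] at this

/-- Lifts of independent residues are independent over `k⸨X⸩`: this is the preceding bound with `y =
X` and `e = 1`. -/
instance : FiniteDimensional k (Residue k D) := by
  by_contra hinf
  have hr : Cardinal.aleph0 ≤ Module.rank k (Residue k D) := by
    rw [← not_lt, Module.rank_lt_aleph0_iff]; exact hinf
  obtain ⟨s, hs, hli⟩ := (le_rank_iff_exists_linearIndependent_finset
    (n := finrank k⸨X⸩ D + 1)).1 (Cardinal.natCast_lt_aleph0.le.trans hr)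
  choose x hx hx' using fun a : (s : Set (Residue k D)) => res_surjective (k := k) (D := D) a.1
  have h1 := card_mul_le_finrank (k := k) (⊤ : Subalgebra k⸨X⸩ D) (y := unif k D) (e := 1)
    Algebra.mem_top (val_unif_lt_one k D) (by rw [pow_one]) (x := x) (fun _ => Algebra.mem_top) hx
    (by simpa only [hx'] using hli)
  simp only [SetLike.coe_sort_coe, Fintype.card_coe] at h1
  have h2 := Submodule.finrank_le (Subalgebra.toSubmodule (⊤ : Subalgebra k⸨X⸩ D))
  rw [Subalgebra.finrank_toSubmodule] at h2
  omega

end Independence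

end SplitAlg

/-! ### Value groups of subalgebras, expansions, `[C : F] = e f`, completeness -/

namespace SplitAlg

attribute [local instance] residueDivisionRing

theorem inv_mem_of_finiteDimensional {F D : Type*} [Field F] [DivisionRing D] [Algebra F D]
    [FiniteDimensional F D] (C : Subalgebra F D) {y : D} (hy : y ∈ C) : y⁻¹ ∈ C := by
  rcases eq_or_ne y 0 with rfl | hy0
  · simp
  have hinj : Function.Injective (LinearMap.mulLeft F (⟨y, hy⟩ : C)) := by
    intro a b hab
    have : y * (a : D) = y * b := congrArg Subtype.val hab
    exact Subtype.ext (mul_left_cancel₀ hy0 this)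
  obtain ⟨c, hc⟩ := LinearMap.surjective_of_injective hinj 1
  have : y * (c : D) = 1 := congrArg Subtype.val hc
  rw [← eq_inv_of_mul_eq_one_right this]
  exact c.2

theorem zpow_mem_of_finiteDimensional {F D : Type*} [Field F] [DivisionRing D] [Algebra F D]
    [FiniteDimensional F D] (C : Subalgebra F D) {y : D} (hy : y ∈ C) (n : ℤ) : y ^ n ∈ C := by
  cases n with
  | ofNat n => simpa using C.pow_mem hy n
  | negSucc n =>
    rw [zpow_negSucc]
    exact inv_mem_of_finiteDimensional C (C.pow_mem hy _)

section

variable {k : Type*} [Field k] {D : Type*} [DivisionRing D] [Algebra k⸨X⸩ D]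
  [FiniteDimensional k⸨X⸩ D]

/-- `y` generates the value group of the subalgebra `C`. -/
def IsGenerator (C : Subalgebra k⸨X⸩ D) (y : D) : Prop :=
  y ∈ C ∧ y ≠ 0 ∧ val k D y < 1 ∧ ∀ x ∈ C, x ≠ 0 → ∃ n : ℤ, val k D x = val k D y ^ n

omit [FiniteDimensional k⸨X⸩ D] in
theorem unif_mem (C : Subalgebra k⸨X⸩ D) : unif k D ∈ C := C.algebraMap_mem _

theorem constHom_mem (C : Subalgebra k⸨X⸩ D) (c : k) : (constHom k D c : D) ∈ C :=
  C.algebraMap_mem _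

theorem zpow_val_le_iff {y : D} (hy0 : y ≠ 0) (hy1 : val k D y < 1) {m n : ℤ} :
    val k D y ^ m ≤ val k D y ^ n ↔ n ≤ m :=
  zpow_le_zpow_iff_right_of_lt_one₀ (zero_lt_iff.2 ((Valuation.ne_zero_iff _).2 hy0)) hy1

/-- The value group is discrete: the generator has the least positive exponent, and a nonzero
remainder on division by it would be smaller. -/
theorem exists_isGenerator (C : Subalgebra k⸨X⸩ D) : ∃ y, IsGenerator C y := by
  classical
  have hex : ∃ m : ℕ, ∃ y ∈ C, 0 < m ∧ val k D y = WithZero.exp (-(m : ℤ)) := by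
    refine ⟨finrank k⸨X⸩ D, unif k D, unif_mem C, finrank_pos, ?_⟩
    rw [val_unif, ← WithZero.exp_nsmul]
    simp
  obtain ⟨y, hy, hm, hyv⟩ := Nat.find_spec hex
  set m := Nat.find hex with hmdef
  have hy0 : y ≠ 0 := by
    rintro rfl
    rw [map_zero] at hyv
    exact WithZero.exp_ne_zero hyv.symm
  refine ⟨y, hy, hy0, ?_, fun x hx hx0 => ?_⟩
  · rw [hyv, ← WithZero.exp_zero, WithZero.exp_lt_exp]; omega
  have hxv : (val k D x) ≠ 0 := (Valuation.ne_zero_iff _).2 hx0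
  obtain ⟨a, ha⟩ : ∃ a : ℤ, val k D x = WithZero.exp (-a) :=
    ⟨-(val k D x).log, by rw [neg_neg, WithZero.exp_log hxv]⟩
  refine ⟨a / m, ?_⟩
  have hz : ∀ q : ℤ, val k D y ^ q = WithZero.exp (-(m * q) : ℤ) := fun q => by
    rw [hyv, ← WithZero.exp_zsmul]; congr 1; simp [mul_comm]
  by_cases hr : a % m = 0
  · rw [ha, hz]; congr 2; rw [Int.mul_ediv_cancel' (Int.dvd_of_emod_eq_zero hr)]
  · exfalso
    have h1 := Int.emod_nonneg a (b := (m : ℤ)) (by omega)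
    have h2 := Int.emod_lt_of_pos a (b := (m : ℤ)) (by omega)
    refine Nat.find_min hex (m := (a % m).toNat) (by omega)
      ⟨x * y ^ (-(a / m)), C.mul_mem hx (zpow_mem_of_finiteDimensional C hy _), by omega, ?_⟩
    rw [map_mul, map_zpow₀, hz, ha, ← WithZero.exp_add]
    congr 1
    have := Int.emod_add_mul_ediv a m
    rw [Int.toNat_of_nonneg h1, mul_neg]
    omega

theorem IsGenerator.exists_val_unif_eq {C : Subalgebra k⸨X⸩ D} {y : D} (hy : IsGenerator C y) :
    ∃ e : ℕ, 0 < e ∧ val k D (unif k D) = val k D y ^ e := by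
  obtain ⟨hyC, hy0, hy1, hy2⟩ := hy
  obtain ⟨n, hn⟩ := hy2 _ (unif_mem C) (unif_ne_zero k D)
  have h1 : val k D y ^ n < val k D y ^ (0 : ℤ) := by
    rw [← hn, zpow_zero]; exact val_unif_lt_one k D
  have h2 : 0 < n := by
    by_contra h
    exact absurd ((zpow_val_le_iff hy0 hy1).2 (not_lt.1 h)) h1.not_ge
  exact ⟨n.toNat, by omega, by rw [hn, ← zpow_natCast, Int.toNat_of_nonneg h2.le]⟩

theorem IsGenerator.val_le {C : Subalgebra k⸨X⸩ D} {y x : D} (hy : IsGenerator C y) (hx : x ∈ C)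
    {m : ℤ} (h : val k D x < val k D y ^ m) : val k D x ≤ val k D y ^ (m + 1) := by
  rcases eq_or_ne x 0 with rfl | hx0
  · simp
  obtain ⟨hyC, hy0, hy1, hy2⟩ := hy
  obtain ⟨n, hn⟩ := hy2 x hx hx0
  rw [hn, zpow_val_le_iff hy0 hy1]
  rw [hn] at h
  by_contra hlt
  exact absurd ((zpow_val_le_iff hy0 hy1).2 (by omega : n ≤ m)) h.not_ge

theorem isGenerator_top_iff {z : D} : IsGenerator (⊤ : Subalgebra k⸨X⸩ D) z ↔ IsParameter k z := by
  simp [IsGenerator, IsParameter]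

/-- The residues of the integral elements of a subalgebra. -/
def residueSubmodule (C : Subalgebra k⸨X⸩ D) : Submodule k (Residue k D) where
  carrier := {a | ∃ x ∈ C, val k D x ≤ 1 ∧ res x = a}
  zero_mem' := ⟨0, C.zero_mem, by simp, res_zero⟩
  add_mem' := by
    rintro _ _ ⟨x, hx, hx', rfl⟩ ⟨y, hy, hy', rfl⟩
    exact ⟨x + y, C.add_mem hx hy, Valuation.map_add_le _ hx' hy', res_add hx' hy'⟩
  smul_mem' := by
    rintro c _ ⟨x, hx, hx', rfl⟩
    refine ⟨(constHom k D c : D) * x, C.mul_mem (constHom_mem C c) hx, ?_, (smul_eq_res c hx').symm⟩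
    rw [map_mul]
    exact mul_le_one' (constHom k D c).2 hx'

theorem mem_residueSubmodule {C : Subalgebra k⸨X⸩ D} {a : Residue k D} :
    a ∈ residueSubmodule C ↔ ∃ x ∈ C, val k D x ≤ 1 ∧ res x = a := Iff.rfl

theorem eq_zero_of_forall_val_le {y x : D} (hy0 : y ≠ 0) (hy1 : val k D y < 1)
    (h : ∀ n : ℕ, val k D x ≤ val k D y ^ n) : x = 0 := by
  by_contra hx
  have hxv : val k D x ≠ 0 := (Valuation.ne_zero_iff _).2 hx
  have hyv : val k D y ≠ 0 := (Valuation.ne_zero_iff _).2 hy0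
  have hlog : (val k D y).log < 0 := by
    rw [← WithZero.log_one]
    exact (WithZero.log_lt_log hyv one_ne_zero).2 hy1
  have := h ((val k D x).log.natAbs + 1)
  rw [← WithZero.log_le_log hxv (pow_ne_zero _ hyv), WithZero.log_pow, nsmul_eq_mul] at this
  push_cast at this
  have h2 : -(((val k D x).log.natAbs : ℤ) + 1) ≥ (((val k D x).log.natAbs : ℤ) + 1) * (val k D y).log := by
    nlinarith
  have h3 := neg_abs_le (val k D x).log
  rw [Int.natCast_natAbs] at h2
  linarith

theorem val_algebraMap_sub_trunc_le (f : PowerSeries k) (n : ℕ) :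
    val k D (algebraMap k⸨X⸩ D (f : k⸨X⸩) -
      ∑ m ∈ Finset.range n, (constHom k D (PowerSeries.coeff m f) : D) * unif k D ^ m) ≤
      val k D (unif k D) ^ n := by
  have h1 : ∑ m ∈ Finset.range n, (constHom k D (PowerSeries.coeff m f) : D) * unif k D ^ m =
      algebraMap k⸨X⸩ D (∑ m ∈ Finset.range n,
        HahnSeries.single (m : ℤ) (PowerSeries.coeff m f)) := by
    rw [map_sum]
    refine Finset.sum_congr rfl fun m _ => ?_
    rw [coe_constHom, unif, ← map_pow, ← map_mul]
    congr 1
    rw [HahnSeries.single_pow, HahnSeries.C_apply, HahnSeries.single_mul_single]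
    simp
  rw [h1, ← map_sub, ← zpow_natCast, val_algebraMap_le_iff]
  intro m hm
  rw [HahnSeries.coeff_sub, HahnSeries.coeff_sum, PowerSeries.coeff_coe]
  rcases lt_or_ge m 0 with h | h
  · rw [if_pos h, Finset.sum_eq_zero, sub_zero]
    intro j _
    rw [HahnSeries.coeff_single_of_ne]; omega
  · rw [if_neg (not_lt.2 h), Finset.sum_eq_single m.natAbs]
    · have : ((m.natAbs : ℕ) : ℤ) = m := by omega
      rw [this, HahnSeries.coeff_single_same, sub_self]
    · intro j _ hj
      rw [HahnSeries.coeff_single_of_ne]; omega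
    · intro hj
      exact absurd (Finset.mem_range.2 (by omega)) hj

/-- If elements of `C` can be approximated modulo `X` by combinations of the `w i` over the
constants, then they are combinations of the `w i` over the power series. -/
theorem exists_powerSeries_of_approx {ι : Type*} [Fintype ι] {w : ι → D}
    (hw : ∀ i, val k D (w i) ≤ 1) {C : Set D}
    (h : ∀ c ∈ C, val k D c ≤ 1 → ∃ a : ι → k, ∃ c' ∈ C, val k D c' ≤ 1 ∧
      c = ∑ i, (constHom k D (a i) : D) * w i + unif k D * c') {c : D} (hc : c ∈ C)
    (hc1 : val k D c ≤ 1) :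
    ∃ f : ι → PowerSeries k, c = ∑ i, algebraMap k⸨X⸩ D (f i : k⸨X⸩) * w i := by
  choose a g hg hg1 heq using h
  let G : ℕ → {x : D // x ∈ C ∧ val k D x ≤ 1} := fun n =>
    Nat.rec ⟨c, hc, hc1⟩ (fun _ x => ⟨g x.1 x.2.1 x.2.2, hg _ _ _, hg1 _ _ _⟩) n
  let A : ℕ → ι → k := fun n => a (G n).1 (G n).2.1 (G n).2.2
  have hG : ∀ n, (G n).1 = ∑ i, (constHom k D (A n i) : D) * w i + unif k D * (G (n + 1)).1 :=
    fun n => heq (G n).1 (G n).2.1 (G n).2.2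
  have hsum : ∀ n, c = ∑ i, (∑ m ∈ Finset.range n, (constHom k D (A m i) : D) * unif k D ^ m) * w i
      + unif k D ^ n * (G n).1 := by
    intro n
    induction n with
    | zero => simp [G]
    | succ n ih =>
      rw [ih]
      conv_lhs => rw [hG n]
      simp only [Finset.sum_range_succ, add_mul, Finset.sum_add_distrib, mul_add, Finset.mul_sum,
        pow_succ, mul_assoc, add_assoc]
      congr 2
      refine Finset.sum_congr rfl fun i _ => ?_
      rw [← mul_assoc, ← mul_assoc]
      congr 1
      exact (Algebra.commutes (HahnSeries.C (A n i) : k⸨X⸩) (unif k D ^ n)).symm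
  refine ⟨fun i => PowerSeries.mk fun n => A n i, ?_⟩
  rw [← sub_eq_zero]
  refine eq_zero_of_forall_val_le (k := k) (unif_ne_zero k D) (val_unif_lt_one k D) fun n => ?_
  conv_lhs => rw [hsum n]
  have h1 : ∀ x y z : D, x + y - z = y - (z - x) := fun x y z => by abel
  rw [h1, ← Finset.sum_sub_distrib]
  refine Valuation.map_sub_le (v := val k D) ?_ (Valuation.map_sum_le (val k D) fun i _ => ?_)
  · rw [map_mul, map_pow]
    exact mul_le_of_le_one_right zero_le (G n).2.2
  · rw [← sub_mul, map_mul]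
    refine (mul_le_of_le_one_right zero_le (hw i)).trans ?_
    simpa using val_algebraMap_sub_trunc_le (D := D) (PowerSeries.mk fun n => A n i) n

/-- The expansion of integral elements of a subalgebra with respect to lifts of a generating system
of the residues and the powers of a generator. -/
theorem IsGenerator.exists_powerSeries {C : Subalgebra k⸨X⸩ D} {y : D} (hy : IsGenerator C y)
    {e : ℕ} (he : val k D (unif k D) = val k D y ^ e) {ι : Type*} [Fintype ι] {x : ι → D}
    (hxC : ∀ i, x i ∈ C) (hx : ∀ i, val k D (x i) ≤ 1)
    (hsp : residueSubmodule C ≤ Submodule.span k (Set.range fun i => (res (x i) : Residue k D)))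
    {c : D} (hc : c ∈ C) (hc1 : val k D c ≤ 1) :
    ∃ f : Fin e × ι → PowerSeries k,
      c = ∑ ij, algebraMap k⸨X⸩ D (f ij : k⸨X⸩) * (x ij.2 * y ^ (ij.1 : ℕ)) := by
  obtain ⟨hyC, hy0, hy1, hy2⟩ := id hy
  have hyv : val k D y ≠ 0 := (Valuation.ne_zero_iff _).2 hy0
  refine exists_powerSeries_of_approx (C := C) (fun ij => ?_) ?_ hc hc1
  · rw [map_mul, map_pow]
    exact mul_le_one' (hx _) (pow_le_one₀ zero_le hy1.le)
  clear hc hc1 c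
  intro c hc hc1
  -- The element is expanded in powers of `y` up to order `e`. Since `y ^ e` and `X` have equal
  -- value, what remains is `X` times an integral element, as the approximation lemma requires.
  have key : ∀ m : ℕ, ∃ a : ℕ → ι → k, val k D
      (c - ∑ j ∈ Finset.range m, ∑ i, (constHom k D (a j i) : D) * (x i * y ^ j)) ≤
        val k D y ^ m := by
    intro m
    induction m with
    | zero => exact ⟨fun _ _ => 0, by simpa using hc1⟩
    | succ m ih =>
      obtain ⟨a, ha⟩ := ih
      set d := c - ∑ j ∈ Finset.range m, ∑ i, (constHom k D (a j i) : D) * (x i * y ^ j) with hd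
      have hdC : d ∈ C := C.sub_mem hc (C.sum_mem fun j _ => C.sum_mem fun i _ =>
        C.mul_mem (constHom_mem C _) (C.mul_mem (hxC i) (C.pow_mem hyC j)))
      have h1 : d * y ^ (-(m : ℤ)) ∈ C := C.mul_mem hdC (zpow_mem_of_finiteDimensional C hyC _)
      have h2 : val k D (d * y ^ (-(m : ℤ))) ≤ 1 := by
        rw [map_mul, map_zpow₀, zpow_neg, zpow_natCast]
        exact mul_inv_le_one_of_le₀ ha zero_le
      obtain ⟨b, hb⟩ := (Submodule.mem_span_range_iff_exists_fun k).1 (hsp ⟨_, h1, h2, rfl⟩)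
      refine ⟨Function.update a m b, ?_⟩
      have h3 : c - ∑ j ∈ Finset.range (m + 1), ∑ i,
          (constHom k D (Function.update a m b j i) : D) * (x i * y ^ j) =
          (d * y ^ (-(m : ℤ)) - ∑ i, (constHom k D (b i) : D) * x i) * y ^ m := by
        rw [Finset.sum_range_succ, ← sub_sub, sub_mul, mul_assoc, zpow_neg, zpow_natCast,
          inv_mul_cancel₀ (pow_ne_zero _ hy0), mul_one, hd, Finset.sum_mul]
        simp only [Function.update_self, mul_assoc]
        congr 2
        refine Finset.sum_congr rfl fun j hj => ?_
        rw [Function.update_of_ne (Finset.mem_range.1 hj).ne]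
      have h5 : ∀ i ∈ Finset.univ, val k D ((constHom k D (b i) : D) * x i) ≤ 1 := fun i _ => by
        rw [map_mul]; exact mul_le_one' (constHom k D _).2 (hx i)
      have h4 : val k D (d * y ^ (-(m : ℤ)) - ∑ i, (constHom k D (b i) : D) * x i) < 1 := by
        rw [← res_eq_res_iff h2 (Valuation.map_sum_le _ h5), res_sum _ _ h5, ← hb]
        exact Finset.sum_congr rfl fun i _ => smul_eq_res _ (hx i)
      rw [h3, map_mul, map_pow, pow_succ']
      refine mul_le_mul_left ?_ _
      have := hy.val_le (m := 0) (C.sub_mem h1 (C.sum_mem fun i _ =>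
        C.mul_mem (constHom_mem C (b i)) (hxC i))) (by simpa using h4)
      simpa using this
  obtain ⟨a, ha⟩ := key e
  refine ⟨fun ij => a ij.1 ij.2, (unif k D)⁻¹ * (c - ∑ j ∈ Finset.range e, ∑ i,
    (constHom k D (a j i) : D) * (x i * y ^ j)), ?_, ?_, ?_⟩
  · exact C.mul_mem (inv_mem_of_finiteDimensional C (unif_mem C)) (C.sub_mem hc
      (C.sum_mem fun j _ => C.sum_mem fun i _ =>
        C.mul_mem (constHom_mem C _) (C.mul_mem (hxC i) (C.pow_mem hyC j))))
  · rw [map_mul, map_inv₀]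
    exact inv_mul_le_one_of_le₀ (by rw [he]; exact ha) zero_le
  · rw [mul_inv_cancel_left₀ (unif_ne_zero k D), Fintype.sum_prod_type, Finset.sum_range]
    simp

theorem exists_unif_pow_mul_integral (c : D) : ∃ n : ℕ, val k D (unif k D ^ n * c) ≤ 1 := by
  by_contra! h
  have hc0 : c ≠ 0 := by rintro rfl; simpa using h 0
  have : c⁻¹ = 0 := by
    refine eq_zero_of_forall_val_le (k := k) (unif_ne_zero k D) (val_unif_lt_one k D) fun n => ?_
    have := (h n).le
    rw [map_mul, map_pow] at this
    rw [map_inv₀]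
    exact (inv_le_iff_one_le_mul₀ (zero_lt_iff.2 ((Valuation.ne_zero_iff _).2 hc0))).2 this
  exact inv_ne_zero hc0 this

/-- The fundamental equality `[C : F] = e f`. -/
theorem IsGenerator.finrank_eq {C : Subalgebra k⸨X⸩ D} {y : D} (hy : IsGenerator C y)
    {e : ℕ} (he : val k D (unif k D) = val k D y ^ e) :
    finrank k⸨X⸩ C = e * finrank k (residueSubmodule C) := by
  let b := Module.finBasis k (residueSubmodule C)
  choose x hxC hx hxb using fun i => mem_residueSubmodule.1 (b i).2
  have hli : LinearIndependent k fun i => (res (x i) : Residue k D) := by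
    simp only [hxb]
    exact b.linearIndependent.map' (residueSubmodule C).subtype (Submodule.ker_subtype _)
  refine le_antisymm ?_ ?_
  · have hsp : residueSubmodule C ≤
        Submodule.span k (Set.range fun i => (res (x i) : Residue k D)) := by
      simp only [hxb]
      have h1 : Set.range (fun i => (b i : Residue k D)) =
        (residueSubmodule C).subtype '' Set.range b := by rw [← Set.range_comp]; rfl
      rw [h1, Submodule.span_image, b.span_eq, Submodule.map_top, Submodule.range_subtype]
    have h1 : Subalgebra.toSubmodule C ≤ Submodule.span k⸨X⸩ (Set.range
        fun ij : Fin e × Fin (finrank k (residueSubmodule C)) => x ij.2 * y ^ (ij.1 : ℕ)) := by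
      intro c hc
      obtain ⟨n, hn⟩ := exists_unif_pow_mul_integral (k := k) c
      obtain ⟨f, hf⟩ := hy.exists_powerSeries he hxC hx hsp
        (C.mul_mem (C.pow_mem (unif_mem C) n) hc) hn
      have h2 : c = ((HahnSeries.single 1 1 : k⸨X⸩) ^ n)⁻¹ • (unif k D ^ n * c) := by
        rw [Algebra.smul_def, map_inv₀, map_pow]
        exact (inv_mul_cancel_left₀ (pow_ne_zero _ (unif_ne_zero k D)) _).symm
      rw [h2, hf]
      refine Submodule.smul_mem _ _ (Submodule.sum_mem _ fun ij _ => ?_)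
      rw [← Algebra.smul_def]
      exact Submodule.smul_mem _ _ (Submodule.subset_span ⟨ij, rfl⟩)
    calc finrank k⸨X⸩ C = finrank k⸨X⸩ (Subalgebra.toSubmodule C) := rfl
      _ ≤ _ := Submodule.finrank_mono h1
      _ ≤ _ := finrank_range_le_card _
      _ = _ := by simp
  · have := card_mul_le_finrank C hy.1 hy.2.2.1 he hxC hx hli
    simpa using this

/-- Both value groups are images of subgroups of `ℤ` under `n ↦ val z ^ n`, namely of `ℤ` and of `e
ℤ`, and this map is injective. -/
theorem ramificationIndex_eq {z : D} (hz : IsParameter k z) {e : ℕ}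
    (he : val k D (unif k D) = val k D z ^ e) : ramificationIndex k D = e := by
  have hzv : val k D z ≠ 0 := (Valuation.ne_zero_iff _).2 hz.1
  set g : (ℤᵐ⁰)ˣ := Units.mk0 _ hzv with hg
  have h1 : MonoidWithZeroHom.valueGroup (.ofClass (val k D)) =
      (⊤ : Subgroup (Multiplicative ℤ)).map (zpowersHom _ g) := by
    ext b
    rw [← SetLike.mem_coe, ← MonoidWithZeroHom.valueMonoid_eq_valueGroup']
    constructor
    · rintro ⟨x, hx⟩
      have hx0 : x ≠ 0 := by
        rintro rfl
        rw [map_zero] at hx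
        exact b.ne_zero hx.symm
      obtain ⟨n, hn⟩ := hz.2.2 x hx0
      refine ⟨Multiplicative.ofAdd n, trivial, Units.ext ?_⟩
      rw [zpowersHom_apply, Units.val_zpow_eq_zpow_val, ← hx]
      exact hn.symm
    · rintro ⟨n, -, rfl⟩
      refine ⟨z ^ n.toAdd, ?_⟩
      rw [zpowersHom_apply, Units.val_zpow_eq_zpow_val]
      exact map_zpow₀ (val k D) _ _
  have h2 : MonoidWithZeroHom.valueGroup (.ofClass ((val k D).comap (algebraMap k⸨X⸩ D))) =
      (AddSubgroup.toSubgroup (AddSubgroup.zmultiples (e : ℤ))).map (zpowersHom _ g) := by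
    ext b
    rw [← SetLike.mem_coe, ← MonoidWithZeroHom.valueMonoid_eq_valueGroup']
    constructor
    · rintro ⟨x, hx⟩
      have hx0 : x ≠ 0 := by
        rintro rfl
        rw [map_zero] at hx
        exact b.ne_zero hx.symm
      obtain ⟨n, hn⟩ := exists_val_algebraMap_eq k D hx0
      refine ⟨Multiplicative.ofAdd (n * e), ⟨n, rfl⟩, Units.ext ?_⟩
      rw [zpowersHom_apply, Units.val_zpow_eq_zpow_val, ← hx]
      change val k D z ^ (n * e) = val k D (algebraMap k⸨X⸩ D x)
      rw [hn, he, mul_comm, zpow_mul, zpow_natCast]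
    · rintro ⟨m, ⟨n, hn⟩, rfl⟩
      refine ⟨(HahnSeries.single 1 1) ^ n, ?_⟩
      rw [zpowersHom_apply, Units.val_zpow_eq_zpow_val]
      change val k D (algebraMap k⸨X⸩ D _) = val k D z ^ m.toAdd
      have hm : m.toAdd = n * e := by
        have : n • (e : ℤ) = m.toAdd := hn
        rw [← this, smul_eq_mul]
      rw [map_zpow₀, map_zpow₀, hm, mul_comm, zpow_mul, zpow_natCast, ← he]
      rfl
  have hinj : Function.Injective (zpowersHom (ℤᵐ⁰)ˣ g) := by
    intro m n hmn
    refine zpow_val_injective (k := k) hz.1 hz.2.1 ?_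
    have := congrArg Units.val hmn
    rwa [zpowersHom_apply, zpowersHom_apply, Units.val_zpow_eq_zpow_val,
      Units.val_zpow_eq_zpow_val] at this
  rw [ramificationIndex, h1, h2, Subgroup.relIndex_map_map_of_injective _ _ hinj,
    Subgroup.relIndex_top_right, AddSubgroup.index_toSubgroup, Int.index_zmultiples]
  simp

/-- Completeness comes coordinatewise from `k⟦X⟧`: each `d n` is `X ^ n` times a combination of
finitely many fixed elements over `k⟦X⟧`, and the coordinates can be summed because only the terms
with `n ≤ m` affect the coefficient of `X ^ m`. -/
theorem exists_val_sub_sum_le_unif (d : ℕ → D)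
    (hd : ∀ n, val k D (d n) ≤ val k D (unif k D) ^ n) :
    ∃ x : D, ∀ n, val k D (x - ∑ j ∈ Finset.range n, d j) ≤ val k D (unif k D) ^ n := by
  obtain ⟨y, hy⟩ := exists_isGenerator (⊤ : Subalgebra k⸨X⸩ D)
  obtain ⟨e, -, he⟩ := hy.exists_val_unif_eq
  let b := Module.finBasis k (Residue k D)
  choose x hx hxb using fun i => res_surjective (b i)
  have hsp : residueSubmodule (⊤ : Subalgebra k⸨X⸩ D) ≤
      Submodule.span k (Set.range fun i => (res (x i) : Residue k D)) := by
    simp only [hxb]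
    exact b.span_eq ▸ le_top
  have hd' : ∀ n, val k D ((unif k D)⁻¹ ^ n * d n) ≤ 1 := fun n => by
    rw [inv_pow, map_mul, map_inv₀, map_pow]
    exact inv_mul_le_one_of_le₀ (hd n) zero_le
  choose f hf using fun n => hy.exists_powerSeries he (fun _ => Algebra.mem_top) hx hsp
    Algebra.mem_top (hd' n)
  have hw : ∀ ij : Fin e × Fin (finrank k (Residue k D)),
      val k D (x ij.2 * y ^ (ij.1 : ℕ)) ≤ 1 := fun ij => by
    rw [map_mul, map_pow]
    exact mul_le_one' (hx _) (pow_le_one₀ zero_le hy.2.2.1.le)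
  let g := fun ij : Fin e × Fin (finrank k (Residue k D)) =>
    PowerSeries.mk fun m => ∑ n ∈ Finset.range (m + 1), PowerSeries.coeff (m - n) (f n ij)
  refine ⟨∑ ij, algebraMap k⸨X⸩ D (g ij : k⸨X⸩) * (x ij.2 * y ^ (ij.1 : ℕ)), fun n => ?_⟩
  have hdn : ∀ n, d n = ∑ ij, algebraMap k⸨X⸩ D ((PowerSeries.X ^ n * f n ij : PowerSeries k) : k⸨X⸩)
      * (x ij.2 * y ^ (ij.1 : ℕ)) := fun n => by
    have h1 : d n = unif k D ^ n * ((unif k D)⁻¹ ^ n * d n) := by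
      rw [inv_pow, mul_inv_cancel_left₀ (pow_ne_zero _ (unif_ne_zero k D))]
    conv_lhs => rw [h1, hf n]
    rw [Finset.mul_sum]
    refine Finset.sum_congr rfl fun ij _ => ?_
    rw [← mul_assoc, PowerSeries.coe_mul, map_mul, PowerSeries.coe_pow, PowerSeries.coe_X, map_pow]
    rfl
  simp only [hdn]
  rw [Finset.sum_comm, ← Finset.sum_sub_distrib]
  refine Valuation.map_sum_le (val k D) fun ij _ => ?_
  rw [← Finset.sum_mul, ← sub_mul, map_mul]
  refine (mul_le_of_le_one_right zero_le (hw ij)).trans ?_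
  rw [← map_sum, ← map_sub, ← zpow_natCast, val_algebraMap_le_iff]
  intro m hm
  have h2 : (g ij : k⸨X⸩) - ∑ j ∈ Finset.range n,
      ((PowerSeries.X ^ j * f j ij : PowerSeries k) : k⸨X⸩) =
      ((g ij - ∑ j ∈ Finset.range n, PowerSeries.X ^ j * f j ij : PowerSeries k) : k⸨X⸩) := by
    rw [PowerSeries.coe_sub]
    congr 1
    exact (map_sum (HahnSeries.ofPowerSeries ℤ k) _ _).symm
  rw [h2, PowerSeries.coeff_coe]
  split_ifs with hneg
  · rfl
  · rw [map_sub, map_sum, PowerSeries.coeff_mk, sub_eq_zero]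
    have h3 : m.natAbs + 1 ≤ n := by omega
    rw [← Finset.sum_subset (Finset.range_subset_range.2 h3)]
    · refine Finset.sum_congr rfl fun j hj => ?_
      rw [PowerSeries.coeff_X_pow_mul', if_pos (by have := Finset.mem_range.1 hj; omega)]
    · intro j _ hj
      rw [PowerSeries.coeff_X_pow_mul', if_neg (by rw [Finset.mem_range] at hj; omega)]

/-- `D` is complete. -/
theorem exists_val_sub_sum_le {z : D} (hz : IsParameter k z) (d : ℕ → D)
    (hd : ∀ n, val k D (d n) ≤ val k D z ^ n) :
    ∃ x : D, ∀ n, val k D (x - ∑ j ∈ Finset.range n, d j) ≤ val k D z ^ n := by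
  obtain ⟨e, he0, he⟩ := (isGenerator_top_iff.2 hz).exists_val_unif_eq
  have hanti : ∀ {m n : ℕ}, m ≤ n → val k D z ^ n ≤ val k D z ^ m := fun h =>
    pow_le_pow_right_of_le_one' hz.2.1.le h
  -- Blocks of `e` consecutive terms turn an estimate in powers of `z` into one in powers of `X`.
  obtain ⟨x, hx⟩ := exists_val_sub_sum_le_unif (k := k)
    (fun m => ∑ j ∈ Finset.range e, d (m * e + j)) (fun m => by
      refine Valuation.map_sum_le (val k D) fun j _ => (hd _).trans ?_
      rw [he, ← pow_mul, mul_comm e]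
      exact hanti (by omega))
  refine ⟨x, fun n => ?_⟩
  have h1 := hx n
  have h2 : ∀ m, ∑ i ∈ Finset.range m, ∑ j ∈ Finset.range e, d (i * e + j) =
      ∑ j ∈ Finset.range (m * e), d j := by
    intro m
    induction m with
    | zero => simp
    | succ m ih => rw [Finset.sum_range_succ, ih, add_mul, one_mul, Finset.sum_range_add]
  rw [h2, he, ← pow_mul] at h1
  have hne : n ≤ n * e := Nat.le_mul_of_pos_right n he0
  have h3 : x - ∑ j ∈ Finset.range n, d j = (x - ∑ j ∈ Finset.range (n * e), d j) +
      ∑ j ∈ Finset.Ico n (n * e), d j := by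
    rw [← Finset.sum_range_add_sum_Ico _ hne]
    abel
  rw [h3]
  refine Valuation.map_add_le _ (h1.trans (hanti ?_)) (Valuation.map_sum_le (val k D) fun j hj =>
    (hd j).trans (hanti (Finset.mem_Ico.1 hj).1))
  rw [mul_comm]; exact hne

end

end SplitAlg

set_option linter.unusedSectionVars false

/-! ### Hensel's lemma and intertwining of roots -/

namespace SplitAlg

attribute [local instance] residueDivisionRing

noncomputable abbrev centerField {k R : Type*} [Field k] [DivisionRing R] [Algebra k R]
    [FiniteDimensional k R] : Field (Subalgebra.center k R) :=
  fieldOfFiniteDimensional k (Subalgebra.center k R)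

attribute [local instance] centerField

noncomputable abbrev centerAlgebra {k R : Type*} [Field k] [DivisionRing R] [Algebra k R]
    [FiniteDimensional k R] : Algebra (Subalgebra.center k R) R where
  algebraMap := (Subalgebra.center k R).val.toRingHom
  commutes' c x := (Subalgebra.mem_center_iff.1 c.2 x).symm
  smul_def' _ _ := rfl

attribute [local instance] centerAlgebra

/-- The dimension of a commutative subalgebra of a division algebra with arbitrary centre. -/
theorem finrank_sq_le_mul_finrank_center {k R : Type*} [Field k] [DivisionRing R] [Algebra k R]
    [FiniteDimensional k R] (P : Subalgebra k R) (hP : ∀ x ∈ P, ∀ y ∈ P, x * y = y * x) :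
    finrank k P ^ 2 ≤ finrank k R * finrank k (Subalgebra.center k R) := by
  let Z := Subalgebra.center k R
  have : Algebra.IsCentral Z R := ⟨fun x hx =>
    ⟨⟨x, Subalgebra.mem_center_iff.2 (Subalgebra.mem_center_iff.1 hx)⟩, rfl⟩⟩
  have : FiniteDimensional Z R := Module.Finite.of_restrictScalars_finite k Z R
  -- Enlarging `P` by the centre keeps it commutative and reduces the claim to the central case over
  -- `Z`.
  let P' := Algebra.adjoin Z (P : Set R)
  have h1 := finrank_sq_le_of_commute P' (fun x hx y hy =>
    congrArg Subtype.val ((Algebra.isMulCommutative_adjoin Z hP).is_comm.comm ⟨x, hx⟩ ⟨y, hy⟩))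
  have h2 : finrank k P ≤ finrank k (P'.restrictScalars k) :=
    Submodule.finrank_mono (s := Subalgebra.toSubmodule P)
      (t := Subalgebra.toSubmodule (P'.restrictScalars k)) Algebra.subset_adjoin
  have h3 : finrank k Z * finrank Z P' = finrank k (P'.restrictScalars k) :=
    finrank_mul_finrank k Z P'
  have h4 : finrank k Z * finrank Z R = finrank k R := finrank_mul_finrank k Z R
  change _ ≤ finrank k R * finrank k Z
  calc finrank k P ^ 2 ≤ (finrank k Z * finrank Z P') ^ 2 := by rw [h3]; gcongr
    _ = finrank k Z * finrank Z P' ^ 2 * finrank k Z := by ring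
    _ ≤ finrank k Z * finrank Z R * finrank k Z := by gcongr
    _ = _ := by rw [h4]

section

variable {k : Type*} [Field k] {D : Type*} [DivisionRing D] [Algebra k⸨X⸩ D]
  [FiniteDimensional k⸨X⸩ D]

/-- The value at `x` of a polynomial with constant coefficients. -/
noncomputable def evalConst (x : D) (g : k[X]) : D := aeval x (g.map (HahnSeries.C : k →+* k⸨X⸩))

theorem evalConst_add (x : D) (g h : k[X]) :
    evalConst x (g + h) = evalConst x g + evalConst x h := by simp [evalConst]

theorem evalConst_mul (x : D) (g h : k[X]) :
    evalConst x (g * h) = evalConst x g * evalConst x h := by simp [evalConst]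

theorem evalConst_monomial (x : D) (n : ℕ) (c : k) :
    evalConst x (monomial n c) = (constHom k D c : D) * x ^ n := by
  simp [evalConst, coe_constHom, aeval_monomial]

theorem evalConst_comp (x : D) (g h : k[X]) :
    evalConst x (g.comp h) = evalConst (evalConst x h) g := by
  rw [evalConst, map_comp, aeval_comp]; rfl

theorem evalConst_mem {C : Subalgebra k⸨X⸩ D} {x : D} (hx : x ∈ C) (g : k[X]) :
    evalConst x g ∈ C :=
  Algebra.adjoin_le (Set.singleton_subset_iff.2 hx) (aeval_mem_adjoin_singleton k⸨X⸩ x)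

theorem conj_evalConst {z : D} (hz : z ≠ 0) (x : D) (g : k[X]) :
    evalConst (z * x * z⁻¹) g = z * evalConst x g * z⁻¹ := by
  rw [← conjAlgHom_apply k⸨X⸩ hz, ← conjAlgHom_apply k⸨X⸩ hz, evalConst, evalConst,
    aeval_algHom_apply]

theorem res_pow {x : D} (hx : val k D x ≤ 1) (n : ℕ) :
    (res (x ^ n) : Residue k D) = res x ^ n := by
  induction n with
  | zero => simp [res_one]
  | succ n ih => rw [pow_succ, res_mul (by rw [map_pow]; exact pow_le_one₀ zero_le hx) hx, ih, pow_succ]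

theorem val_evalConst_le {x : D} (hx : val k D x ≤ 1) (g : k[X]) :
    val k D (evalConst x g) ≤ 1 := by
  induction g using Polynomial.induction_on' with
  | add g h hg hh => rw [evalConst_add]; exact Valuation.map_add_le _ hg hh
  | monomial n c =>
    rw [evalConst_monomial, map_mul, map_pow]
    exact mul_le_one' (constHom k D c).2 (pow_le_one₀ zero_le hx)

theorem res_evalConst {x : D} (hx : val k D x ≤ 1) (g : k[X]) :
    res (evalConst x g) = aeval (res x : Residue k D) g := by
  induction g using Polynomial.induction_on' with
  | add g h hg hh =>
    rw [evalConst_add, res_add (val_evalConst_le hx g) (val_evalConst_le hx h), hg, hh, map_add]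
  | monomial n c =>
    rw [evalConst_monomial, res_mul (constHom k D c).2 (by rw [map_pow]; exact pow_le_one₀ zero_le hx),
      res_constHom, res_pow hx, aeval_monomial]

/-- The divided difference of a polynomial at two elements, which intertwines two roots with the
same residue. -/
theorem exists_divided_difference {x₁ x₂ : D} (hx₁ : val k D x₁ ≤ 1) (hx₂ : val k D x₂ ≤ 1)
    (h : (res x₁ : Residue k D) = res x₂) (g : k[X]) :
    ∃ v : D, val k D v ≤ 1 ∧ x₂ * v - v * x₁ = evalConst x₂ g - evalConst x₁ g ∧
      (res v : Residue k D) = aeval (res x₁) (derivative g) ∧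
      ∀ C : Subalgebra k⸨X⸩ D, x₁ ∈ C → x₂ ∈ C → v ∈ C := by
  induction g using Polynomial.induction_on' with
  | add g g' hg hg' =>
    obtain ⟨v, h1, h2, h3, h4⟩ := hg
    obtain ⟨v', h1', h2', h3', h4'⟩ := hg'
    refine ⟨v + v', Valuation.map_add_le _ h1 h1', ?_, ?_, fun C hC hC' =>
      C.add_mem (h4 C hC hC') (h4' C hC hC')⟩
    · rw [evalConst_add, evalConst_add, mul_add, add_mul, add_sub_add_comm, add_sub_add_comm, h2, h2']
    · rw [res_add h1 h1', h3, h3', derivative_add, map_add]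
  | monomial n c =>
    -- The divided difference of `X ^ n` is `∑ x₂ ^ j * x₁ ^ (n - 1 - j)`, built by the recursion `w
    -- ↦ x₂ ^ n + w * x₁`. Equal residues turn it into `n * res x₁ ^ (n - 1)`.
    have key : ∃ w : D, val k D w ≤ 1 ∧ x₂ * w - w * x₁ = x₂ ^ n - x₁ ^ n ∧
        (res w : Residue k D) = (n : Residue k D) * res x₁ ^ (n - 1) ∧
        ∀ C : Subalgebra k⸨X⸩ D, x₁ ∈ C → x₂ ∈ C → w ∈ C := by
      induction n with
      | zero => exact ⟨0, by simp, by simp, by simp [res_zero], fun C _ _ => C.zero_mem⟩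
      | succ n ih =>
        obtain ⟨w, h1, h2, h3, h4⟩ := ih
        have h5 : val k D (x₂ ^ n) ≤ 1 := by rw [map_pow]; exact pow_le_one₀ zero_le hx₂
        have h6 : val k D (w * x₁) ≤ 1 := by rw [map_mul]; exact mul_le_one' h1 hx₁
        refine ⟨x₂ ^ n + w * x₁, Valuation.map_add_le _ h5 h6, ?_, ?_, fun C hC hC' =>
          C.add_mem (C.pow_mem hC' n) (C.mul_mem (h4 C hC hC') hC)⟩
        · rw [mul_add, add_mul, ← mul_assoc, ← pow_succ', add_sub_add_comm, ← sub_mul, h2,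
            sub_mul, ← pow_succ]
          abel
        · rw [res_add h5 h6, res_pow hx₂, ← h, res_mul h1 hx₁, h3, add_tsub_cancel_right]
          rcases n with _ | n
          · simp
          · rw [add_tsub_cancel_right, mul_assoc, ← pow_succ]
            push_cast
            rw [add_mul ((n : Residue k D) + 1) 1, one_mul, add_comm]
    obtain ⟨w, h1, h2, h3, h4⟩ := key
    refine ⟨constHom k D c * w, ?_, ?_, ?_, fun C hC hC' =>
      C.mul_mem (constHom_mem C c) (h4 C hC hC')⟩
    · rw [map_mul]; exact mul_le_one' (constHom k D c).2 h1
    · rw [evalConst_monomial, evalConst_monomial, ← mul_sub, ← h2, mul_sub, ← mul_assoc,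
        coe_constHom, ← Algebra.commutes, mul_assoc, mul_assoc]
    · rw [res_mul (constHom k D c).2 h1, res_constHom, h3, derivative_monomial, aeval_monomial,
        map_mul, map_natCast, mul_assoc]

/-- Two roots with the same residue are intertwined by a unit of the valuation ring. -/
theorem exists_intertwine {x₁ x₂ : D} (hx₁ : val k D x₁ ≤ 1) (hx₂ : val k D x₂ ≤ 1)
    (h : (res x₁ : Residue k D) = res x₂) {g : k[X]} (h₁ : evalConst x₁ g = 0)
    (h₂ : evalConst x₂ g = 0) (hg : aeval (res x₁ : Residue k D) (derivative g) ≠ 0) :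
    ∃ v : D, val k D v = 1 ∧ x₂ * v = v * x₁ ∧
      ∀ C : Subalgebra k⸨X⸩ D, x₁ ∈ C → x₂ ∈ C → v ∈ C := by
  obtain ⟨v, h3, h4, h5, h6⟩ := exists_divided_difference hx₁ hx₂ h g
  refine ⟨v, le_antisymm h3 (not_lt.1 fun hlt => hg ?_), ?_, h6⟩
  · rw [← h5, res_eq_zero_iff h3]; exact hlt
  · rwa [h₁, h₂, sub_zero, sub_eq_zero] at h4

theorem ne_zero_of_val_eq_one {v : D} (hv : val k D v = 1) : v ≠ 0 := by
  rintro rfl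
  rw [map_zero] at hv
  exact zero_ne_one hv

/-- Commuting roots with the same residue are equal. -/
theorem eq_of_commute_of_res_eq {x₁ x₂ : D} (hx₁ : val k D x₁ ≤ 1) (hx₂ : val k D x₂ ≤ 1)
    (h : (res x₁ : Residue k D) = res x₂) {g : k[X]} (h₁ : evalConst x₁ g = 0)
    (h₂ : evalConst x₂ g = 0) (hg : aeval (res x₁ : Residue k D) (derivative g) ≠ 0)
    (hc : x₁ * x₂ = x₂ * x₁) : x₁ = x₂ := by
  obtain ⟨v, h3, h4, h5⟩ := exists_intertwine hx₁ hx₂ h h₁ h₂ hg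
  -- The intertwiner lies in every subalgebra containing both roots, in particular in the
  -- centralizer of `x₁`.
  have h6 := h5 (Subalgebra.centralizer k⸨X⸩ {x₁}) (by simp [Subalgebra.mem_centralizer_iff])
    (by simp [Subalgebra.mem_centralizer_iff, hc])
  rw [Subalgebra.mem_centralizer_iff] at h6
  have h7 := h6 x₁ rfl
  rw [← h7] at h4
  exact (mul_right_cancel₀ (ne_zero_of_val_eq_one h3) h4).symm

/-- One step of Newton's iteration. -/
theorem exists_newton_step {S : Subalgebra k⸨X⸩ D} (hS : ∀ x ∈ S, ∀ y ∈ S, x * y = y * x)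
    {z : D} (hz : IsParameter k z) (g : k[X]) {x : D} (hxS : x ∈ S) (hx : val k D x ≤ 1)
    (hg : aeval (res x : Residue k D) (derivative g) ≠ 0) {n : ℕ}
    (hn : val k D (evalConst x g) ≤ val k D z ^ (n + 1)) :
    ∃ h ∈ S, val k D h ≤ val k D z ^ (n + 1) ∧
      val k D (evalConst (x + h) g) ≤ val k D z ^ (n + 2) := by
  have hd : val k D (evalConst x (derivative g)) = 1 := by
    refine le_antisymm (val_evalConst_le hx _) (not_lt.1 fun hlt => hg ?_)
    rw [← res_evalConst hx, res_eq_zero_iff (val_evalConst_le hx _)]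
    exact hlt
  set h : D := -(evalConst x g * (evalConst x (derivative g))⁻¹) with hh
  have hhS : h ∈ S := S.neg_mem (S.mul_mem (evalConst_mem hxS _)
    (inv_mem_of_finiteDimensional S (evalConst_mem hxS _)))
  have hhv : val k D h ≤ val k D z ^ (n + 1) := by
    rw [hh, Valuation.map_neg, map_mul, map_inv₀, hd, inv_one, mul_one]
    exact hn
  have hh1 : val k D h ≤ 1 := hhv.trans (pow_le_one₀ zero_le hz.2.1.le)
  refine ⟨h, hhS, hhv, ?_⟩
  -- A second order Taylor expansion with integral remainder, available because `x` and `h` commute.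
  have taylor : ∀ g : k[X], ∃ r : D, val k D r ≤ 1 ∧
      evalConst (x + h) g = evalConst x g + evalConst x (derivative g) * h + r * h ^ 2 := by
    have hxh : x * h = h * x := hS x hxS h hhS
    intro g
    induction g using Polynomial.induction_on' with
    | add g g' hg hg' =>
      obtain ⟨r, h1, h2⟩ := hg
      obtain ⟨r', h1', h2'⟩ := hg'
      refine ⟨r + r', Valuation.map_add_le _ h1 h1', ?_⟩
      rw [evalConst_add, h2, h2', derivative_add, evalConst_add, evalConst_add]
      simp only [add_mul]
      abel
    | monomial m c =>
      have key : ∃ r : D, val k D r ≤ 1 ∧ r * h = h * r ∧ (x + h) ^ m =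
          x ^ m + (m : D) * x ^ (m - 1) * h + r * h ^ 2 := by
        have hcm : Commute x h := hxh
        induction m with
        | zero => exact ⟨0, by simp, by simp, by simp⟩
        | succ m ih =>
          obtain ⟨r, h1, h2, h3⟩ := ih
          have h4 : val k D ((m : D) * x ^ (m - 1)) ≤ 1 := by
            rw [map_mul, map_pow]
            refine mul_le_one' ?_ (pow_le_one₀ zero_le hx)
            exact natCast_mem (val k D).integer m
          refine ⟨(x + h) * r + (m : D) * x ^ (m - 1), Valuation.map_add_le _ ?_ h4, ?_, ?_⟩
          · rw [map_mul]; exact mul_le_one' (Valuation.map_add_le _ hx hh1) h1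
          · refine ((Commute.mul_left ?_ h2).add_left (Commute.mul_left (Nat.cast_commute _ _)
              (hcm.pow_left _)))
            exact hcm.add_left (Commute.refl h)
          · have h5 : x * ((m : D) * x ^ (m - 1)) = m * x ^ m := by
              rcases m with _ | m
              · simp
              · rw [add_tsub_cancel_right, pow_succ' x m, ← mul_assoc, ← mul_assoc,
                  (Nat.cast_commute _ _).eq]
            have h6 : h * ((m : D) * x ^ (m - 1)) = (m : D) * x ^ (m - 1) * h :=
              (Commute.mul_left (Nat.cast_commute _ _) (hcm.pow_left _)).symm.eq
            rw [pow_succ' (x + h), h3, add_tsub_cancel_right]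
            have h7 : (x + h) * (x ^ m + (m : D) * x ^ (m - 1) * h + r * h ^ 2) =
              x * x ^ m + h * x ^ m + x * ((m : D) * x ^ (m - 1)) * h +
                h * ((m : D) * x ^ (m - 1)) * h + (x + h) * r * h ^ 2 := by
              noncomm_ring
            rw [h7, h5, h6, ← pow_succ', (hcm.pow_left m).symm.eq]
            push_cast
            noncomm_ring
      obtain ⟨r, h1, -, h3⟩ := key
      refine ⟨constHom k D c * r, ?_, ?_⟩
      · rw [map_mul]; exact mul_le_one' (constHom k D c).2 h1
      · rw [evalConst_monomial, evalConst_monomial, derivative_monomial, evalConst_monomial, h3,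
          map_mul, map_natCast]
        push_cast
        simp only [mul_add, mul_assoc]
  obtain ⟨r, hr1, hr⟩ := taylor g
  have h8 : evalConst x (derivative g) * h = - evalConst x g := by
    rw [hS _ (evalConst_mem hxS _) _ hhS, hh, neg_mul, inv_mul_cancel_right₀
      (ne_zero_of_val_eq_one hd)]
  rw [hr, h8, add_neg_cancel, zero_add, map_mul, map_pow]
  refine (mul_le_of_le_one_left zero_le hr1).trans ?_
  calc val k D h ^ 2 ≤ (val k D z ^ (n + 1)) ^ 2 := by gcongr
    _ = val k D z ^ ((n + 1) * 2) := (pow_mul _ _ _).symm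
    _ ≤ val k D z ^ (n + 2) := pow_le_pow_right_of_le_one' hz.2.1.le (by omega)

theorem exists_isParameter : ∃ z : D, IsParameter k z := by
  obtain ⟨z, hz⟩ := exists_isGenerator (⊤ : Subalgebra k⸨X⸩ D)
  exact ⟨z, isGenerator_top_iff.1 hz⟩

/-- Conjugation by `d` preserves values, so `x - d * x * d⁻¹` is as small as the error of the
approximation. -/
theorem commute_of_forall_approx {z : D} (hz : IsParameter k z) {x d : D}
    (h : ∀ n : ℕ, ∃ y, y * d = d * y ∧ val k D (x - y) ≤ val k D z ^ n) : x * d = d * x := by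
  rcases eq_or_ne d 0 with rfl | hd
  · simp
  have h1 : x - d * x * d⁻¹ = 0 := by
    refine eq_zero_of_forall_val_le (k := k) hz.1 hz.2.1 fun n => ?_
    obtain ⟨y, hy, hxy⟩ := h n
    have h2 : x - d * x * d⁻¹ = (x - y) - d * (x - y) * d⁻¹ := by
      rw [mul_sub, sub_mul, ← hy, mul_inv_cancel_right₀ hd]; abel
    rw [h2]
    refine Valuation.map_sub_le (v := val k D) hxy ?_
    rw [map_mul, map_mul, map_inv₀, mul_comm, inv_mul_cancel_left₀ ((Valuation.ne_zero_iff _).2 hd)]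
    exact hxy
  rw [sub_eq_zero] at h1
  conv_lhs => rw [h1]
  rw [inv_mul_cancel_right₀ hd]

theorem val_evalConst_sub_le {z x y : D} (hx : val k D x ≤ 1) (hy : val k D y ≤ 1)
    (g : k[X]) {n : ℕ}
    (h : val k D (x - y) ≤ val k D z ^ n) :
    val k D (evalConst x g - evalConst y g) ≤ val k D z ^ n := by
  induction g using Polynomial.induction_on' with
  | add g g' hg hg' =>
    rw [evalConst_add, evalConst_add, add_sub_add_comm]
    exact Valuation.map_add_le _ hg hg'
  | monomial m c =>
    rw [evalConst_monomial, evalConst_monomial, ← mul_sub, map_mul]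
    refine (mul_le_of_le_one_left zero_le (constHom k D c).2).trans ?_
    induction m with
    | zero => simp
    | succ m ih =>
      have h1 : x ^ (m + 1) - y ^ (m + 1) = x ^ m * (x - y) + (x ^ m - y ^ m) * y := by
        rw [pow_succ, pow_succ]; noncomm_ring
      rw [h1]
      refine Valuation.map_add_le _ ?_ ?_
      · rw [map_mul, map_pow]
        exact (mul_le_of_le_one_left zero_le (pow_le_one₀ zero_le hx)).trans h
      · rw [map_mul]
        exact (mul_le_of_le_one_right zero_le hy).trans ih

/-- Hensel's lemma in the (commutative) bicommutant of an element. -/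
theorem exists_root_lift {x₀ : D} (hx₀ : val k D x₀ ≤ 1) {g : k[X]}
    (h₀ : aeval (res x₀ : Residue k D) g = 0)
    (h₁ : aeval (res x₀ : Residue k D) (derivative g) ≠ 0) :
    ∃ x : D, val k D x ≤ 1 ∧ (res x : Residue k D) = res x₀ ∧ evalConst x g = 0 ∧
      ∀ d, x₀ * d = d * x₀ → x * d = d * x := by
  obtain ⟨z, hz⟩ := exists_isParameter (k := k) (D := D)
  let T : Set D := (Subalgebra.centralizer k⸨X⸩ {x₀} : Set D)
  have hT : ∀ d, d ∈ T ↔ x₀ * d = d * x₀ := fun d => by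
    simp [T, Set.mem_centralizer_iff]
  -- The double centralizer of `x₀` is commutative and contains the inverses of its elements, so
  -- Newton's iteration stays in it. Its limit then commutes with everything that commutes with
  -- `x₀`.
  let S := Subalgebra.centralizer k⸨X⸩ T
  have hSd : ∀ x, x ∈ S ↔ ∀ d, x₀ * d = d * x₀ → d * x = x * d := fun x => by
    simp only [S, Subalgebra.mem_centralizer_iff, T, hT]
  have hx₀S : x₀ ∈ S := (hSd _).2 fun d hd => hd.symm
  have hS : ∀ x ∈ S, ∀ y ∈ S, x * y = y * x := fun x hx y hy =>
    (hSd y).1 hy x ((hSd x).1 hx x₀ rfl)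
  let Q : ℕ → D → Prop := fun n x => x ∈ S ∧ val k D x ≤ 1 ∧ (res x : Residue k D) = res x₀ ∧
    val k D (evalConst x g) ≤ val k D z ^ (n + 1)
  have step : ∀ n x, Q n x → ∃ h, val k D h ≤ val k D z ^ (n + 1) ∧ Q (n + 1) (x + h) := by
    rintro n x ⟨h1, h2, h3, h4⟩
    obtain ⟨h, hhS, hh1, hh2⟩ := exists_newton_step hS hz g h1 h2 (by rwa [h3]) h4
    have hlt : val k D h < 1 := hh1.trans_lt (pow_lt_one₀ zero_le hz.2.1 (by omega))
    refine ⟨h, hh1, S.add_mem h1 hhS, Valuation.map_add_le _ h2 hlt.le, ?_, hh2⟩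
    rw [res_add h2 hlt.le, (res_eq_zero_iff hlt.le).2 hlt, add_zero, h3]
  choose H hH1 hH2 using step
  have hQ0 : Q 0 x₀ := by
    refine ⟨hx₀S, hx₀, rfl, ?_⟩
    rw [zero_add, pow_one]
    refine hz.val_le ?_
    rw [← res_eq_zero_iff (val_evalConst_le hx₀ g), res_evalConst hx₀, h₀]
  let s : (n : ℕ) → {x : D // Q n x} := fun n =>
    Nat.rec ⟨x₀, hQ0⟩ (fun n x => ⟨x.1 + H n x.1 x.2, hH2 n x.1 x.2⟩) n
  obtain ⟨x, hx⟩ := exists_val_sub_sum_le hz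
    (fun n => Nat.rec (motive := fun _ => D) x₀ (fun n _ => H n (s n).1 (s n).2) n) (by
      intro n
      cases n with
      | zero => simpa using hx₀
      | succ n => exact hH1 n _ _)
  have hsum : ∀ n, ∑ j ∈ Finset.range (n + 1),
      (Nat.rec (motive := fun _ => D) x₀ (fun n _ => H n (s n).1 (s n).2) j : D) = (s n).1 := by
    intro n
    induction n with
    | zero => simp [s]
    | succ n ih => rw [Finset.sum_range_succ, ih]
  have hxs : ∀ n, val k D (x - (s n).1) ≤ val k D z ^ (n + 1) := fun n => by
    rw [← hsum]; exact hx (n + 1)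
  have hxS : x ∈ S := by
    refine (hSd x).2 fun d hd => (commute_of_forall_approx hz fun n => ⟨(s n).1,
      ((hSd _).1 (s n).2.1 d hd).symm, (hxs n).trans ?_⟩).symm
    exact pow_le_pow_right_of_le_one' hz.2.1.le (by omega)
  have hx1 : val k D x ≤ 1 := by
    have := Valuation.map_add_le (val k D) ((hxs 0).trans (pow_le_one₀ zero_le hz.2.1.le)) hx₀
    simpa [s] using this
  refine ⟨x, hx1, ?_, ?_, fun d hd => ((hSd x).1 hxS d hd).symm⟩
  · rw [res_eq_res_iff hx1 hx₀]
    have := hxs 0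
    rw [zero_add, pow_one] at this
    exact this.trans_lt hz.2.1
  · refine eq_zero_of_forall_val_le (k := k) hz.1 hz.2.1 fun n => ?_
    have h3 : val k D (x - (s n).1) ≤ val k D z ^ n :=
      (hxs n).trans (pow_le_pow_right_of_le_one' hz.2.1.le (by omega))
    have h4 := val_evalConst_sub_le hx1 (s n).2.2.1 g h3
    have h5 : val k D (evalConst (s n).1 g) ≤ val k D z ^ n :=
      ((s n).2.2.2.2).trans (pow_le_pow_right_of_le_one' hz.2.1.le (by omega))
    have := Valuation.map_add_le _ h4 h5
    rwa [sub_add_cancel] at this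

end

end SplitAlg

/-! ### The degree of the residue centre equals the ramification index -/

namespace SplitAlg

attribute [local instance] residueDivisionRing centerField centerAlgebra

theorem aeval_derivative_minpoly_ne_zero {k R : Type*} [Field k] [Ring R] [Nontrivial R]
    [Algebra k R] {θ : R} (hθ : IsSeparable k θ) : aeval θ (derivative (minpoly k θ)) ≠ 0 := by
  obtain ⟨a, b, hab⟩ := hθ
  intro h
  have := congrArg (aeval θ) hab
  rw [map_add, map_mul, map_mul, minpoly.aeval, h, mul_zero, mul_zero, add_zero, map_one] at this
  exact zero_ne_one this

theorem adjoin_commute {F R : Type*} [Field F] [Ring R] [Algebra F R] {s : Set R}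
    (hs : ∀ x ∈ s, ∀ y ∈ s, x * y = y * x) :
    ∀ x ∈ Algebra.adjoin F s, ∀ y ∈ Algebra.adjoin F s, x * y = y * x := fun x hx y hy =>
  congrArg Subtype.val ((Algebra.isMulCommutative_adjoin F hs).is_comm.comm ⟨x, hx⟩ ⟨y, hy⟩)

theorem mem_centralizer_singleton {F R : Type*} [Field F] [Ring R] [Algebra F R] {x d : R} :
    d ∈ Subalgebra.centralizer F {x} ↔ x * d = d * x := by
  simp [Subalgebra.mem_centralizer_iff]

theorem centralizer_adjoin_singleton {F R : Type*} [Field F] [Ring R] [Algebra F R] (x : R) :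
    Subalgebra.centralizer F (Algebra.adjoin F {x} : Set R) = Subalgebra.centralizer F {x} := by
  refine le_antisymm (Subalgebra.centralizer_le F _ _ Algebra.subset_adjoin) fun d hd => ?_
  rw [Subalgebra.mem_centralizer_iff]
  have : Algebra.adjoin F {x} ≤ Subalgebra.centralizer F {d} :=
    Algebra.adjoin_le (Set.singleton_subset_iff.2
      (mem_centralizer_singleton.2 (mem_centralizer_singleton.1 hd).symm))
  exact fun y hy => (mem_centralizer_singleton.1 (this hy)).symm

section

variable {k : Type*} [Field k] {D : Type*} [DivisionRing D] [Algebra k⸨X⸩ D]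
  [FiniteDimensional k⸨X⸩ D]

theorem exists_lift_minpoly {x₀ : D} (hx₀ : val k D x₀ ≤ 1)
    (hsep : IsSeparable k (res x₀ : Residue k D)) :
    ∃ x : D, val k D x ≤ 1 ∧ (res x : Residue k D) = res x₀ ∧
      evalConst x (minpoly k (res x₀ : Residue k D)) = 0 ∧
      ∀ d, x₀ * d = d * x₀ → x * d = d * x :=
  exists_root_lift hx₀ (minpoly.aeval _ _) (aeval_derivative_minpoly_ne_zero hsep)

open Classical in
/-- A lift of a root of a polynomial over `k` generates an unramified extension. -/
theorem finrank_adjoin_lift {x : D} (hx : val k D x ≤ 1)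
    (h : evalConst x (minpoly k (res x : Residue k D)) = 0) :
    finrank k⸨X⸩ (Algebra.adjoin k⸨X⸩ {x}) = (minpoly k (res x : Residue k D)).natDegree := by
  have hint : IsIntegral k (res x : Residue k D) := Algebra.IsIntegral.isIntegral _
  set g := minpoly k (res x : Residue k D) with hg
  have hm : (g.map (HahnSeries.C : k →+* k⸨X⸩)).Monic := (minpoly.monic hint).map _
  have hdeg : (g.map (HahnSeries.C : k →+* k⸨X⸩)).natDegree = g.natDegree :=
    (minpoly.monic hint).natDegree_map _
  refine le_antisymm ?_ ?_
  · change finrank k⸨X⸩ (Subalgebra.toSubmodule (Algebra.adjoin k⸨X⸩ {x})) ≤ _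
    rw [← Submodule.span_range_natDegree_eq_adjoin hm h, hdeg]
    refine (finrank_span_finset_le_card _).trans (Finset.card_image_le.trans ?_)
    simp
  · have hx1 : x ∈ Algebra.adjoin k⸨X⸩ {x} := Algebra.self_mem_adjoin_singleton _ _
    have := card_mul_le_finrank (k := k) (Algebra.adjoin k⸨X⸩ {x}) (y := unif k D) (e := 1)
      (unif_mem _) (val_unif_lt_one k D) (by rw [pow_one]) (x := fun i : Fin g.natDegree => x ^ (i : ℕ))
      (fun i => Subalgebra.pow_mem _ hx1 _)
      (fun i => by rw [map_pow]; exact pow_le_one₀ zero_le hx)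
      (by simpa only [res_pow hx] using linearIndependent_pow (K := k) (res x : Residue k D))
    simpa using this

theorem residueSubmodule_eq_top {C : Subalgebra k⸨X⸩ D} {u : Residue k D →+* (val k D).integer}
    (hu : IsSection u) (h : ∀ a, (u a : D) ∈ C) : residueSubmodule C = ⊤ :=
  eq_top_iff.2 fun a _ => ⟨u a, h a, (u a).2, res_section hu a⟩

theorem IsParameter.finrank_eq {z : D} (hz : IsParameter k z) {e : ℕ}
    (he : val k D (unif k D) = val k D z ^ e) :
    finrank k⸨X⸩ D = e * finrank k (Residue k D) := by
  have h1 := (isGenerator_top_iff.2 hz).finrank_eq he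
  have h2 : residueSubmodule (⊤ : Subalgebra k⸨X⸩ D) = ⊤ := eq_top_iff.2 fun a _ => by
    obtain ⟨x, hx, rfl⟩ := res_surjective a
    exact ⟨x, Algebra.mem_top, hx, rfl⟩
  rw [h2, finrank_top] at h1
  rw [← h1]
  exact (finrank_top k⸨X⸩ D).symm

/-- The commutative subalgebra generated by the image of the centre of the residue algebra. -/
noncomputable def adjoinCenter (u : Residue k D →+* (val k D).integer) : Subalgebra k⸨X⸩ D :=
  Algebra.adjoin k⸨X⸩ ((fun a => (u a : D)) '' (ResidueCenter k D : Set (Residue k D)))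

theorem section_mem_centralizer (u : Residue k D →+* (val k D).integer) (a : Residue k D) :
    (u a : D) ∈ Subalgebra.centralizer k⸨X⸩ (adjoinCenter u : Set D) := by
  have : adjoinCenter u ≤ Subalgebra.centralizer k⸨X⸩ {(u a : D)} := by
    refine Algebra.adjoin_le ?_
    rintro _ ⟨b, hb, rfl⟩
    refine mem_centralizer_singleton.2 ?_
    rw [← Subring.coe_mul, ← Subring.coe_mul, ← map_mul, ← map_mul,
      Subalgebra.mem_center_iff.1 hb a]
  rw [Subalgebra.mem_centralizer_iff]
  exact fun y hy => (mem_centralizer_singleton.1 (this hy)).symm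

theorem finrank_residue_le_finrank_centralizer {u : Residue k D →+* (val k D).integer}
    (hu : IsSection u) : finrank k (Residue k D) ≤
      finrank k⸨X⸩ (Subalgebra.centralizer k⸨X⸩ (adjoinCenter u : Set D)) := by
  let b := Module.finBasis k (Residue k D)
  have := card_mul_le_finrank (k := k) (Subalgebra.centralizer k⸨X⸩ (adjoinCenter u : Set D))
    (y := unif k D) (e := 1) (unif_mem _) (val_unif_lt_one k D) (by rw [pow_one])
    (x := fun i => (u (b i) : D)) (fun i => section_mem_centralizer u _)
    (fun i => (u (b i)).2) (by simpa only [res_section hu] using b.linearIndependent)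
  simpa using this

theorem finrank_residueCenter_le_finrank_adjoinCenter {u : Residue k D →+* (val k D).integer}
    (hu : IsSection u) : finrank k (ResidueCenter k D) ≤ finrank k⸨X⸩ (adjoinCenter u) := by
  let b := Module.finBasis k (ResidueCenter k D)
  have := card_mul_le_finrank (k := k) (adjoinCenter u) (y := unif k D)
    (e := 1) (unif_mem _) (val_unif_lt_one k D) (by rw [pow_one])
    (x := fun i => (u (b i : Residue k D) : D))
    (fun i => Algebra.subset_adjoin ⟨_, (b i).2, rfl⟩)
    (fun i => (u _).2) (by
      simp only [res_section hu]
      exact b.linearIndependent.map' (ResidueCenter k D).val.toLinearMap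
        (LinearMap.ker_eq_bot.2 Subtype.val_injective))
  simpa using this

/-- The algebra generated by `u(Z̄)` has dimension at least `[Z̄ : k]`, its centralizer contains
`u(D̄)` and has dimension at least `f`, and the product of the two dimensions is `e f`. -/
theorem finrank_residueCenter_le [Algebra.IsCentral k⸨X⸩ D]
    {u : Residue k D →+* (val k D).integer} (hu : IsSection u) {z : D} (hz : IsParameter k z)
    {e : ℕ} (he : val k D (unif k D) = val k D z ^ e) :
    finrank k (ResidueCenter k D) ≤ e := by
  have h1 := finrank_residue_le_finrank_centralizer hu
  have h2 := finrank_residueCenter_le_finrank_adjoinCenter hu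
  have h3 := finrank_mul_finrank_centralizer (adjoinCenter u)
  rw [hz.finrank_eq he] at h3
  have hf : 0 < finrank k (Residue k D) := finrank_pos
  by_contra hlt
  have : e * finrank k (Residue k D) < finrank k⸨X⸩ (adjoinCenter u) *
      finrank k⸨X⸩ (Subalgebra.centralizer k⸨X⸩ (adjoinCenter u : Set D)) :=
    Nat.mul_lt_mul_of_lt_of_le (lt_of_lt_of_le (not_le.1 hlt) h2) h1 (hf.trans_le h1)
  omega

/-- Let `θ` be separable of degree `a` with commutative centralizer `P` of dimension `b` in the
residue algebra, `x` a lift of `θ`, and `e'` the ramification index of the centralizer `C` of `x`.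
Residues of `C` commute with `θ`, so `[D : F] ≤ a e' b`. A commutative subalgebra of dimension at
least `e' a` gives `(e' a) ^ 2 ≤ [D : F]`, hence `e' a ≤ b` and `e f ≤ b ^ 2`. Commutativity of `P`
gives `b ^ 2 ≤ f [Z̄ : k]`. -/
theorem le_finrank_residueCenter [Algebra.IsCentral k⸨X⸩ D] {z : D} (hz : IsParameter k z)
    {e : ℕ} (he : val k D (unif k D) = val k D z ^ e) :
    e ≤ finrank k (ResidueCenter k D) := by
  obtain ⟨θ, hθ, hcomm⟩ := exists_isSeparable_centralizer_comm (F := k) (R := Residue k D)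
  obtain ⟨x₀, hx₀, rfl⟩ := res_surjective θ
  obtain ⟨x, hx, hxθ, hroot, -⟩ := exists_lift_minpoly hx₀ hθ
  rw [← hxθ] at hcomm hroot
  set L := Algebra.adjoin k⸨X⸩ {x} with hL
  set C := Subalgebra.centralizer k⸨X⸩ ({x} : Set D) with hC
  set P := Subalgebra.centralizer k ({(res x : Residue k D)} : Set (Residue k D)) with hP
  set a := (minpoly k (res x : Residue k D)).natDegree with ha
  have h1 : a * finrank k⸨X⸩ C = finrank k⸨X⸩ D := by
    have := finrank_mul_finrank_centralizer L
    rwa [finrank_adjoin_lift hx hroot, hL, centralizer_adjoin_singleton] at this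
  obtain ⟨y, hy⟩ := exists_isGenerator C
  obtain ⟨e', he'0, he'⟩ := hy.exists_val_unif_eq
  have h2 : finrank k⸨X⸩ C ≤ e' * finrank k P := by
    rw [hy.finrank_eq he']
    refine Nat.mul_le_mul_left _ (Submodule.finrank_mono (t := Subalgebra.toSubmodule P) ?_)
    rintro _ ⟨c, hc, hc1, rfl⟩
    change res c ∈ P
    rw [hP, mem_centralizer_singleton, ← res_mul hx hc1, ← res_mul hc1 hx,
      mem_centralizer_singleton.1 hc]
  -- The element `y` generating the values of `C` commutes with `x`; together they generate a
  -- commutative algebra with ramification at least `e'` and residue degree at least `a`.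
  have h3 : (e' * a) ^ 2 ≤ finrank k⸨X⸩ D := by
    have hxy : x * y = y * x := mem_centralizer_singleton.1 hy.1
    let K := Algebra.adjoin k⸨X⸩ ({x, y} : Set D)
    have hK := adjoin_commute (F := k⸨X⸩) (s := ({x, y} : Set D)) (by
      rintro a (rfl | rfl) b (rfl | rfl)
      · rfl
      · exact hxy
      · exact hxy.symm
      · rfl)
    refine le_trans ?_ (finrank_sq_le_of_commute K hK)
    gcongr
    have := card_mul_le_finrank (k := k) K (y := y) (e := e') (Algebra.subset_adjoin (by simp))
      hy.2.2.1 he' (x := fun i : Fin a => x ^ (i : ℕ))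
      (fun i => Subalgebra.pow_mem _ (Algebra.subset_adjoin (by simp)) _)
      (fun i => by rw [map_pow]; exact pow_le_one₀ zero_le hx)
      (by simpa only [res_pow hx] using linearIndependent_pow (K := k) (res x : Residue k D))
    simpa using this
  have h4 := finrank_sq_le_mul_finrank_center P (fun p hp q hq => hcomm p q
    (mem_centralizer_singleton.1 hp) (mem_centralizer_singleton.1 hq))
  have hef := hz.finrank_eq he
  set b := finrank k P
  set c := finrank k⸨X⸩ C
  set f := finrank k (Residue k D)
  have hpos : 0 < e' * a := by
    refine Nat.pos_of_ne_zero fun h0 => ?_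
    have : 0 < finrank k⸨X⸩ D := finrank_pos
    rcases Nat.mul_eq_zero.1 h0 with h | h
    · omega
    · rw [h, zero_mul] at h1; omega
  have h5 : finrank k⸨X⸩ D ≤ (e' * a) * b := by
    rw [← h1]
    calc a * c ≤ a * (e' * b) := by gcongr
      _ = _ := by ring
  have h6 : e' * a ≤ b := by
    have : (e' * a) * (e' * a) ≤ (e' * a) * b := by rw [← sq]; exact h3.trans h5
    exact Nat.le_of_mul_le_mul_left this hpos
  have h7 : e * f ≤ f * finrank k (ResidueCenter k D) := by
    rw [← hef]
    refine h5.trans (le_trans ?_ h4)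
    rw [sq]; gcongr
  have hf : 0 < f := finrank_pos
  rw [mul_comm] at h7
  exact Nat.le_of_mul_le_mul_left h7 hf

theorem finrank_residueCenter_eq [Algebra.IsCentral k⸨X⸩ D] (hD : Splittable k D) {z : D}
    (hz : IsParameter k z) {e : ℕ} (he : val k D (unif k D) = val k D z ^ e) :
    finrank k (ResidueCenter k D) = e := by
  obtain ⟨u, hu⟩ := hD
  exact le_antisymm (finrank_residueCenter_le hu hz he) (le_finrank_residueCenter hz he)

/-- The centralizer of the image of the centre is unramified. -/
theorem isGenerator_unif_centralizer [Algebra.IsCentral k⸨X⸩ D]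
    {u : Residue k D →+* (val k D).integer} (hu : IsSection u) :
    IsGenerator (Subalgebra.centralizer k⸨X⸩ (adjoinCenter u : Set D)) (unif k D) := by
  set C := Subalgebra.centralizer k⸨X⸩ (adjoinCenter u : Set D) with hC
  obtain ⟨z, hz⟩ := exists_isParameter (k := k) (D := D)
  obtain ⟨e, he0, he⟩ := (isGenerator_top_iff.2 hz).exists_val_unif_eq
  obtain ⟨y, hy⟩ := exists_isGenerator C
  obtain ⟨e', he'0, he'⟩ := hy.exists_val_unif_eq
  have h1 := finrank_residueCenter_le_finrank_adjoinCenter hu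
  have h2 := hy.finrank_eq he'
  have h3 := finrank_mul_finrank_centralizer (adjoinCenter u)
  rw [residueSubmodule_eq_top hu (section_mem_centralizer u), finrank_top] at h2
  rw [hz.finrank_eq he, ← hC, h2, ← mul_assoc] at h3
  rw [finrank_residueCenter_eq ⟨u, hu⟩ hz he] at h1
  have h4 := Nat.eq_of_mul_eq_mul_right finrank_pos h3
  -- The algebra of `u(Z̄)` has degree at least `e`, and its degree times `e'` is `e`; no
  -- ramification is left for the centralizer.
  have h5 : e' = 1 := by
    have : e * e' ≤ e * 1 := by
      rw [mul_one]
      exact (Nat.mul_le_mul_right _ h1).trans h4.le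
    have := Nat.le_of_mul_le_mul_left this he0
    omega
  rw [h5, pow_one] at he'
  exact ⟨unif_mem _, unif_ne_zero k D, val_unif_lt_one k D, fun x hx hx0 => he' ▸ hy.2.2.2 x hx hx0⟩

theorem finrank_residueCenter_eq_ramificationIndex [Algebra.IsCentral k⸨X⸩ D]
    (hD : Splittable k D) : finrank k (ResidueCenter k D) = ramificationIndex k D := by
  obtain ⟨z, hz⟩ := exists_isParameter (k := k) (D := D)
  obtain ⟨e, -, he⟩ := (isGenerator_top_iff.2 hz).exists_val_unif_eq
  rw [finrank_residueCenter_eq hD hz he, ramificationIndex_eq hz he]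

end

end SplitAlg

/-! ### Conjugation on the residue centre and the algebra in `z ^ n` -/

namespace SplitAlg

attribute [local instance] residueDivisionRing centerField centerAlgebra

/-- A primitive element of the separable closure of `k` in a finite extension. -/
theorem exists_primitive_separable (k Z : Type*) [Field k] [Field Z] [Algebra k Z]
    [FiniteDimensional k Z] : ∃ θ : Z, IsSeparable k θ ∧
      (∀ η : Z, IsSeparable k η → ∃ h : k[X], η = aeval θ h) ∧
      ∀ σ τ : Z ≃ₐ[k] Z, σ θ = τ θ → σ = τ := by
  obtain ⟨α, hα⟩ := Field.exists_primitive_element k (separableClosure k Z)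
  have hαalg : ∀ η : separableClosure k Z, ∃ h : k[X], η = aeval α h := fun η => by
    have h1 : η ∈ IntermediateField.adjoin k {α} := hα ▸ IntermediateField.mem_top
    have h2 := IntermediateField.adjoin_simple_toSubalgebra_of_isAlgebraic (F := k)
      (Algebra.IsAlgebraic.isAlgebraic α)
    have h3 : η ∈ Algebra.adjoin k {α} := by rw [← h2]; exact h1
    rw [Algebra.adjoin_singleton_eq_range_aeval] at h3
    obtain ⟨h, hh⟩ := h3
    exact ⟨h, hh.symm⟩
  have hcoe : ∀ h : k[X], ((aeval α h : separableClosure k Z) : Z) = aeval (α : Z) h := fun h =>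
    (aeval_algHom_apply (separableClosure k Z).val α h).symm
  refine ⟨α, (mem_separableClosure_iff).1 α.2, fun η hη => ?_, fun σ τ hστ => ?_⟩
  · obtain ⟨h, hh⟩ := hαalg ⟨η, mem_separableClosure_iff.2 hη⟩
    exact ⟨h, by rw [← hcoe, ← hh]⟩
  · obtain ⟨q, hq⟩ := ExpChar.exists k
    have hqZ : ExpChar Z q := expChar_of_injective_algebraMap (algebraMap k Z).injective q
    have hqE : ExpChar (separableClosure k Z) q :=
      expChar_of_injective_algebraMap (algebraMap k (separableClosure k Z)).injective q
    -- The field is purely inseparable over its separable closure: some `q`-power of `z` is a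
    -- polynomial in `α`, and Frobenius is injective.
    ext z
    obtain ⟨n, w, hw⟩ := (isPurelyInseparable_iff_pow_mem (separableClosure k Z) q).1
      (separableClosure.isPurelyInseparable k Z) z
    obtain ⟨h, rfl⟩ := hαalg w
    have hw' : aeval (α : Z) h = z ^ q ^ n := by rw [← hcoe]; exact hw
    refine iterateFrobenius_inj Z q n ?_
    rw [iterateFrobenius_def, iterateFrobenius_def, ← map_pow, ← map_pow, ← hw',
      ← aeval_algHom_apply σ, ← aeval_algHom_apply τ, hστ]

/-- Automorphisms are determined by the image of `θ`, which is a root of its minimal polynomial. -/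
theorem card_gal_le_natDegree {k Z : Type*} [Field k] [Field Z] [Algebra k Z]
    [FiniteDimensional k Z] {θ : Z} (h : ∀ σ τ : Z ≃ₐ[k] Z, σ θ = τ θ → σ = τ) :
    Nat.card (Z ≃ₐ[k] Z) ≤ (minpoly k θ).natDegree := by
  classical
  have hint : IsIntegral k θ := Algebra.IsIntegral.isIntegral θ
  let f : (Z ≃ₐ[k] Z) → ((minpoly k θ).aroots Z).toFinset := fun σ => ⟨σ θ, by
    rw [Multiset.mem_toFinset, mem_aroots]
    exact ⟨minpoly.ne_zero hint, by rw [aeval_algHom_apply σ, minpoly.aeval, map_zero]⟩⟩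
  have hf : Function.Injective f := fun σ τ hστ => h σ τ (congrArg Subtype.val hστ)
  refine (Nat.card_le_card_of_injective f hf).trans ?_
  rw [Nat.card_eq_fintype_card, Fintype.card_coe]
  exact (Multiset.toFinset_card_le _).trans ((card_roots' _).trans natDegree_map_le)

section

variable {k : Type*} [Field k] {D : Type*} [DivisionRing D] [Algebra k⸨X⸩ D]
  [FiniteDimensional k⸨X⸩ D]

theorem val_conj {y : D} (hy : y ≠ 0) (x : D) : val k D (y * x * y⁻¹) = val k D x := by
  rw [map_mul, map_mul, map_inv₀, mul_comm, inv_mul_cancel_left₀ ((Valuation.ne_zero_iff _).2 hy)]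

/-- The map induced on the residue algebra by conjugation. -/
noncomputable def conjFun (y : D) (a : Residue k D) : Residue k D :=
  res (y * (res_surjective a).choose * y⁻¹)

theorem conjFun_res {y : D} (hy : y ≠ 0) {x : D} (hx : val k D x ≤ 1) :
    conjFun y (res x : Residue k D) = res (y * x * y⁻¹) := by
  obtain ⟨h1, h2⟩ := (res_surjective (res x : Residue k D)).choose_spec
  rw [conjFun, res_eq_res_iff (by rwa [val_conj hy]) (by rwa [val_conj hy]), ← sub_mul, ← mul_sub,
    val_conj hy, ← res_eq_res_iff h1 hx, h2]

/-- The automorphism of the residue algebra induced by conjugation. -/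
noncomputable def conjRes (y : Dˣ) : Residue k D ≃ₐ[k] Residue k D where
  toFun := conjFun y
  invFun := conjFun (y⁻¹ : Dˣ)
  left_inv a := by
    obtain ⟨x, hx, rfl⟩ := res_surjective a
    rw [conjFun_res y.ne_zero hx, conjFun_res (y⁻¹).ne_zero (by rwa [val_conj y.ne_zero])]
    simp [mul_assoc]
  right_inv a := by
    obtain ⟨x, hx, rfl⟩ := res_surjective a
    rw [conjFun_res (y⁻¹).ne_zero hx, conjFun_res y.ne_zero (by rwa [val_conj (y⁻¹).ne_zero])]
    simp [mul_assoc]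
  map_mul' a b := by
    obtain ⟨x, hx, rfl⟩ := res_surjective a
    obtain ⟨x', hx', rfl⟩ := res_surjective b
    rw [← res_mul hx hx', conjFun_res y.ne_zero (by rw [map_mul]; exact mul_le_one' hx hx'),
      conjFun_res y.ne_zero hx, conjFun_res y.ne_zero hx',
      ← res_mul (by rwa [val_conj y.ne_zero]) (by rwa [val_conj y.ne_zero])]
    simp [mul_assoc]
  map_add' a b := by
    obtain ⟨x, hx, rfl⟩ := res_surjective a
    obtain ⟨x', hx', rfl⟩ := res_surjective b
    rw [← res_add hx hx', conjFun_res y.ne_zero (Valuation.map_add_le _ hx hx'),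
      conjFun_res y.ne_zero hx, conjFun_res y.ne_zero hx',
      ← res_add (by rwa [val_conj y.ne_zero]) (by rwa [val_conj y.ne_zero]), mul_add, add_mul]
  commutes' c := by
    rw [← res_constHom, conjFun_res y.ne_zero (constHom k D c).2, coe_constHom,
      ← Algebra.commutes, mul_inv_cancel_right₀ y.ne_zero]

theorem conjRes_res (y : Dˣ) {x : D} (hx : val k D x ≤ 1) :
    conjRes y (res x : Residue k D) = res ((y : D) * x * (y : D)⁻¹) := conjFun_res y.ne_zero hx

theorem conjRes_mul (y y' : Dˣ) (a : Residue k D) :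
    conjRes (y * y') a = conjRes y (conjRes y' a) := by
  obtain ⟨x, hx, rfl⟩ := res_surjective a
  rw [conjRes_res _ hx, conjRes_res _ hx, conjRes_res _ (by rwa [val_conj y'.ne_zero])]
  simp [mul_assoc]

theorem conjRes_one (a : Residue k D) : conjRes 1 a = a := by
  obtain ⟨x, hx, rfl⟩ := res_surjective a
  rw [conjRes_res _ hx]
  simp

theorem conjRes_mem_center (y : Dˣ) {a : Residue k D} (ha : a ∈ ResidueCenter k D) :
    conjRes y a ∈ ResidueCenter k D := by
  rw [Subalgebra.mem_center_iff] at ha ⊢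
  intro b
  obtain ⟨b, rfl⟩ := (conjRes y).surjective b
  rw [← map_mul, ha, map_mul]

/-- The automorphism of the centre of the residue algebra induced by conjugation. -/
noncomputable def centerConj : Dˣ →* (ResidueCenter k D ≃ₐ[k] ResidueCenter k D) where
  toFun y :=
    { toFun := fun a => ⟨conjRes y a, conjRes_mem_center y a.2⟩
      invFun := fun a => ⟨conjRes y⁻¹ a, conjRes_mem_center y⁻¹ a.2⟩
      left_inv := fun a => Subtype.ext (by
        change conjRes y⁻¹ (conjRes y (a : Residue k D)) = a
        rw [← conjRes_mul, inv_mul_cancel, conjRes_one])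
      right_inv := fun a => Subtype.ext (by
        change conjRes y (conjRes y⁻¹ (a : Residue k D)) = a
        rw [← conjRes_mul, mul_inv_cancel, conjRes_one])
      map_mul' := fun a b => Subtype.ext (map_mul (conjRes y) (a : Residue k D) (b : Residue k D))
      map_add' := fun a b => Subtype.ext (map_add (conjRes y) (a : Residue k D) (b : Residue k D))
      commutes' := fun c => Subtype.ext ((conjRes y).commutes c) }
  map_one' := AlgEquiv.ext fun a => Subtype.ext (conjRes_one (a : Residue k D))
  map_mul' y y' := AlgEquiv.ext fun a => Subtype.ext (conjRes_mul y y' (a : Residue k D))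

theorem coe_centerConj (y : Dˣ) (a : ResidueCenter k D) :
    (centerConj y a : Residue k D) = conjRes y a := rfl

/-- The expansion of an element of a subalgebra with respect to a generator of its values. -/
theorem IsGenerator.val_sub_sum_coeff_le {C : Subalgebra k⸨X⸩ D} {y : D} (hy : IsGenerator C y)
    {u : Residue k D →+* (val k D).integer} (hu : IsSection u) (huC : ∀ a, (u a : D) ∈ C)
    {x : D} (hx : x ∈ C) (hx1 : val k D x ≤ 1) (n : ℕ) :
    val k D (x - ∑ j ∈ Finset.range n, (u (coeff u y x j) : D) * y ^ j) ≤ val k D y ^ n := by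
  have hr : ∀ n, remainder u y x n ∈ C ∧ val k D (remainder u y x n) ≤ 1 := by
    intro n
    induction n with
    | zero => exact ⟨hx, hx1⟩
    | succ n ih =>
      have h1 := C.sub_mem ih.1 (huC (res (remainder u y x n)))
      have h2 := hy.val_le (m := 0) h1 (by simpa using val_sub_res_lt hu ih.2)
      refine ⟨C.mul_mem h1 (inv_mem_of_finiteDimensional C hy.1), ?_⟩
      rw [remainder, map_mul, map_inv₀]
      exact mul_inv_le_one_of_le₀ (by simpa using h2) zero_le
  have hsum : x - ∑ j ∈ Finset.range n, (u (coeff u y x j) : D) * y ^ j =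
      remainder u y x n * y ^ n := by
    induction n with
    | zero => simp [remainder]
    | succ n ih =>
      rw [Finset.sum_range_succ, ← sub_sub, ih, ← sub_mul, remainder, pow_succ', ← mul_assoc,
        inv_mul_cancel_right₀ hy.2.1, coeff]
  rw [hsum, map_mul, map_pow]
  exact mul_le_of_le_one_left zero_le (hr n).2

/-- A closed subalgebra containing the image of `u` and a generator `y` of its values. -/
theorem laurentSet_eq {C : Subalgebra k⸨X⸩ D} {y : D} (hy : IsGenerator C y)
    {u : Residue k D →+* (val k D).integer} (hu : IsSection u) (huC : ∀ a, (u a : D) ∈ C)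
    (hcl : ∀ x, (∀ n : ℕ, ∃ c ∈ C, val k D (x - c) ≤ val k D y ^ n) → x ∈ C) :
    (C : Set D) = laurentSet u y := by
  obtain ⟨hyC, hy0, hy1, hy2⟩ := id hy
  ext x
  constructor
  · intro hx
    rcases eq_or_ne x 0 with rfl | hx0
    · exact ⟨0, fun _ => 0, fun n => by simp⟩
    obtain ⟨N, hN⟩ := hy2 x hx hx0
    have hyN : y ^ N ≠ 0 := zpow_ne_zero _ hy0
    set x' := x * (y ^ N)⁻¹ with hx'
    have hx'C : x' ∈ C := C.mul_mem hx (inv_mem_of_finiteDimensional C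
      (zpow_mem_of_finiteDimensional C hyC N))
    have hx'1 : val k D x' ≤ 1 := by
      rw [hx', map_mul, map_inv₀, map_zpow₀, ← hN,
        mul_inv_cancel₀ ((Valuation.ne_zero_iff _).2 hx0)]
    refine ⟨N, coeff u y x', fun n => ?_⟩
    have h3 : x - ∑ j ∈ Finset.range n, (u (coeff u y x' j) : D) * y ^ (N + j) =
        (x' - ∑ j ∈ Finset.range n, (u (coeff u y x' j) : D) * y ^ j) * y ^ N := by
      have h4 : ∀ j : ℕ, y ^ (N + j) = y ^ j * y ^ N := fun j => by
        rw [add_comm, zpow_add₀ hy0, zpow_natCast]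
      simp only [h4, ← mul_assoc, ← Finset.sum_mul, sub_mul]
      rw [hx', inv_mul_cancel_right₀ hyN]
    rw [h3, map_mul, map_zpow₀, add_comm, zpow_add₀ ((Valuation.ne_zero_iff _).2 hy0), zpow_natCast]
    exact mul_le_mul_left (hy.val_sub_sum_coeff_le hu huC hx'C hx'1 n) _
  · rintro ⟨N, c, hc⟩
    refine hcl x fun n => ⟨_, C.sum_mem fun j _ => C.mul_mem (huC (c j))
      (zpow_mem_of_finiteDimensional C hyC _), (hc (n + N.natAbs)).trans ?_⟩
    rw [← zpow_natCast, zpow_val_le_iff hy0 hy1]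
    push_cast
    have := neg_abs_le N
    omega

/-- Such an `x` commutes with all partial sums `∑ u (c j) * z ^ j`, hence with their limits, the
integral elements; powers of `X` clear denominators, so `x` is central. -/
theorem mem_bot_of_commute [Algebra.IsCentral k⸨X⸩ D] {z : D} (hz : IsParameter k z)
    {u : Residue k D →+* (val k D).integer} (hu : IsSection u) {x : D}
    (hxu : ∀ a, (u a : D) * x = x * u a) (hxz : z * x = x * z) :
    x ∈ (⊥ : Subalgebra k⸨X⸩ D) := by
  have h1 : ∀ d, val k D d ≤ 1 → d * x = x * d := fun d hd =>
    commute_of_forall_approx hz fun n => ⟨_, by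
      refine (Commute.sum_left (Finset.range n) (fun j => (u (coeff u z d j) : D) * z ^ j) x
        fun j _ => ?_).eq
      exact Commute.mul_left (hxu _) (Commute.pow_left hxz j), val_sub_sum_coeff_le hu hz hd n⟩
  refine Algebra.IsCentral.out (Subalgebra.mem_center_iff.2 fun d => ?_)
  obtain ⟨n, hn⟩ := exists_unif_pow_mul_integral (k := k) d
  have h2 := h1 _ hn
  have h3 : x * unif k D ^ n = unif k D ^ n * x :=
    ((show Commute (unif k D) x from unif_mul_comm k D x).pow_left n).eq.symm
  rw [← mul_assoc, h3, mul_assoc, mul_assoc] at h2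
  exact mul_left_cancel₀ (pow_ne_zero _ (unif_ne_zero k D)) h2

theorem mul_inv_eq_of_intertwine {a b v : D} (hv : v ≠ 0) (h : b * v = v * a) :
    v * a * v⁻¹ = b := by
  rw [← h, mul_inv_cancel_right₀ hv]

/-- An element whose conjugation fixes the residue of a root `x` of a separable polynomial is, up
to a unit of the valuation ring, in the centralizer of `x`. -/
theorem exists_unit_mul_mem_centralizer {x : D} (hx : val k D x ≤ 1) {g : k[X]}
    (hg : evalConst x g = 0) (hg' : aeval (res x : Residue k D) (derivative g) ≠ 0) {y : D}
    (hy : y ≠ 0) (hfix : (res (y * x * y⁻¹) : Residue k D) = res x) :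
    ∃ v, val k D v = 1 ∧ v * y ∈ Subalgebra.centralizer k⸨X⸩ ({x} : Set D) := by
  have hx1 : val k D (y * x * y⁻¹) ≤ 1 := by rwa [val_conj hy]
  obtain ⟨v, h1, h2, -⟩ := exists_intertwine hx1 hx hfix
    (by rw [conj_evalConst hy, hg]; simp) hg (by rwa [hfix])
  refine ⟨v, h1, ?_⟩
  rw [mem_centralizer_singleton, ← mul_assoc, h2]
  simp only [mul_assoc, inv_mul_cancel₀ hy, mul_one]

/-- If `u` is a section of the residue map, some `u(D̄)((z ^ n))`, with `n` the order of the
automorphism group of the centre of the residue algebra, is a subalgebra whose centre is cyclic of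
degree `n`. -/
theorem exists_laurentSet_cyclic_of_gal {F : Type*} {D : Type*} [Field F] [DivisionRing D]
    [Algebra F⸨X⸩ D] [FiniteDimensional F⸨X⸩ D] [Algebra.IsCentral F⸨X⸩ D]
    {u : Residue F D →+* (val F D).integer} (hu : IsSection u) :
    ∃ z, IsParameter F z ∧ ∃ A : Subalgebra F⸨X⸩ D,
      (A : Set D) = laurentSet u (z ^ Nat.card (ResidueCenter F D ≃ₐ[F] ResidueCenter F D)) ∧
      HasCyclicGaloisCenter F⸨X⸩ A (Nat.card (ResidueCenter F D ≃ₐ[F] ResidueCenter F D)) := by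
  set n := Nat.card (ResidueCenter F D ≃ₐ[F] ResidueCenter F D) with hn
  obtain ⟨θ, hθ, hθsep, hθinj⟩ := exists_primitive_separable F (ResidueCenter F D)
  have hmin : minpoly F (θ : Residue F D) = minpoly F θ :=
    minpoly.algHom_eq (ResidueCenter F D).val Subtype.val_injective θ
  have hθ' : IsSeparable F (θ : Residue F D) := by rw [IsSeparable, hmin]; exact hθ
  have hcard : n ≤ (minpoly F (θ : Residue F D)).natDegree := by
    rw [hmin]; exact card_gal_le_natDegree hθinj
  -- The section need not fix the constants, so `u θ` need not be a root of `g`. The corrected lift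
  -- `x` still commutes with `u(D̄)`, because `u θ` does.
  obtain ⟨x, hx, hxθ, hroot, hxcomm⟩ := exists_lift_minpoly (x₀ := (u θ : D)) (u θ).2
    (by rwa [res_section hu])
  rw [res_section hu] at hxθ hroot
  have hder := aeval_derivative_minpoly_ne_zero hθ'
  set g := minpoly F (θ : Residue F D) with hg
  have huA : ∀ a, (u a : D) ∈ Subalgebra.centralizer F⸨X⸩ ({x} : Set D) := fun a => by
    rw [mem_centralizer_singleton]
    refine hxcomm _ ?_
    rw [← Subring.coe_mul, ← Subring.coe_mul, ← map_mul, ← map_mul,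
      Subalgebra.mem_center_iff.1 θ.2 a]
  set A := Subalgebra.centralizer F⸨X⸩ ({x} : Set D) with hA
  set L := Algebra.adjoin F⸨X⸩ ({x} : Set D) with hL
  have hxL : x ∈ L := Algebra.self_mem_adjoin_singleton _ _
  have hLdim : finrank F⸨X⸩ L = g.natDegree := by
    have := finrank_adjoin_lift hx (by rw [hxθ]; exact hroot)
    rwa [hxθ] at this
  have hLcomm := adjoin_commute (F := F⸨X⸩) (s := ({x} : Set D)) (by rintro a rfl b rfl; rfl)
  have hAdim : g.natDegree * finrank F⸨X⸩ A = finrank F⸨X⸩ D := by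
    have := finrank_mul_finrank_centralizer L
    rwa [hLdim, hL, centralizer_adjoin_singleton] at this
  obtain ⟨z₀, hz₀⟩ := exists_isParameter (k := F) (D := D)
  obtain ⟨e, he0, he⟩ := (isGenerator_top_iff.2 hz₀).exists_val_unif_eq
  obtain ⟨y, hy⟩ := exists_isGenerator A
  obtain ⟨e', he'0, he'⟩ := hy.exists_val_unif_eq
  -- The centralizer `A` contains `u(D̄)`, so its residue degree is that of `D`; all of the index
  -- `deg g` is ramification.
  have hee : e = g.natDegree * e' := by
    have h1 := hz₀.finrank_eq he
    have h2 := hy.finrank_eq he'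
    rw [residueSubmodule_eq_top hu huA, finrank_top] at h2
    rw [← hAdim, h2, ← mul_assoc] at h1
    exact (Nat.eq_of_mul_eq_mul_right finrank_pos h1).symm
  have hyval : val F D y = val F D z₀ ^ g.natDegree := by
    obtain ⟨m, hm⟩ := hz₀.2.2 y hy.2.1
    rw [he', hm, ← zpow_natCast, ← zpow_natCast, ← zpow_mul] at he
    have h3 := zpow_val_injective hz₀.1 hz₀.2.1 he
    rw [hee] at h3
    push_cast at h3
    have h4 : m = g.natDegree := mul_right_cancel₀ (by exact_mod_cast he'0.ne') h3
    rw [hm, h4, zpow_natCast]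
  have hAval : ∀ w ∈ A, w ≠ 0 → ∃ j : ℤ, val F D w = val F D z₀ ^ (g.natDegree * j) := by
    intro w hw hw0
    obtain ⟨j, hj⟩ := hy.2.2.2 w hw hw0
    exact ⟨j, by rw [hj, hyval, zpow_mul, zpow_natCast]⟩
  -- the order of the action of a parameter on the centre
  have hord : orderOf (centerConj (k := F) (Units.mk0 z₀ hz₀.1)) = g.natDegree ∧ n = g.natDegree := by
    set σ := centerConj (k := F) (Units.mk0 z₀ hz₀.1) with hσ
    have h1 : 0 < orderOf σ := orderOf_pos σ
    have h2 : orderOf σ ≤ n := by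
      rw [hn]; exact Nat.le_of_dvd Nat.card_pos (orderOf_dvd_natCard σ)
    -- If a power of `z₀` fixes `θ`, a unit multiple of it commutes with `x`, so its value is a
    -- multiple of that of `z₀ ^ deg g`. With `orderOf σ ≤ n ≤ deg g` all three numbers agree.
    have h3 : g.natDegree ∣ orderOf σ := by
      have h4 : centerConj (k := F) ((Units.mk0 z₀ hz₀.1) ^ orderOf σ) θ = θ := by
        rw [map_pow, ← hσ, pow_orderOf_eq_one]; rfl
      have h5 := congrArg (Subtype.val) h4
      rw [coe_centerConj, ← hxθ, conjRes_res _ hx] at h5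
      obtain ⟨v, hv, hvA⟩ := exists_unit_mul_mem_centralizer hx hroot (by rwa [hxθ])
        (Units.ne_zero _) h5
      obtain ⟨j, hj⟩ := hAval _ hvA (mul_ne_zero (ne_zero_of_val_eq_one hv) (Units.ne_zero _))
      rw [map_mul, hv, one_mul, Units.val_pow_eq_pow_val, map_pow, Units.val_mk0,
        ← zpow_natCast] at hj
      have := zpow_val_injective hz₀.1 hz₀.2.1 hj
      exact Int.natCast_dvd_natCast.1 ⟨j, this⟩
    have h6 := Nat.le_of_dvd h1 h3
    omega
  -- adjust the parameter
  obtain ⟨h, hh⟩ := hθsep (centerConj (k := F) (Units.mk0 z₀ hz₀.1) θ) (by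
    rw [IsSeparable, minpoly.algEquiv_eq]; exact hθ)
  have hh' : conjRes (Units.mk0 z₀ hz₀.1) (θ : Residue F D) = aeval (θ : Residue F D) h := by
    rw [← coe_centerConj, hh]
    exact (aeval_algHom_apply (ResidueCenter F D).val θ h).symm
  have hconjx : (res (z₀ * x * z₀⁻¹) : Residue F D) = aeval (θ : Residue F D) h := by
    rw [← hh', ← hxθ, conjRes_res _ hx]; rfl
  have hroot2 : evalConst (evalConst x h) g = 0 := by
    have h1 : g ∣ g.comp h := minpoly.dvd _ _ (by
      rw [aeval_comp, ← hh', aeval_algHom_apply (conjRes (Units.mk0 z₀ hz₀.1)), minpoly.aeval,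
        map_zero])
    obtain ⟨q, hq⟩ := h1
    rw [← evalConst_comp, hq, evalConst_mul, hroot, zero_mul]
  -- Both `z₀ * x * z₀⁻¹` and `h(x)` are roots of `g` with residue `σ θ`. The unit intertwining them
  -- makes `z = v * z₀` conjugate `x` to `h(x)`, inside `L`.
  obtain ⟨v, hv1, hv2, -⟩ := exists_intertwine (x₁ := z₀ * x * z₀⁻¹) (x₂ := evalConst x h)
    (by rwa [val_conj hz₀.1]) (val_evalConst_le hx h) (by rw [hconjx, res_evalConst hx, hxθ])
    (g := g) (by rw [conj_evalConst hz₀.1, hroot]; simp) hroot2 (by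
      rw [hconjx, ← hh', aeval_algHom_apply (conjRes (Units.mk0 z₀ hz₀.1))]
      exact (map_ne_zero_iff _ (conjRes _).injective).2 hder)
  set z := v * z₀ with hzdef
  have hz0 : z ≠ 0 := mul_ne_zero (ne_zero_of_val_eq_one hv1) hz₀.1
  have hzval : val F D z = val F D z₀ := by rw [hzdef, map_mul, hv1, one_mul]
  have hz : IsParameter F z := ⟨hz0, hzval ▸ hz₀.2.1, fun w hw => hzval ▸ hz₀.2.2 w hw⟩
  have hzx : z * x * z⁻¹ = evalConst x h := by
    rw [← mul_inv_eq_of_intertwine (ne_zero_of_val_eq_one hv1) hv2, hzdef, mul_inv_rev]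
    simp only [mul_assoc]
  have hzL : ∀ a ∈ L, z * a * z⁻¹ ∈ L := by
    have : L ≤ L.comap (conjAlgHom F⸨X⸩ hz0) := by
      refine Algebra.adjoin_le (Set.singleton_subset_iff.2 ?_)
      change conjAlgHom F⸨X⸩ hz0 x ∈ L
      rw [conjAlgHom_apply, hzx]
      exact evalConst_mem hxL h
    intro a ha
    have := this ha
    rwa [Subalgebra.mem_comap, conjAlgHom_apply] at this
  have hzA : ∀ a ∈ A, z * a * z⁻¹ ∈ A := by
    intro a ha
    obtain ⟨b, hb, hbx⟩ := exists_conj_eq_of_conj_mem hz0 (Subalgebra.toSubmodule L) hzL hxL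
    have hba : b * a = a * b := by
      rw [hA, ← centralizer_adjoin_singleton, Subalgebra.mem_centralizer_iff] at ha
      exact ha b hb
    rw [hA, mem_centralizer_singleton, ← hbx, ← conjAlgHom_apply F⸨X⸩ hz0,
      ← conjAlgHom_apply F⸨X⸩ hz0, ← map_mul, ← map_mul, hba]
  -- Conjugating `x` by `z ^ n` gives a root of `g` in the commutative algebra `L` with the same
  -- residue as `x`, hence `x` itself.
  have hzn : z ^ n ∈ A := by
    have hzn0 : z ^ n ≠ 0 := pow_ne_zero _ hz0
    have h1 : ∀ m : ℕ, z ^ m * x * (z ^ m)⁻¹ ∈ L := by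
      intro m
      induction m with
      | zero => simpa using hxL
      | succ m ih =>
        have := hzL _ ih
        rw [pow_succ', mul_inv_rev]
        simpa only [mul_assoc] using this
    have h2 : (res (z ^ n * x * (z ^ n)⁻¹) : Residue F D) = res x := by
      have h4 : centerConj (k := F) ((Units.mk0 z hz0) ^ n) θ = θ := by
        rw [map_pow, hn, pow_card_eq_one']; rfl
      have h5 := congrArg (Subtype.val) h4
      rwa [coe_centerConj, ← hxθ, conjRes_res _ hx, Units.val_pow_eq_pow_val, Units.val_mk0] at h5
    have h3 := eq_of_commute_of_res_eq (by rwa [val_conj hzn0]) hx h2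
      (by rw [conj_evalConst hzn0, hroot]; simp) hroot (by rwa [h2, hxθ])
      (hLcomm _ (h1 n) _ hxL)
    rw [hA, mem_centralizer_singleton]
    conv_lhs => rw [← h3]
    rw [inv_mul_cancel_right₀ hzn0]
  have hgen : IsGenerator A (z ^ n) := by
    refine ⟨hzn, pow_ne_zero _ hz0, ?_, fun w hw hw0 => ?_⟩
    · rw [map_pow]
      exact pow_lt_one₀ zero_le hz.2.1 Nat.card_pos.ne'
    · obtain ⟨j, hj⟩ := hAval w hw hw0
      exact ⟨j, by rw [hj, map_pow, hzval, hord.2, zpow_mul, zpow_natCast]⟩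
  refine ⟨z, hz, A, laurentSet_eq hgen hu huA fun w hw => ?_,
    hasCyclicGaloisCenter_of_conj A hz0 hzA (fun c hc => ?_) (fun w hw hwz => ?_) ?_⟩
  · rw [hA, mem_centralizer_singleton]
    refine (commute_of_forall_approx hz fun m => ?_).symm
    obtain ⟨c, hc, hcw⟩ := hw m
    refine ⟨c, (mem_centralizer_singleton.1 hc).symm, hcw.trans ?_⟩
    rw [map_pow, ← pow_mul]
    exact pow_le_pow_right_of_le_one' hz.2.1.le (Nat.le_mul_of_pos_left m Nat.card_pos)
  · rw [hA, mem_centralizer_singleton]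
    rw [Subalgebra.mem_centralizer_iff] at hc
    exact hc x (mem_centralizer_singleton.2 rfl)
  · exact mem_bot_of_commute hz hu (fun a => hw _ (huA a)) hwz
  · have h1 := finrank_mul_finrank_centralizer A
    rw [← hAdim, mul_comm] at h1
    rw [hord.2]
    exact Nat.eq_of_mul_eq_mul_right finrank_pos h1

end

end SplitAlg

namespace SplitAlg

attribute [local instance] residueDivisionRing centerField centerAlgebra

/-! ### Uniqueness of expansions and the maps `delta` -/

section Expansions

variable {k : Type*} [Field k] {D : Type*} [DivisionRing D] [Algebra k⸨X⸩ D]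
  [FiniteDimensional k⸨X⸩ D] {u : Residue k D →+* (val k D).integer}

/-- Uniqueness of expansions, up to a given order. -/
theorem eq_zero_of_val_sum_le (hu : IsSection u) {z : D} (hz0 : z ≠ 0) (hz1 : val k D z < 1)
    {d : ℕ → Residue k D} {m : ℕ}
    (h : val k D (∑ j ∈ Finset.range m, (u (d j) : D) * z ^ j) ≤ val k D z ^ m) :
    ∀ j < m, d j = 0 := by
  classical
  by_contra hne
  push Not at hne
  have hzv : 0 < val k D z := zero_lt_iff.2 ((Valuation.ne_zero_iff _).2 hz0)
  obtain ⟨hj, hdj⟩ := Nat.find_spec hne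
  set j := Nat.find hne with hjdef
  have hmin : ∀ i < j, d i = 0 := fun i hi => by
    by_contra h0
    exact Nat.find_min hne hi ⟨hi.trans hj, h0⟩
  have h1 : val k D ((u (d j) : D) * z ^ j) = val k D z ^ j := by
    rw [map_mul, val_section hu hdj, one_mul, map_pow]
  have h2 := Valuation.map_sum_eq_of_lt (val k D) (Finset.mem_range.2 hj)
    (f := fun j => (u (d j) : D) * z ^ j) (fun i hi => by
      simp only [Finset.mem_sdiff, Finset.mem_singleton] at hi
      change val k D ((u (d i) : D) * z ^ i) < val k D ((u (d j) : D) * z ^ j)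
      rw [h1]
      rcases lt_or_gt_of_ne hi.2 with h | h
      · rw [hmin i h]; simpa using pow_pos hzv j
      · rw [map_mul, map_pow]
        refine (mul_le_of_le_one_left zero_le (u (d i)).2).trans_lt ?_
        exact pow_lt_pow_right_of_lt_one₀ hzv hz1 h)
  rw [h2, h1] at h
  exact absurd (pow_lt_pow_right_of_lt_one₀ hzv hz1 hj) h.not_gt

theorem eq_of_val_sub_sum_le (hu : IsSection u) {z : D} (hz0 : z ≠ 0) (hz1 : val k D z < 1)
    {c d : ℕ → Residue k D} {m : ℕ} {x : D}
    (hc : val k D (x - ∑ j ∈ Finset.range m, (u (c j) : D) * z ^ j) ≤ val k D z ^ m)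
    (hd : val k D (x - ∑ j ∈ Finset.range m, (u (d j) : D) * z ^ j) ≤ val k D z ^ m) :
    ∀ j < m, c j = d j := by
  intro j hj
  rw [← sub_eq_zero]
  refine eq_zero_of_val_sum_le hu hz0 hz1 (d := fun j => c j - d j) ?_ j hj
  have h1 : ∑ j ∈ Finset.range m, (u (c j - d j) : D) * z ^ j =
      (x - ∑ j ∈ Finset.range m, (u (d j) : D) * z ^ j) -
        (x - ∑ j ∈ Finset.range m, (u (c j) : D) * z ^ j) := by
    simp only [map_sub, AddSubgroupClass.coe_sub, sub_mul, Finset.sum_sub_distrib]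
    abel
  rw [h1]
  exact Valuation.map_sub_le (v := val k D) hd hc

theorem val_zpow_mul_mul_zpow {z : D} (hz : z ≠ 0) (l : ℤ) (x : D) :
    val k D (z ^ l * x * z ^ (-l)) = val k D x := by
  rw [zpow_neg, val_conj (zpow_ne_zero l hz)]

theorem val_sub_sum_delta_le (hu : IsSection u) {z : D} (hz : IsParameter k z) (l : ℤ)
    (a : Residue k D) (n : ℕ) :
    val k D (z ^ l * (u a : D) * z ^ (-l) -
      ∑ j ∈ Finset.range n, (u (delta u z l j a) : D) * z ^ j) ≤ val k D z ^ n :=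
  val_sub_sum_coeff_le hu hz (by rw [val_zpow_mul_mul_zpow hz.1]; exact (u a).2) n

theorem delta_eq_of_val_le (hu : IsSection u) {z : D} (hz : IsParameter k z) {l : ℤ}
    {a : Residue k D} {c : ℕ → Residue k D} {m : ℕ}
    (h : val k D (z ^ l * (u a : D) * z ^ (-l) - ∑ j ∈ Finset.range m, (u (c j) : D) * z ^ j) ≤
      val k D z ^ m) {j : ℕ} (hj : j < m) : delta u z l j a = c j :=
  eq_of_val_sub_sum_le hu hz.1 hz.2.1 (val_sub_sum_delta_le hu hz l a m) h j hj

theorem delta_add (hu : IsSection u) {z : D} (hz : IsParameter k z) (l : ℤ) (j : ℕ)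
    (a b : Residue k D) : delta u z l j (a + b) = delta u z l j a + delta u z l j b := by
  refine delta_eq_of_val_le hu hz (c := fun j => delta u z l j a + delta u z l j b)
    (m := j + 1) ?_ (Nat.lt_succ_self j)
  have h := Valuation.map_add_le _ (val_sub_sum_delta_le hu hz l a (j + 1))
    (val_sub_sum_delta_le hu hz l b (j + 1))
  have h1 : ∀ x y s t : D, x - s + (y - t) = (x + y) - (s + t) := fun x y s t => by abel
  rw [h1, ← add_mul, ← mul_add, ← Finset.sum_add_distrib] at h
  simpa only [map_add, Subring.coe_add, add_mul] using h

theorem delta_zero (hu : IsSection u) {z : D} (hz : IsParameter k z) (l : ℤ) (j : ℕ) :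
    delta u z l j 0 = 0 := by
  have := delta_add hu hz l j 0 0
  rwa [add_zero, left_eq_add] at this

theorem delta_sum (hu : IsSection u) {z : D} (hz : IsParameter k z) (l : ℤ) (j : ℕ) {ι : Type*}
    (s : Finset ι) (f : ι → Residue k D) :
    delta u z l j (∑ i ∈ s, f i) = ∑ i ∈ s, delta u z l j (f i) :=
  map_sum (AddMonoidHom.mk' (delta u z l j) (delta_add hu hz l j)) f s

/-- The maps `delta` are linear over elements that `u` almost sends into the centre. -/
theorem delta_mul_of_val_le (hu : IsSection u) {z : D} (hz : IsParameter k z) (l : ℤ) {j m : ℕ}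
    (hj : j < m) {c : Residue k D} {f : k⸨X⸩}
    (hc : val k D ((u c : D) - algebraMap k⸨X⸩ D f) ≤ val k D z ^ m) (a : Residue k D) :
    delta u z l j (c * a) = c * delta u z l j a := by
  refine delta_eq_of_val_le hu hz (c := fun j => c * delta u z l j a) ?_ hj
  have h1 := val_sub_sum_delta_le hu hz l a m
  set S := ∑ j ∈ Finset.range m, (u (delta u z l j a) : D) * z ^ j with hS
  have h2 : ∑ j ∈ Finset.range m, (u (c * delta u z l j a) : D) * z ^ j = u c * S := by
    rw [hS, Finset.mul_sum]
    simp only [map_mul, Subring.coe_mul, mul_assoc]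
  set κ := algebraMap k⸨X⸩ D f with hκ
  have hκz : z ^ l * κ = κ * z ^ l := (Algebra.commutes f _).symm
  -- Replacing `u c` by the central `κ` under the conjugation, and back outside it, costs errors of
  -- order `m` only.
  have h3 : z ^ l * (u (c * a) : D) * z ^ (-l) - u c * S =
      (z ^ l * ((u c - κ) * u a) * z ^ (-l) - (u c - κ) * (z ^ l * (u a : D) * z ^ (-l))) +
        u c * (z ^ l * (u a : D) * z ^ (-l) - S) := by
    rw [map_mul, Subring.coe_mul]
    have h4 : z ^ l * (κ * (u a : D)) * z ^ (-l) = κ * (z ^ l * (u a : D) * z ^ (-l)) := by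
      rw [← mul_assoc, hκz]; simp only [mul_assoc]
    rw [sub_mul (u c : D), mul_sub (z ^ l), sub_mul _ _ (z ^ (-l)), h4]
    noncomm_ring
  rw [h2, h3]
  refine Valuation.map_add_le _ (Valuation.map_sub_le (v := val k D) ?_ ?_) ?_
  · rw [val_zpow_mul_mul_zpow hz.1, map_mul]
    exact (mul_le_of_le_one_right zero_le (u a).2).trans hc
  · rw [map_mul, val_zpow_mul_mul_zpow hz.1]
    exact (mul_le_of_le_one_right zero_le (u a).2).trans hc
  · rw [map_mul]
    exact (mul_le_of_le_one_left zero_le (u c).2).trans h1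

end Expansions

/-! ### Evaluation of power series over the residue algebra at `X` -/

section Evaluation

variable {k : Type*} [Field k] {D : Type*} [DivisionRing D] [Algebra k⸨X⸩ D]
  [FiniteDimensional k⸨X⸩ D] (u : Residue k D →+* (val k D).integer)

/-- Evaluation of polynomials over the residue algebra at the central element `X`. -/
noncomputable def polyEval : (Residue k D)[X] →+* D :=
  eval₂RingHom' ((val k D).integer.subtype.comp u) (unif k D)
    fun a => (unif_mul_comm k D (u a)).symm

theorem polyEval_C (a : Residue k D) : polyEval u (C a) = u a := by
  simp [polyEval, eval₂RingHom']

theorem polyEval_X : polyEval u X = unif k D := by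
  simp [polyEval, eval₂RingHom']

theorem polyEval_sum_range (c : ℕ → Residue k D) (n : ℕ) :
    polyEval u (∑ j ∈ Finset.range n, monomial j (c j)) =
      ∑ j ∈ Finset.range n, (u (c j) : D) * unif k D ^ j := by
  rw [map_sum]
  simp only [← C_mul_X_pow_eq_monomial, map_mul, map_pow, polyEval_C, polyEval_X]

theorem val_polyEval_le (f : (Residue k D)[X]) : val k D (polyEval u f) ≤ 1 := by
  rw [f.as_sum_range, polyEval_sum_range]
  refine Valuation.map_sum_le (val k D) fun j _ => ?_
  rw [map_mul, map_pow]
  exact mul_le_one' (u _).2 (pow_le_one₀ zero_le (val_unif_lt_one k D).le)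

theorem val_polyEval_le_pow {f : (Residue k D)[X]} {n : ℕ} (h : ∀ j < n, f.coeff j = 0) :
    val k D (polyEval u f) ≤ val k D (unif k D) ^ n := by
  obtain ⟨g, rfl⟩ := X_pow_dvd_iff.2 h
  rw [map_mul, map_pow, polyEval_X, map_mul, map_pow]
  exact mul_le_of_le_one_right zero_le (val_polyEval_le u g)

theorem exists_powerSeriesEval (f : PowerSeries (Residue k D)) :
    ∃ x : D, ∀ n, val k D (x - polyEval u (f.trunc n)) ≤ val k D (unif k D) ^ n := by
  obtain ⟨x, hx⟩ := exists_val_sub_sum_le_unif (k := k)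
    (fun j => (u (PowerSeries.coeff j f) : D) * unif k D ^ j) (fun n => by
      rw [map_mul, map_pow]
      exact mul_le_of_le_one_left zero_le (u _).2)
  refine ⟨x, fun n => ?_⟩
  have h1 : f.trunc n = ∑ j ∈ Finset.range n, monomial j (PowerSeries.coeff j f) := by
    ext m
    simp [PowerSeries.coeff_trunc, coeff_monomial]
  rw [h1, polyEval_sum_range]
  exact hx n

/-- The value of a power series over the residue algebra at the central element `X`. -/
noncomputable def powerSeriesEval (f : PowerSeries (Residue k D)) : D :=
  (exists_powerSeriesEval u f).choose

theorem val_powerSeriesEval_sub_le (f : PowerSeries (Residue k D)) {g : (Residue k D)[X]} {n : ℕ}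
    (h : ∀ j < n, g.coeff j = PowerSeries.coeff j f) :
    val k D (powerSeriesEval u f - polyEval u g) ≤ val k D (unif k D) ^ n := by
  have h1 := (exists_powerSeriesEval u f).choose_spec n
  have h2 : val k D (polyEval u (f.trunc n - g)) ≤ val k D (unif k D) ^ n :=
    val_polyEval_le_pow u fun j hj => by
      rw [coeff_sub, PowerSeries.coeff_trunc, if_pos hj, h j hj, sub_self]
  have := Valuation.map_add_le _ h1 h2
  rwa [map_sub, sub_add_sub_cancel] at this

theorem powerSeriesEval_eq {f : PowerSeries (Residue k D)} {x : D}
    (h : ∀ n, ∃ g : (Residue k D)[X], (∀ j < n, g.coeff j = PowerSeries.coeff j f) ∧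
      val k D (x - polyEval u g) ≤ val k D (unif k D) ^ n) : powerSeriesEval u f = x := by
  rw [← sub_eq_zero]
  refine eq_zero_of_forall_val_le (k := k) (unif_ne_zero k D) (val_unif_lt_one k D) fun n => ?_
  obtain ⟨g, hg, hx⟩ := h n
  have := Valuation.map_sub_le (v := val k D) (val_powerSeriesEval_sub_le u f hg) hx
  rwa [sub_sub_sub_cancel_right] at this

theorem val_powerSeriesEval_le (f : PowerSeries (Residue k D)) :
    val k D (powerSeriesEval u f) ≤ 1 := by
  simpa using val_powerSeriesEval_sub_le u f (g := 0) (n := 0) (by simp)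

theorem res_powerSeriesEval (hu : IsSection u) (f : PowerSeries (Residue k D)) :
    res (powerSeriesEval u f) = PowerSeries.constantCoeff f := by
  have h := val_powerSeriesEval_sub_le u f (g := C (PowerSeries.constantCoeff f)) (n := 1)
    (fun j hj => by
      obtain rfl : j = 0 := by omega
      simp)
  rw [polyEval_C, pow_one] at h
  rw [← res_section hu (PowerSeries.constantCoeff f),
    res_eq_res_iff (val_powerSeriesEval_le u f) (u _).2]
  exact h.trans_lt (val_unif_lt_one k D)

/-- Evaluation at `X` as a ring homomorphism. -/
noncomputable def powerSeriesEvalHom :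
    PowerSeries (Residue k D) →+* (val k D).integer where
  toFun f := ⟨powerSeriesEval u f, val_powerSeriesEval_le u f⟩
  map_zero' := Subtype.ext (powerSeriesEval_eq u fun n => ⟨0, by simp, by simp⟩)
  map_one' := Subtype.ext (powerSeriesEval_eq u fun n => ⟨1, fun j _ => by
    rw [PowerSeries.coeff_one, coeff_one], by simp⟩)
  map_add' f g := Subtype.ext (powerSeriesEval_eq u fun n => ⟨f.trunc n + g.trunc n,
    fun j hj => by simp [PowerSeries.coeff_trunc, hj], by
      have := Valuation.map_add_le _ (val_powerSeriesEval_sub_le u f (g := f.trunc n) (n := n)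
        fun j hj => by simp [PowerSeries.coeff_trunc, hj])
        (val_powerSeriesEval_sub_le u g (g := g.trunc n) (n := n)
        fun j hj => by simp [PowerSeries.coeff_trunc, hj])
      rw [map_add]
      rwa [← add_sub_add_comm] at this⟩)
  map_mul' f g := Subtype.ext (powerSeriesEval_eq u fun n => ⟨f.trunc n * g.trunc n,
    fun j hj => by
      rw [PowerSeries.coeff_mul, coeff_mul]
      refine Finset.sum_congr rfl fun ab hab => ?_
      rw [Finset.HasAntidiagonal.mem_antidiagonal] at hab
      rw [PowerSeries.coeff_trunc, PowerSeries.coeff_trunc, if_pos (by omega), if_pos (by omega)],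
    by
      have h1 := val_powerSeriesEval_sub_le u f (g := f.trunc n) (n := n)
        fun j hj => by simp [PowerSeries.coeff_trunc, hj]
      have h2 := val_powerSeriesEval_sub_le u g (g := g.trunc n) (n := n)
        fun j hj => by simp [PowerSeries.coeff_trunc, hj]
      have h3 : powerSeriesEval u f * powerSeriesEval u g - polyEval u (f.trunc n) *
          polyEval u (g.trunc n) = (powerSeriesEval u f - polyEval u (f.trunc n)) *
          powerSeriesEval u g + polyEval u (f.trunc n) *
          (powerSeriesEval u g - polyEval u (g.trunc n)) := by noncomm_ring
      rw [map_mul, Subring.coe_mul, h3]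
      refine Valuation.map_add_le _ ?_ ?_
      · rw [map_mul]
        exact (mul_le_of_le_one_right zero_le (val_powerSeriesEval_le u g)).trans h1
      · rw [map_mul]
        exact (mul_le_of_le_one_left zero_le (val_polyEval_le u _)).trans h2⟩)

end Evaluation

end SplitAlg

/-! ### Existence of an embedding determined by `s` -/

namespace SplitAlg

attribute [local instance] residueDivisionRing centerField centerAlgebra

section

variable {k : Type*} [Field k] {D : Type*} [DivisionRing D] [Algebra k⸨X⸩ D]
  [FiniteDimensional k⸨X⸩ D]

theorem charP_of_constants (p : ℕ) [CharP k p] : CharP D p :=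
  charP_of_injective_ringHom (f := (algebraMap k⸨X⸩ D).comp (HahnSeries.C : k →+* k⸨X⸩))
    (RingHom.injective _) p

/-- On `p ^ N`-th powers of elements of `k`, a section differs little from the constants. -/
theorem val_section_pow_sub_le (p : ℕ) [Fact p.Prime] [CharP k p]
    {u : Residue k D →+* (val k D).integer} (hu : IsSection u) {z : D} (hz : IsParameter k z)
    (c : k) (N : ℕ) : val k D ((u (algebraMap k (Residue k D) c ^ p ^ N) : D) -
      algebraMap k⸨X⸩ D (HahnSeries.C c ^ p ^ N)) ≤ val k D z ^ p ^ N := by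
  have : CharP D p := charP_of_constants (k := k) p
  have h1 : val k D ((u (algebraMap k (Residue k D) c) : D) - constHom k D c) < 1 := by
    rw [← res_eq_res_iff (u _).2 (constHom k D c).2, res_section hu, res_constHom]
  -- Constants are central, so in characteristic `p` the difference of the `p ^ N`-th powers is the
  -- `p ^ N`-th power of the difference, which has positive order.
  rw [map_pow, map_pow, Subring.coe_pow, ← coe_constHom, ← sub_pow_char_pow_of_commute p, map_pow]
  · gcongr
    exact hz.val_le h1
  · exact (Algebra.commutes (HahnSeries.C c : k⸨X⸩) (u (algebraMap k (Residue k D) c) : D)).symm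

/-- A section which is the identity on sufficiently many constants is determined by `s`. -/
theorem deltaDetermined_of_section_eq (p : ℕ) [Fact p.Prime] [CharP k p]
    {u : Residue k D →+* (val k D).integer} (hu : IsSection u) (s : ResidueCenter k D)
    {ι : Type*} (b : ι → k)
    (hb : ∀ (N : ℕ) (T : Subring (ResidueCenter k D)),
      (∀ c : k, algebraMap k (ResidueCenter k D) c ^ p ^ N ∈ T) →
        (∀ i, algebraMap k (ResidueCenter k D) (b i) ∈ T) → s ∈ T → T = ⊤)
    (hub : ∀ i, (u (algebraMap k (Residue k D) (b i)) : D) = constHom k D (b i)) :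
    DeltaDetermined u (s : Residue k D) := by
  intro z z' l l' j j' hz hz' hs a ha
  -- The ring of central elements over which `delta u z l j` is left linear.
  let R₀ (z : D) (hz : IsParameter k z) (l : ℤ) (j : ℕ) : Subring (ResidueCenter k D) :=
    { carrier := {c | ∀ x, delta u z l j ((c : Residue k D) * x) = c * delta u z l j x}
      mul_mem' := fun {c d} hc hd x => by
        rw [MulMemClass.coe_mul, mul_assoc, hc, hd, mul_assoc]
      one_mem' := fun x => by simp
      add_mem' := fun {c d} hc hd x => by
        rw [AddMemClass.coe_add, add_mul, delta_add hu hz, hc, hd, add_mul]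
      zero_mem' := fun x => by simp [delta_zero hu hz]
      neg_mem' := fun {c} hc x => by
        have h1 := delta_add hu hz l j (((-c : ResidueCenter k D) : Residue k D) * x) (c * x)
        rw [← add_mul] at h1
        have h2 : ((-c : ResidueCenter k D) : Residue k D) = - c := rfl
        rw [h2, neg_add_cancel, zero_mul, delta_zero hu hz, hc, eq_comm, add_eq_zero_iff_eq_neg]
          at h1
        change delta u z l j (-(c : Residue k D) * x) = -(c : Residue k D) * delta u z l j x
        rw [h1, neg_mul] }
  have hmem : ∀ (z : D) (hz : IsParameter k z) (l : ℤ) (j N : ℕ), j < p ^ N →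
      (∀ c : k, algebraMap k (ResidueCenter k D) c ^ p ^ N ∈ R₀ z hz l j) ∧
        ∀ i, algebraMap k (ResidueCenter k D) (b i) ∈ R₀ z hz l j := by
    intro z hz l j N hN
    refine ⟨fun c x => ?_, fun i x => ?_⟩
    · exact delta_mul_of_val_le hu hz l hN (val_section_pow_sub_le p hu hz c N) x
    · refine delta_mul_of_val_le hu hz l (Nat.lt_succ_self j) (f := HahnSeries.C (b i)) ?_ x
      rw [← coe_constHom]
      have h1 : (u ((algebraMap k (ResidueCenter k D) (b i) : ResidueCenter k D) : Residue k D) : D)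
        = constHom k D (b i) := hub i
      rw [h1, sub_self, map_zero]
      exact zero_le
  -- Both maps are linear over `R`, which contains the `b i` and the `p ^ N`-th powers of constants
  -- for `N = j + j'`, as `p ^ N` exceeds `j` and `j'`. Hence `R[s]` is the whole centre.
  let R := R₀ z hz l j ⊓ R₀ z' hz' l' j'
  let T := (Algebra.adjoin R {s}).toSubring
  have hRT : R ≤ T := fun c hc => (Algebra.adjoin R {s}).algebraMap_mem ⟨c, hc⟩
  have hN : ∀ i ≤ j + j', i < p ^ (j + j') := fun i hi =>
    hi.trans_lt (Nat.lt_pow_self (Fact.out : p.Prime).one_lt)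
  have h1 := hmem z hz l j (j + j') (hN _ (by omega))
  have h2 := hmem z' hz' l' j' (j + j') (hN _ (by omega))
  have hT : T = ⊤ := hb (j + j') T (fun c => hRT ⟨h1.1 c, h2.1 c⟩)
    (fun i => hRT ⟨h1.2 i, h2.2 i⟩) (Algebra.self_mem_adjoin_singleton R s)
  have haT : (⟨a, ha⟩ : ResidueCenter k D) ∈ T := hT ▸ Subring.mem_top _
  change _ ∈ Algebra.adjoin R {s} at haT
  rw [Algebra.adjoin_singleton_eq_range_aeval] at haT
  obtain ⟨f, hf⟩ := haT
  have hf' : ∑ i ∈ Finset.range (f.natDegree + 1),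
      ((f.coeff i : ResidueCenter k D) : Residue k D) * (s : Residue k D) ^ i = a := by
    have h3 := congrArg Subtype.val hf
    change ((aeval s f : ResidueCenter k D) : Residue k D) = a at h3
    rw [← h3, aeval_eq_sum_range]
    change _ = (ResidueCenter k D).val _
    rw [map_sum]
    rfl
  rw [← hf', delta_sum hu hz, delta_sum hu hz']
  refine Finset.sum_congr rfl fun i _ => ?_
  rw [(f.coeff i).2.1, (f.coeff i).2.2, hs]

/-- A given section `u₀` is twisted by a higher derivation `U` of the residue algebra: evaluation at
`X`, with coefficients embedded by `u₀`, composed with `U`. If `U` sends `b i` to the coefficients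
of the expansion of the constant `b i`, the new section fixes the `b i`. -/
theorem exists_section_deltaDetermined (p : ℕ) [Fact p.Prime] [CharP k p]
    [Algebra.IsCentral k⸨X⸩ D] (hD : Splittable k D) (s : Residue k D)
    (hs : ResidueCenter k D = Algebra.adjoin k {s}) :
    ∃ u : Residue k D →+* (val k D).integer, IsSection u ∧ DeltaDetermined u s := by
  obtain ⟨u₀, hu₀⟩ := hD
  have hsZ : s ∈ ResidueCenter k D := hs ▸ Algebra.self_mem_adjoin_singleton k s
  have htop : Algebra.adjoin k {(⟨s, hsZ⟩ : ResidueCenter k D)} = ⊤ := by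
    refine Subalgebra.map_injective (f := (ResidueCenter k D).val) Subtype.val_injective ?_
    rw [AlgHom.map_adjoin, Algebra.map_top, Subalgebra.range_val, Set.image_singleton]
    exact hs.symm
  have hcp : CharP (ResidueCenter k D) p :=
    charP_of_injective_algebraMap (algebraMap k (ResidueCenter k D)).injective p
  let _ : Algebra (ZMod p) (ResidueCenter k D) := ZMod.algebra _ p
  obtain ⟨ι, b, hb, hbs⟩ := exists_pBasis_of_adjoin_eq_top p (⟨s, hsZ⟩ : ResidueCenter k D) htop
  have hgen := isGenerator_unif_centralizer hu₀
  have hexp : ∀ c : k, ∀ n, val k D ((constHom k D c : D) - ∑ j ∈ Finset.range n,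
      (u₀ (coeff u₀ (unif k D) (constHom k D c : D) j) : D) * unif k D ^ j) ≤
      val k D (unif k D) ^ n := fun c n =>
    hgen.val_sub_sum_coeff_le hu₀ (section_mem_centralizer u₀) (constHom_mem _ c)
      (constHom k D c).2 n
  -- The constant `c` and `X` commute with `u₀ a`; expanding `c * u₀ a` in two ways shows that the
  -- coefficients of `c` are central.
  have hcen : ∀ c j, coeff u₀ (unif k D) (constHom k D c : D) j ∈ ResidueCenter k D := by
    intro c j
    rw [Subalgebra.mem_center_iff]
    intro a
    have hcomm : (constHom k D c : D) * (u₀ a : D) = u₀ a * constHom k D c :=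
      Algebra.commutes (HahnSeries.C c : k⸨X⸩) (u₀ a : D)
    refine eq_of_val_sub_sum_le hu₀ (unif_ne_zero k D) (val_unif_lt_one k D)
      (x := (constHom k D c : D) * u₀ a) (m := j + 1)
      (c := fun j => a * coeff u₀ (unif k D) (constHom k D c : D) j)
      (d := fun j => coeff u₀ (unif k D) (constHom k D c : D) j * a) ?_ ?_ j (Nat.lt_succ_self j)
    · rw [hcomm]
      simp only [map_mul, Subring.coe_mul, mul_assoc]
      rw [← Finset.mul_sum, ← mul_sub, map_mul]
      exact (mul_le_of_le_one_left zero_le (u₀ a).2).trans (hexp c (j + 1))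
    · have h1 : ∀ i : ℕ, (u₀ a : D) * unif k D ^ i = unif k D ^ i * u₀ a := fun i =>
        ((show Commute (unif k D) (u₀ a : D) from unif_mul_comm k D _).pow_left i).eq.symm
      simp only [map_mul, Subring.coe_mul, mul_assoc, h1]
      simp only [← mul_assoc]
      rw [← Finset.sum_mul, ← sub_mul, map_mul]
      exact (mul_le_of_le_one_right zero_le (u₀ a).2).trans (hexp c (j + 1))
  let φ : ι → PowerSeries (ResidueCenter k D) := fun i =>
    PowerSeries.mk fun j => ⟨_, hcen (b i) j⟩
  obtain ⟨V, hV, hVb⟩ := exists_hasseSchmidt_of_linearIndependent p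
    (fun i => algebraMap k (ResidueCenter k D) (b i)) hb φ (fun i => by
      refine Subtype.ext ?_
      rw [← PowerSeries.coeff_zero_eq_constantCoeff_apply, PowerSeries.coeff_mk]
      exact res_constHom (b i))
  have : Algebra.IsCentral (ResidueCenter k D) (Residue k D) := ⟨fun x hx =>
    ⟨⟨x, Subalgebra.mem_center_iff.2 (Subalgebra.mem_center_iff.1 hx)⟩, rfl⟩⟩
  have : FiniteDimensional (ResidueCenter k D) (Residue k D) :=
    Module.Finite.of_restrictScalars_finite k _ _
  obtain ⟨U, hU, hUV⟩ := exists_hasseSchmidt_extension (D := Residue k D) hV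
  have hu : IsSection ((powerSeriesEvalHom u₀).comp U) := by
    refine RingHom.ext fun a => ?_
    rw [RingHom.comp_apply, ← res_coe]
    exact (res_powerSeriesEval u₀ hu₀ (U a)).trans (hU a)
  refine ⟨(powerSeriesEvalHom u₀).comp U, hu,
    deltaDetermined_of_section_eq p hu ⟨s, hsZ⟩ b hbs fun i => ?_⟩
  change powerSeriesEval u₀ (U (algebraMap (ResidueCenter k D) (Residue k D)
    (algebraMap k (ResidueCenter k D) (b i)))) = _
  rw [hUV, hVb]
  refine powerSeriesEval_eq u₀ fun n => ⟨∑ j ∈ Finset.range n, monomial j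
    (coeff u₀ (unif k D) (constHom k D (b i) : D) j), fun j hj => ?_, ?_⟩
  · rw [PowerSeries.coeff_map, PowerSeries.coeff_mk, finsetSum_coeff]
    simp only [coeff_monomial]
    rw [Finset.sum_ite_eq', if_pos (Finset.mem_range.2 hj)]
    rfl
  · rw [polyEval_sum_range]
    exact hexp (b i) n

end

end SplitAlg

/-! ### Series in `z ^ p` modulo high order and normalizing parameters -/

namespace SplitAlg

attribute [local instance] residueDivisionRing centerField centerAlgebra

section

variable {k : Type*} [Field k] {D : Type*} [DivisionRing D] [Algebra k⸨X⸩ D]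
  [FiniteDimensional k⸨X⸩ D]

variable (k) in
/-- The elements of order at least `n` with respect to a parameter `z`. -/
noncomputable def ball (z : D) (n : ℕ) : AddSubgroup D where
  carrier := {x | val k D x ≤ val k D z ^ n}
  zero_mem' := by simp
  add_mem' hx hy := Valuation.map_add_le (val k D) hx hy
  neg_mem' {x} hx := by
    change val k D (-x) ≤ _
    rw [Valuation.map_neg]
    exact hx

theorem mem_ball {z x : D} {n : ℕ} : x ∈ ball k z n ↔ val k D x ≤ val k D z ^ n := Iff.rfl

theorem ball_congr {z z' : D} (h : val k D z' = val k D z) (n : ℕ) : ball k z' n = ball k z n := by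
  ext x
  rw [mem_ball, mem_ball, h]

theorem ball_anti {z : D} (hz : IsParameter k z) {m n : ℕ} (h : m ≤ n) : ball k z n ≤ ball k z m :=
  fun _ hx => le_trans hx (pow_le_pow_right_of_le_one' hz.2.1.le h)

theorem mul_mem_ball {z x y : D} {m n : ℕ} (hx : x ∈ ball k z m) (hy : y ∈ ball k z n) :
    x * y ∈ ball k z (m + n) := by
  rw [mem_ball, map_mul, pow_add]
  exact mul_le_mul' hx hy

theorem pow_mem_ball (z : D) (n : ℕ) : z ^ n ∈ ball k z n := by
  rw [mem_ball, map_pow]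

theorem section_mem_ball (u : Residue k D →+* (val k D).integer) (z : D) (a : Residue k D) :
    (u a : D) ∈ ball k z 0 := by
  rw [mem_ball, pow_zero]
  exact (u a).2

theorem section_mul_mem_ball (u : Residue k D →+* (val k D).integer) {z x : D} (a : Residue k D)
    {n : ℕ} (hx : x ∈ ball k z n) : (u a : D) * x ∈ ball k z n := by
  have := mul_mem_ball (section_mem_ball u z a) hx
  rwa [zero_add] at this

theorem mul_mem_ball_of_integral {z x y : D} {n : ℕ} (hx : x ∈ ball k z n) (hy : val k D y ≤ 1) :
    x * y ∈ ball k z n := by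
  rw [mem_ball, map_mul]
  exact (mul_le_of_le_one_right zero_le hy).trans hx

theorem section_mul_pow_mem_ball (u : Residue k D →+* (val k D).integer) (z : D) (a : Residue k D)
    (n : ℕ) : (u a : D) * z ^ n ∈ ball k z n :=
  section_mul_mem_ball u a (pow_mem_ball z n)

theorem conj_mem_ball {z y x : D} (hy : y ≠ 0) {n : ℕ} (hx : x ∈ ball k z n) :
    y * x * y⁻¹ ∈ ball k z n := by
  rw [mem_ball, val_conj hy]
  exact hx

theorem exists_eq_mul_pow {z x : D} (hz : IsParameter k z) {n : ℕ} (hx : x ∈ ball k z n) :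
    ∃ y, val k D y ≤ 1 ∧ x = y * z ^ n := by
  refine ⟨x * (z ^ n)⁻¹, ?_, (inv_mul_cancel_right₀ (pow_ne_zero _ hz.1) x).symm⟩
  rw [map_mul, map_inv₀, map_pow]
  exact mul_inv_le_one_of_le₀ hx zero_le

/-- The leading coefficient of an element of order at least `n`. -/
theorem exists_sub_mem_ball {u : Residue k D →+* (val k D).integer} (hu : IsSection u) {z x : D}
    (hz : IsParameter k z) {n : ℕ} (hx : x ∈ ball k z n) :
    ∃ d, x - (u d : D) * z ^ n ∈ ball k z (n + 1) := by
  obtain ⟨y, hy, rfl⟩ := exists_eq_mul_pow hz hx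
  refine ⟨res y, ?_⟩
  rw [← sub_mul, add_comm]
  refine mul_mem_ball ?_ (pow_mem_ball z n)
  rw [mem_ball, pow_one]
  exact hz.val_le (val_sub_res_lt hu hy)

theorem pow_sub_pow_mem_ball {z z' : D} (hv : val k D z' = val k D z)
    (h : z' - z ∈ ball k z 2) (n : ℕ) : z' ^ n - z ^ n ∈ ball k z (n + 1) := by
  induction n with
  | zero => simp
  | succ n ih =>
    have h1 : z' ^ (n + 1) - z ^ (n + 1) = z' ^ n * (z' - z) + (z' ^ n - z ^ n) * z := by
      rw [pow_succ, pow_succ]; noncomm_ring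
    rw [h1]
    have h2 : z' ^ n ∈ ball k z n := by rw [mem_ball, map_pow, hv]
    exact AddSubgroup.add_mem _ (mul_mem_ball (m := n) (n := 2) h2 h)
      (mul_mem_ball (m := n + 1) (n := 1) ih (by simpa using pow_mem_ball (k := k) z 1))

/-- The additive group generated by the elements `u a * z ^ (p * m)`. -/
noncomputable def powSpan (u : Residue k D →+* (val k D).integer) (p : ℕ) (z : D) :
    AddSubgroup D :=
  AddSubgroup.closure {x | ∃ a m, x = (u a : D) * z ^ (p * m)}

/-- The elements congruent modulo terms of order `J` to a series in `z ^ p`. -/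
noncomputable def powSpanMod (u : Residue k D →+* (val k D).integer) (p : ℕ) (z : D) (J : ℕ) :
    AddSubgroup D :=
  powSpan u p z ⊔ ball k z J

variable {u : Residue k D →+* (val k D).integer} {p : ℕ} {z : D}

theorem mul_pow_mem_powSpan (a : Residue k D) (m : ℕ) :
    (u a : D) * z ^ (p * m) ∈ powSpan u p z :=
  AddSubgroup.subset_closure ⟨a, m, rfl⟩

theorem powSpan_le_powSpanMod (J : ℕ) : powSpan u p z ≤ powSpanMod u p z J := le_sup_left

theorem ball_le_powSpanMod (J : ℕ) : ball k z J ≤ powSpanMod u p z J := le_sup_right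

theorem section_mem_powSpan (a : Residue k D) : (u a : D) ∈ powSpan u p z := by
  simpa using mul_pow_mem_powSpan (u := u) (p := p) (z := z) a 0

theorem one_mem_powSpan : (1 : D) ∈ powSpan u p z := by
  simpa using section_mem_powSpan (u := u) (p := p) (z := z) 1

theorem exists_of_mem_powSpanMod {x : D} {J : ℕ} (hx : x ∈ powSpanMod u p z J) :
    ∃ w ∈ powSpan u p z, x - w ∈ ball k z J := by
  obtain ⟨w, hw, r, hr, rfl⟩ := AddSubgroup.mem_sup.1 hx
  exact ⟨w, hw, by rwa [add_sub_cancel_left]⟩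

theorem mem_powSpanMod_of_sub_mem {x y : D} {J : ℕ} (hy : y ∈ powSpanMod u p z J)
    (h : x - y ∈ ball k z J) : x ∈ powSpanMod u p z J := by
  have := AddSubgroup.add_mem _ (ball_le_powSpanMod (u := u) (p := p) J h) hy
  rwa [sub_add_cancel] at this

theorem powSpanMod_anti (hz : IsParameter k z) {m n : ℕ} (h : m ≤ n) :
    powSpanMod u p z n ≤ powSpanMod u p z m :=
  sup_le_sup_left (ball_anti hz h) _

/-- To check that a homomorphism maps series in `z ^ p` into a group, look at the generators. -/
theorem powSpan_induction {f : D →+ D} {H : AddSubgroup D}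
    (h : ∀ a m, f ((u a : D) * z ^ (p * m)) ∈ H) {x : D} (hx : x ∈ powSpan u p z) : f x ∈ H := by
  have : powSpan u p z ≤ H.comap f := by
    refine (AddSubgroup.closure_le _).2 ?_
    rintro _ ⟨a, m, rfl⟩
    exact h a m
  exact this hx

theorem powSpan_le {H : AddSubgroup D} (h : ∀ a m, (u a : D) * z ^ (p * m) ∈ H) :
    powSpan u p z ≤ H :=
  fun _ hx => powSpan_induction (f := AddMonoidHom.id D) h hx

theorem powSpan_le_ball_zero (hz : IsParameter k z) : powSpan u p z ≤ ball k z 0 :=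
  powSpan_le fun a m => ball_anti hz (Nat.zero_le _) (section_mul_pow_mem_ball u z a (p * m))

theorem powSpanMod_le_ball_zero (hz : IsParameter k z) (J : ℕ) :
    powSpanMod u p z J ≤ ball k z 0 :=
  sup_le (powSpan_le_ball_zero hz) (ball_anti hz (Nat.zero_le J))

theorem val_le_one_of_mem_powSpanMod (hz : IsParameter k z) {J : ℕ} {x : D}
    (hx : x ∈ powSpanMod u p z J) : val k D x ≤ 1 := by
  simpa [mem_ball] using powSpanMod_le_ball_zero hz J hx

theorem mul_pow_mem_powSpanMod {x : D} {J : ℕ} (hx : x ∈ powSpanMod u p z J) (m : ℕ) :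
    x * z ^ (p * m) ∈ powSpanMod u p z (J + p * m) := by
  obtain ⟨w, hw, hr⟩ := exists_of_mem_powSpanMod hx
  have h1 : w * z ^ (p * m) ∈ powSpan u p z :=
    powSpan_induction (f := AddMonoidHom.mulRight (z ^ (p * m))) (fun a n => by
      rw [AddMonoidHom.mulRight_apply, mul_assoc, ← pow_add, ← mul_add]
      exact mul_pow_mem_powSpan a _) hw
  refine mem_powSpanMod_of_sub_mem (powSpan_le_powSpanMod _ h1) ?_
  rw [← sub_mul]
  exact mul_mem_ball hr (pow_mem_ball z _)

theorem section_mul_mem_powSpanMod {x : D} {J : ℕ} (a : Residue k D)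
    (hx : x ∈ powSpanMod u p z J) : (u a : D) * x ∈ powSpanMod u p z J := by
  obtain ⟨w, hw, hr⟩ := exists_of_mem_powSpanMod hx
  have h1 : (u a : D) * w ∈ powSpan u p z :=
    powSpan_induction (f := AddMonoidHom.mulLeft (u a : D)) (fun b n => by
      change (u a : D) * ((u b : D) * z ^ (p * n)) ∈ _
      rw [← mul_assoc, ← Subring.coe_mul, ← map_mul]
      exact mul_pow_mem_powSpan _ _) hw
  refine mem_powSpanMod_of_sub_mem (powSpan_le_powSpanMod _ h1) ?_
  rw [← mul_sub]
  exact section_mul_mem_ball u a hr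

/-- The coefficients of series in `z ^ p` vanish outside of the multiples of `p`. -/
theorem exists_coeff_of_mem_powSpan (hz : IsParameter k z) {w : D} (hw : w ∈ powSpan u p z)
    (n : ℕ) : ∃ c : ℕ → Residue k D, (∀ j, ¬ p ∣ j → c j = 0) ∧
      w - ∑ j ∈ Finset.range n, (u (c j) : D) * z ^ j ∈ ball k z n := by
  classical
  induction hw using AddSubgroup.closure_induction with
  | mem x hx =>
    obtain ⟨a, m, rfl⟩ := hx
    refine ⟨Pi.single (p * m) a, fun j hj => Pi.single_eq_of_ne (fun h => hj ⟨m, h⟩) _, ?_⟩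
    by_cases hm : p * m < n
    · rw [Finset.sum_eq_single_of_mem (p * m) (Finset.mem_range.2 hm) fun j _ hj => by
        rw [Pi.single_eq_of_ne hj]; simp, Pi.single_eq_same, sub_self]
      exact AddSubgroup.zero_mem _
    · rw [Finset.sum_eq_zero fun j hj => by
        rw [Pi.single_eq_of_ne (by have := Finset.mem_range.1 hj; omega)]; simp, sub_zero]
      exact ball_anti hz (not_lt.1 hm) (section_mul_pow_mem_ball u z a _)
  | zero => exact ⟨0, fun _ _ => rfl, by simp⟩
  | add x y _ _ hx hy =>
    obtain ⟨c, hc, hcx⟩ := hx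
    obtain ⟨d, hd, hdy⟩ := hy
    refine ⟨c + d, fun j hj => by simp [hc j hj, hd j hj], ?_⟩
    have := AddSubgroup.add_mem _ hcx hdy
    rw [sub_add_sub_comm, ← Finset.sum_add_distrib] at this
    simpa only [Pi.add_apply, map_add, Subring.coe_add, add_mul] using this
  | neg x _ hx =>
    obtain ⟨c, hc, hcx⟩ := hx
    refine ⟨-c, fun j hj => by simp [hc j hj], ?_⟩
    have := AddSubgroup.neg_mem _ hcx
    rw [neg_sub', ← Finset.sum_neg_distrib] at this
    simpa only [Pi.neg_apply, map_neg, NegMemClass.coe_neg, neg_mul] using this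

/-- A series in `z ^ p` has no term of order `J` when `p ∤ J`, so the `J`-th coefficient is well
defined modulo such series and higher order. -/
theorem coeff_eq_of_sub_mem (hu : IsSection u) (hz : IsParameter k z) {x : D} {J : ℕ}
    (hx : val k D x ≤ 1) (hJ : ¬ p ∣ J) {d : Residue k D}
    (h : x - (u d : D) * z ^ J ∈ powSpanMod u p z (J + 1)) : coeff u z x J = d := by
  obtain ⟨w, hw, hr⟩ := exists_of_mem_powSpanMod h
  obtain ⟨c, hc, hcw⟩ := exists_coeff_of_mem_powSpan hz hw (J + 1)
  have h1 := eq_of_val_sub_sum_le hu hz.1 hz.2.1 (val_sub_sum_coeff_le hu hz hx (J + 1))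
    (d := fun j => c j + if j = J then d else 0) (by
      have := AddSubgroup.add_mem _ hr hcw
      rw [sub_add_sub_cancel, sub_sub] at this
      have h2 : ∑ j ∈ Finset.range (J + 1), (u (c j + if j = J then d else 0) : D) * z ^ j =
          (u d : D) * z ^ J + ∑ j ∈ Finset.range (J + 1), (u (c j) : D) * z ^ j := by
        simp only [map_add, Subring.coe_add, add_mul, Finset.sum_add_distrib]
        rw [add_comm]
        congr 1
        rw [Finset.sum_eq_single_of_mem J (Finset.mem_range.2 (Nat.lt_succ_self J))
          fun j _ hj => by rw [if_neg hj]; simp, if_pos rfl]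
      rw [h2]
      exact this) J (Nat.lt_succ_self J)
  rw [h1, hc J hJ, if_pos rfl, zero_add]

theorem eq_zero_of_mul_pow_mem (hu : IsSection u) (hz : IsParameter k z) {J : ℕ}
    (hJ : ¬ p ∣ J) {d : Residue k D} (h : (u d : D) * z ^ J ∈ powSpanMod u p z (J + 1)) :
    d = 0 := by
  have h1 := coeff_eq_of_sub_mem hu hz (x := 0) (d := d) (by simp) hJ (by
    rw [zero_sub]; exact AddSubgroup.neg_mem _ h)
  rw [← h1]
  exact coeff_eq_of_sub_mem hu hz (by simp) hJ (by simp)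

theorem sub_coeff_mem_powSpanMod (hu : IsSection u) (hz : IsParameter k z) {x : D} {J : ℕ}
    (hJ : ¬ p ∣ J) (hx : x ∈ powSpanMod u p z J) :
    x - (u (coeff u z x J) : D) * z ^ J ∈ powSpanMod u p z (J + 1) := by
  obtain ⟨w, hw, hr⟩ := exists_of_mem_powSpanMod hx
  obtain ⟨d, hd⟩ := exists_sub_mem_ball hu hz hr
  have h1 : x - (u d : D) * z ^ J ∈ powSpanMod u p z (J + 1) := by
    refine mem_powSpanMod_of_sub_mem (powSpan_le_powSpanMod _ hw) ?_
    rwa [sub_right_comm]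
  rwa [coeff_eq_of_sub_mem hu hz (val_le_one_of_mem_powSpanMod hz hx) hJ h1]

/-- For `p ∣ J` the term of order `J` is itself a generator of the span, so nothing has to be
removed. -/
theorem mem_powSpanMod_succ_of_dvd (hu : IsSection u) (hz : IsParameter k z) {x : D} {J : ℕ}
    (hJ : p ∣ J) (hx : x ∈ powSpanMod u p z J) : x ∈ powSpanMod u p z (J + 1) := by
  obtain ⟨w, hw, hr⟩ := exists_of_mem_powSpanMod hx
  obtain ⟨d, hd⟩ := exists_sub_mem_ball hu hz hr
  obtain ⟨m, rfl⟩ := hJ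
  refine mem_powSpanMod_of_sub_mem (powSpan_le_powSpanMod _
    (AddSubgroup.add_mem _ hw (mul_pow_mem_powSpan d m))) ?_
  rwa [← sub_sub]

/-- The leading term of a series in `z ^ p` is at a multiple of `p`. -/
theorem dvd_of_mem_powSpanMod (hu : IsSection u) (hz : IsParameter k z) {x : D} {n J : ℕ}
    (hn : n < J) (hx : x ∈ powSpanMod u p z J) (hxn : x ∈ ball k z n)
    (hxn' : x ∉ ball k z (n + 1)) : p ∣ n := by
  by_contra h
  obtain ⟨d, hd⟩ := exists_sub_mem_ball hu hz hxn
  have h1 : d = 0 := by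
    refine eq_zero_of_mul_pow_mem (p := p) hu hz h ?_
    have := AddSubgroup.sub_mem _ (powSpanMod_anti (u := u) (p := p) hz (by omega : n + 1 ≤ J) hx)
      (ball_le_powSpanMod _ hd)
    rwa [sub_sub_cancel] at this
  rw [h1] at hd
  simp at hd
  exact hxn' hd

/-- The parameter `z` normalizes the series in `z ^ p` modulo terms of order `J`. -/
def IsNormal (u : Residue k D →+* (val k D).integer) (p : ℕ) (z : D) (J : ℕ) : Prop :=
  ∀ a, z * (u a : D) * z⁻¹ ∈ powSpanMod u p z J

/-- Conjugation by `z` fixes the powers of `z`, so only the coefficients matter. -/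
theorem IsNormal.conj_mem (hz : IsParameter k z) {J : ℕ} (h : IsNormal u p z J) {x : D}
    (hx : x ∈ powSpanMod u p z J) : z * x * z⁻¹ ∈ powSpanMod u p z J := by
  obtain ⟨w, hw, hr⟩ := exists_of_mem_powSpanMod hx
  have h1 : z * w * z⁻¹ ∈ powSpanMod u p z J :=
    powSpan_induction (f := (AddMonoidHom.mulRight z⁻¹).comp (AddMonoidHom.mulLeft z))
      (fun a m => by
        have h2 : z * ((u a : D) * z ^ (p * m)) * z⁻¹ = z * (u a : D) * z⁻¹ * z ^ (p * m) := by
          have h3 : z ^ (p * m) * z⁻¹ = z⁻¹ * z ^ (p * m) :=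
            (((Commute.refl z).inv_right₀).pow_left _).eq
          simp only [mul_assoc, h3]
        change z * ((u a : D) * z ^ (p * m)) * z⁻¹ ∈ _
        rw [h2]
        exact powSpanMod_anti hz (Nat.le_add_right _ _) (mul_pow_mem_powSpanMod (h a) m)) hw
  refine mem_powSpanMod_of_sub_mem h1 ?_
  rw [← sub_mul, ← mul_sub]
  exact conj_mem_ball hz.1 hr

theorem IsNormal.conj_pow_mem (hz : IsParameter k z) {J : ℕ} (h : IsNormal u p z J) {x : D}
    (hx : x ∈ powSpanMod u p z J) (n : ℕ) : z ^ n * x * (z ^ n)⁻¹ ∈ powSpanMod u p z J := by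
  induction n with
  | zero => simpa using hx
  | succ n ih =>
    have := h.conj_mem hz ih
    rw [pow_succ', mul_inv_rev]
    simpa only [mul_assoc] using this

/-- Normality modulo order `J` suffices for products modulo order `J + 1`: a series is moved past `z
^ (p * m)` only for `m > 0`, and this factor raises the precision by at least one. -/
theorem IsNormal.mul_mem (hp : 0 < p) (hz : IsParameter k z) {J : ℕ} (h : IsNormal u p z J)
    {x y : D} (hx : x ∈ powSpanMod u p z (J + 1)) (hy : y ∈ powSpanMod u p z (J + 1)) :
    x * y ∈ powSpanMod u p z (J + 1) := by
  obtain ⟨w, hw, hr⟩ := exists_of_mem_powSpanMod hx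
  have h1 : w * y ∈ powSpanMod u p z (J + 1) :=
    powSpan_induction (f := AddMonoidHom.mulRight y) (fun a m => by
      rw [AddMonoidHom.mulRight_apply, mul_assoc]
      refine section_mul_mem_powSpanMod a ?_
      rcases Nat.eq_zero_or_pos m with rfl | hm
      · simpa using hy
      · have h2 := mul_pow_mem_powSpanMod (h.conj_pow_mem hz
          (powSpanMod_anti hz (Nat.le_succ J) hy) (p * m)) m
        rw [inv_mul_cancel_right₀ (pow_ne_zero _ hz.1)] at h2
        have : 0 < p * m := Nat.mul_pos hp hm
        exact powSpanMod_anti hz (by omega) h2) hw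
  refine mem_powSpanMod_of_sub_mem h1 ?_
  rw [← sub_mul]
  exact mul_mem_ball_of_integral hr (val_le_one_of_mem_powSpanMod hz hy)

theorem IsNormal.mono (hz : IsParameter k z) {I J : ℕ} (hIJ : I ≤ J) (h : IsNormal u p z J) :
    IsNormal u p z I := fun a => powSpanMod_anti hz hIJ (h a)

theorem IsNormal.pow_mem (hp : 0 < p) (hz : IsParameter k z) {J : ℕ} (h : IsNormal u p z J)
    {x : D} (hx : x ∈ powSpanMod u p z (J + 1)) (n : ℕ) : x ^ n ∈ powSpanMod u p z (J + 1) := by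
  induction n with
  | zero => simpa using powSpan_le_powSpanMod _ one_mem_powSpan
  | succ n ih => rw [pow_succ]; exact h.mul_mem hp hz ih hx

section Change

variable {z' : D}

theorem isParameter_of_val_eq (hz : IsParameter k z) (hv : val k D z' = val k D z) :
    IsParameter k z' :=
  ⟨(Valuation.ne_zero_iff (val k D)).1 (hv ▸ (Valuation.ne_zero_iff (val k D)).2 hz.1),
    hv ▸ hz.2.1, fun x hx => hv ▸ hz.2.2 x hx⟩

/-- Since `z' ^ p` is a series in `z ^ p` and such series multiply, all generators `u a * z' ^ (p *
m)` are too. -/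
theorem IsNormal.powSpanMod_le (hp : 0 < p) (hz : IsParameter k z)
    (hv : val k D z' = val k D z) {J : ℕ} (h : IsNormal u p z J)
    (hz'p : z' ^ p ∈ powSpanMod u p z (J + 1)) {I : ℕ} (hI : I ≤ J + 1) :
    powSpanMod u p z' I ≤ powSpanMod u p z I := by
  refine sup_le (powSpan_le fun a m => ?_) ?_
  · rw [pow_mul]
    exact powSpanMod_anti hz hI (section_mul_mem_powSpanMod a (h.pow_mem hp hz hz'p m))
  · rw [ball_congr hv]
    exact ball_le_powSpanMod _

/-- The leading term of a series in `z ^ p` has order `n` divisible by `p`, and `z' ^ n` agrees with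
`z ^ n` to leading order. Subtracting `u d * z' ^ n` raises the order, and finitely many steps reach
order `I`. -/
theorem IsNormal.le_powSpanMod (hu : IsSection u) (hp : 0 < p) (hz : IsParameter k z)
    (hv : val k D z' = val k D z) (hzz' : z' - z ∈ ball k z 2) {J : ℕ} (h : IsNormal u p z J)
    (hz'p : z' ^ p ∈ powSpanMod u p z (J + 1)) {I : ℕ} (hI : I ≤ J + 1) :
    powSpanMod u p z I ≤ powSpanMod u p z' I := by
  have key : ∀ l ≤ I, ∀ x ∈ powSpanMod u p z I, x ∈ ball k z (I - l) →
      x ∈ powSpanMod u p z' I := by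
    intro l
    induction l with
    | zero =>
      intro _ x _ hx
      rw [tsub_zero, ← ball_congr hv] at hx
      exact ball_le_powSpanMod _ hx
    | succ l ih =>
      intro hl x hx hxl
      set n := I - (l + 1) with hn
      have hnl : I - l = n + 1 := by omega
      by_cases hx' : x ∈ ball k z (n + 1)
      · exact ih (by omega) x hx (hnl ▸ hx')
      obtain ⟨m, hm⟩ := dvd_of_mem_powSpanMod hu hz (by omega : n < I) hx hxl hx'
      obtain ⟨d, hd⟩ := exists_sub_mem_ball hu hz hxl
      have h1 : (u d : D) * z' ^ n ∈ powSpan u p z' := by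
        rw [hm]; exact mul_pow_mem_powSpan d m
      have h2 : x - (u d : D) * z' ^ n ∈ ball k z (n + 1) := by
        have h3 := section_mul_mem_ball u d (pow_sub_pow_mem_ball hv hzz' n)
        have := AddSubgroup.sub_mem _ hd h3
        rwa [mul_sub, sub_sub, add_sub_cancel] at this
      have h4 := ih (by omega) _ (AddSubgroup.sub_mem _ hx
        (h.powSpanMod_le hp hz hv hz'p hI (powSpan_le_powSpanMod I h1))) (hnl ▸ h2)
      have := AddSubgroup.add_mem _ h4 (powSpan_le_powSpanMod I h1)
      rwa [sub_add_cancel] at this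
  intro x hx
  refine key I le_rfl x hx ?_
  rw [tsub_self]
  exact powSpanMod_le_ball_zero hz I hx

/-- Being normal is preserved by small changes of the parameter. -/
theorem IsNormal.of_sub_mem (hu : IsSection u) (hp : 0 < p) (hz : IsParameter k z)
    (hv : val k D z' = val k D z) (hzz' : z' - z ∈ ball k z 2) {J : ℕ} (h : IsNormal u p z J)
    (hz'p : z' ^ p ∈ powSpanMod u p z (J + 1))
    (hη : ∀ a, z' * (u a : D) * z'⁻¹ - z * (u a : D) * z⁻¹ ∈ ball k z J) : IsNormal u p z' J :=
  fun a => h.le_powSpanMod hu hp hz hv hzz' hz'p (Nat.le_succ J)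
    (mem_powSpanMod_of_sub_mem (h a) (hη a))

theorem delta_one (l : ℕ) (a : Residue k D) :
    delta u z 1 l a = coeff u z (z * (u a : D) * z⁻¹) l := by
  rw [delta, zpow_one, zpow_neg_one]

/-- The first coefficient outside of the multiples of `p` after a change of the parameter. -/
theorem IsNormal.delta_eq (hu : IsSection u) (hp : 0 < p) (hz : IsParameter k z)
    (hv : val k D z' = val k D z) (hzz' : z' - z ∈ ball k z 2) {J : ℕ} (hJ : ¬ p ∣ J)
    (h : IsNormal u p z J) (hz'p : z' ^ p ∈ powSpanMod u p z (J + 1)) {η : Residue k D → Residue k D}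
    (hη : ∀ a, z' * (u a : D) * z'⁻¹ - z * (u a : D) * z⁻¹ - (u (η a) : D) * z ^ J ∈
      ball k z (J + 1)) (a : Residue k D) :
    delta u z' 1 J a = delta u z 1 J a + η a := by
  have hz' := isParameter_of_val_eq hz hv
  have hη' : ∀ a, z' * (u a : D) * z'⁻¹ - z * (u a : D) * z⁻¹ ∈ ball k z J := fun a => by
    have := AddSubgroup.add_mem _ (ball_anti hz (Nat.le_succ J) (hη a))
      (section_mul_pow_mem_ball u z (η a) J)
    rwa [sub_add_cancel] at this
  have h' := h.of_sub_mem hu hp hz hv hzz' hz'p hη'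
  have h1 := h.powSpanMod_le hp hz hv hz'p le_rfl (sub_coeff_mem_powSpanMod hu hz' hJ (h' a))
  rw [← delta_one] at h1
  set d' := delta u z' 1 J a with hd'
  -- Only the leading terms count here, so `z' ^ J` may be replaced by `z ^ J`, and the two groups
  -- of series agree modulo order `J + 1`.
  have h2 : z * (u a : D) * z⁻¹ - (u (d' - η a) : D) * z ^ J ∈ powSpanMod u p z (J + 1) := by
    refine mem_powSpanMod_of_sub_mem h1 ?_
    have h3 := section_mul_mem_ball u d' (pow_sub_pow_mem_ball hv hzz' J)
    have := AddSubgroup.sub_mem _ h3 (hη a)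
    have h4 : z * (u a : D) * z⁻¹ - (u (d' - η a) : D) * z ^ J -
        (z' * (u a : D) * z'⁻¹ - (u d' : D) * z' ^ J) = (u d' : D) * (z' ^ J - z ^ J) -
        (z' * (u a : D) * z'⁻¹ - z * (u a : D) * z⁻¹ - (u (η a) : D) * z ^ J) := by
      rw [map_sub, AddSubgroupClass.coe_sub]
      noncomm_ring
    rwa [h4]
  have h5 := coeff_eq_of_sub_mem hu hz (by rw [val_conj hz.1]; exact (u a).2) hJ h2
  rw [delta_one, h5, sub_add_cancel]

theorem IsNormal.succ (hu : IsSection u) (hz : IsParameter k z) {J : ℕ}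
    (h : IsNormal u p z J) (hd : ¬ p ∣ J → ∀ a, delta u z 1 J a = 0) :
    IsNormal u p z (J + 1) := by
  intro a
  by_cases hJ : p ∣ J
  · exact mem_powSpanMod_succ_of_dvd hu hz hJ (h a)
  · have := sub_coeff_mem_powSpanMod hu hz hJ (h a)
    rw [← delta_one, hd hJ a] at this
    simpa using this

end Change

end

end SplitAlg

/-! ### Leading terms of conjugation and their product rule -/

namespace SplitAlg

attribute [local instance] residueDivisionRing centerField centerAlgebra

section

variable {k : Type*} [Field k] {D : Type*} [DivisionRing D] [Algebra k⸨X⸩ D]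
  [FiniteDimensional k⸨X⸩ D]

/-- Conjugation by `z` is trivial up to order `i`, with leading term `δ`. -/
def IsTwist (u : Residue k D →+* (val k D).integer) (z : D) (i : ℕ)
    (δ : Residue k D → Residue k D) : Prop :=
  ∀ a, z * (u a : D) * z⁻¹ - u a - (u (δ a) : D) * z ^ i ∈ ball k z (i + 1)

variable {u : Residue k D →+* (val k D).integer} {p : ℕ} {z : D}

theorem eq_zero_of_section_mul_pow_mem_ball (hu : IsSection u) (hz : IsParameter k z) {n : ℕ}
    {d : Residue k D} (h : (u d : D) * z ^ n ∈ ball k z (n + 1)) : d = 0 := by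
  by_contra hd
  rw [mem_ball, map_mul, val_section hu hd, one_mul, map_pow] at h
  exact absurd (pow_lt_pow_right_of_lt_one₀
    (zero_lt_iff.2 ((Valuation.ne_zero_iff (val k D)).2 hz.1)) hz.2.1 (Nat.lt_succ_self n)) h.not_gt

namespace IsTwist

variable {i : ℕ} {δ : Residue k D → Residue k D}

theorem conj_section_sub_mem (h : IsTwist u z i δ) (hz : IsParameter k z) (a : Residue k D) :
    z * (u a : D) * z⁻¹ - u a ∈ ball k z i := by
  have := AddSubgroup.add_mem _ (ball_anti hz (Nat.le_succ i) (h a))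
    (section_mul_pow_mem_ball u z (δ a) i)
  rwa [sub_add_cancel] at this

/-- Conjugation fixes powers of `z` and moves each `u c` by order `i`; expanding the unit part of
`x` up to order `i` is enough, as the remainder is small already. -/
theorem conj_sub_mem (h : IsTwist u z i δ) (hu : IsSection u) (hz : IsParameter k z) {x : D}
    {n : ℕ} (hx : x ∈ ball k z n) : z * x * z⁻¹ - x ∈ ball k z (n + i) := by
  obtain ⟨y, hy, rfl⟩ := exists_eq_mul_pow hz hx
  have key : z * y * z⁻¹ - y ∈ ball k z i := by
    let φ : D →+ D := (AddMonoidHom.mulRight z⁻¹).comp (AddMonoidHom.mulLeft z) - AddMonoidHom.id D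
    change φ y ∈ _
    rw [← sub_add_cancel y (∑ j ∈ Finset.range i, (u (coeff u z y j) : D) * z ^ j), map_add, map_sum]
    have h1 := val_sub_sum_coeff_le hu hz hy i
    refine AddSubgroup.add_mem _ (AddSubgroup.sub_mem _ (conj_mem_ball hz.1 h1) h1)
      (AddSubgroup.sum_mem _ fun j _ => ?_)
    have h2 := mul_mem_ball (h.conj_section_sub_mem hz (coeff u z y j)) (pow_mem_ball (k := k) z j)
    have h3 : z ^ j * z⁻¹ = z⁻¹ * z ^ j := (((Commute.refl z).inv_right₀).pow_left _).eq
    have h4 : φ ((u (coeff u z y j) : D) * z ^ j) =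
        (z * (u (coeff u z y j) : D) * z⁻¹ - u (coeff u z y j)) * z ^ j := by
      change z * ((u (coeff u z y j) : D) * z ^ j) * z⁻¹ - (u (coeff u z y j) : D) * z ^ j = _
      rw [sub_mul]
      simp only [mul_assoc, h3]
    rw [h4]
    exact ball_anti hz (Nat.le_add_right _ _) h2
  have h3 : z ^ n * z⁻¹ = z⁻¹ * z ^ n := (((Commute.refl z).inv_right₀).pow_left _).eq
  have h4 : z * (y * z ^ n) * z⁻¹ - y * z ^ n = (z * y * z⁻¹ - y) * z ^ n := by
    rw [sub_mul]
    simp only [mul_assoc, h3]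
  rw [h4, add_comm]
  exact mul_mem_ball key (pow_mem_ball z n)

theorem conj_pow_sub_mem (h : IsTwist u z i δ) (hu : IsSection u) (hz : IsParameter k z) {x : D}
    {m : ℕ} (hx : x ∈ ball k z m) (n : ℕ) : z ^ n * x * (z ^ n)⁻¹ - x ∈ ball k z (m + i) := by
  induction n with
  | zero => simp
  | succ n ih =>
    have h1 : z ^ (n + 1) * x * (z ^ (n + 1))⁻¹ - x =
        z * (z ^ n * x * (z ^ n)⁻¹ - x) * z⁻¹ + (z * x * z⁻¹ - x) := by
      rw [pow_succ', mul_inv_rev]; noncomm_ring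
    rw [h1]
    exact AddSubgroup.add_mem _ (conj_mem_ball hz.1 ih) (h.conj_sub_mem hu hz hx)

theorem pow_mul_sub_mem (h : IsTwist u z i δ) (hu : IsSection u) (hz : IsParameter k z) {x : D}
    {m : ℕ} (hx : x ∈ ball k z m) (n : ℕ) : z ^ n * x - x * z ^ n ∈ ball k z (m + i + n) := by
  have := mul_mem_ball (h.conj_pow_sub_mem hu hz hx n) (pow_mem_ball z n)
  rwa [sub_mul, inv_mul_cancel_right₀ (pow_ne_zero _ hz.1)] at this

/-- For central `b` the element `u b` commutes with all coefficients `u c`; only its commutators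
with powers of `z` contribute, and these gain order `i`. -/
theorem commutator_mem (h : IsTwist u z i δ) (hu : IsSection u) (hz : IsParameter k z)
    {b : Residue k D} (hb : b ∈ ResidueCenter k D) {x : D} {n : ℕ} (hx : x ∈ ball k z n) :
    (u b : D) * x - x * u b ∈ ball k z (n + i) := by
  obtain ⟨y, hy, rfl⟩ := exists_eq_mul_pow hz hx
  let φ : D →+ D := AddMonoidHom.mulLeft (u b : D) - AddMonoidHom.mulRight (u b : D)
  change φ (y * z ^ n) ∈ _
  rw [← sub_add_cancel y (∑ j ∈ Finset.range i, (u (coeff u z y j) : D) * z ^ j), add_mul,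
    Finset.sum_mul, map_add, map_sum]
  have h1 : _ ∈ ball k z i := val_sub_sum_coeff_le hu hz hy i
  have h2 := mul_mem_ball h1 (pow_mem_ball z n)
  rw [add_comm i] at h2
  refine AddSubgroup.add_mem _ (AddSubgroup.sub_mem _ (section_mul_mem_ball u b h2)
    (mul_mem_ball_of_integral h2 (u b).2)) (AddSubgroup.sum_mem _ fun j _ => ?_)
  set c := coeff u z y j
  have h3 := section_mul_mem_ball u c (h.pow_mul_sub_mem hu hz (section_mem_ball u z b) (j + n))
  have h4 : φ ((u c : D) * z ^ j * z ^ n) =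
      -((u c : D) * (z ^ (j + n) * u b - u b * z ^ (j + n))) := by
    change (u b : D) * ((u c : D) * z ^ j * z ^ n) - (u c : D) * z ^ j * z ^ n * (u b : D) = _
    have h5 : (u b : D) * u c = u c * u b := by
      rw [← Subring.coe_mul, ← Subring.coe_mul, ← map_mul, ← map_mul,
        Subalgebra.mem_center_iff.1 hb c]
    rw [mul_assoc (u c : D), ← pow_add, ← mul_assoc, h5]
    noncomm_ring
  rw [h4]
  exact AddSubgroup.neg_mem _ (ball_anti hz (by omega) h3)

/-- Since `i > 0`, each further conjugation changes the accumulated difference only beyond order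
`i`, so the leading terms add up. -/
theorem conj_pow (h : IsTwist u z i δ) (hu : IsSection u) (hz : IsParameter k z) (hi : 0 < i)
    (a : Residue k D) (n : ℕ) : z ^ n * (u a : D) * (z ^ n)⁻¹ - u a - (u (n • δ a) : D) * z ^ i ∈
      ball k z (i + 1) := by
  induction n with
  | zero => simp
  | succ n ih =>
    have h2 := h.conj_sub_mem hu hz (h.conj_pow_sub_mem hu hz (section_mem_ball u z a) n)
    have h1 : z ^ (n + 1) * (u a : D) * (z ^ (n + 1))⁻¹ - u a - (u ((n + 1) • δ a) : D) * z ^ i =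
        (z * (z ^ n * (u a : D) * (z ^ n)⁻¹ - u a) * z⁻¹ - (z ^ n * (u a : D) * (z ^ n)⁻¹ - u a)) +
        (z ^ n * (u a : D) * (z ^ n)⁻¹ - u a - (u (n • δ a) : D) * z ^ i) +
        (z * (u a : D) * z⁻¹ - u a - (u (δ a) : D) * z ^ i) := by
      rw [pow_succ', mul_inv_rev, succ_nsmul, map_add, Subring.coe_add]
      noncomm_ring
    rw [h1]
    exact AddSubgroup.add_mem _ (AddSubgroup.add_mem _ (ball_anti hz (by omega) h2) ih) (h a)

theorem pow_mul_sub (h : IsTwist u z i δ) (hu : IsSection u) (hz : IsParameter k z) (hi : 0 < i)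
    (a : Residue k D) (n : ℕ) : z ^ n * (u a : D) - u a * z ^ n - (u (n • δ a) : D) * z ^ (i + n) ∈
      ball k z (i + n + 1) := by
  have := mul_mem_ball (h.conj_pow hu hz hi a n) (pow_mem_ball z n)
  rw [sub_mul, sub_mul, inv_mul_cancel_right₀ (pow_ne_zero _ hz.1), mul_assoc _ (z ^ i), ← pow_add]
    at this
  rwa [add_right_comm] at this

theorem delta_zero_eq (h : IsTwist u z i δ) (hu : IsSection u) (hz : IsParameter k z) (hi : 0 < i)
    (a : Residue k D) : delta u z 1 0 a = a := by
  refine delta_eq_of_val_le hu hz (c := fun _ => a) (m := 1) ?_ one_pos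
  have := ball_anti hz hi (h.conj_section_sub_mem hz a)
  simpa [mem_ball] using this

theorem delta_eq (h : IsTwist u z i δ) (hu : IsSection u) (hz : IsParameter k z) (hi : 0 < i)
    (a : Residue k D) : delta u z 1 i a = δ a := by
  have h1 := delta_eq_of_val_le hu hz (l := 1) (a := a)
    (c := fun j => if j = 0 then a else if j = i then δ a else 0) (m := i + 1) (by
      have h2 : ∑ j ∈ Finset.range (i + 1),
          (u (if j = 0 then a else if j = i then δ a else 0) : D) * z ^ j =
          (u a : D) + (u (δ a) : D) * z ^ i := by
        rw [Finset.sum_range_succ, if_neg hi.ne', if_pos rfl,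
          Finset.sum_eq_single_of_mem 0 (Finset.mem_range.2 hi) fun j hj hj0 => by
            rw [if_neg hj0, if_neg (Finset.mem_range.1 hj).ne]; simp]
        simp
      rw [h2, zpow_one, zpow_neg_one, ← sub_sub]
      exact h a) (Nat.lt_succ_self i)
  rwa [if_neg hi.ne', if_pos rfl] at h1

theorem isAppropriate (h : IsTwist u z i δ) (hu : IsSection u) (hz : IsParameter k z) (hi : 0 < i)
    {s : Residue k D} (hsZ : s ∈ ResidueCenter k D) (hs : δ s ≠ 0) : IsAppropriate u z i := by
  refine ⟨hz, h.delta_zero_eq hu hz hi, ⟨fun a => h.conj_section_sub_mem hz a, s,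
    le_antisymm (h.conj_section_sub_mem hz s) (not_lt.1 fun hlt => hs ?_)⟩, s, hsZ,
    by rwa [h.delta_eq hu hz hi]⟩
  refine eq_zero_of_section_mul_pow_mem_ball hu hz (n := i) ?_
  have h1 : z * (u s : D) * z⁻¹ - u s ∈ ball k z (i + 1) := by
    obtain ⟨y, hy, hxy⟩ := exists_eq_mul_pow hz (h.conj_section_sub_mem hz s)
    rw [hxy, add_comm]
    refine mul_mem_ball ?_ (pow_mem_ball z i)
    rw [mem_ball, pow_one]
    refine hz.val_le (lt_of_le_of_ne hy fun hy1 => hlt.ne ?_)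
    rw [hxy, map_mul, hy1, one_mul, map_pow]
  have := AddSubgroup.sub_mem _ h1 (h s)
  rwa [sub_sub_cancel] at this

theorem of_sub_mem (h : IsTwist u z i δ) {z' : D}
    (hv : val k D z' = val k D z) (hzz' : z' - z ∈ ball k z 2)
    (hη : ∀ a, z' * (u a : D) * z'⁻¹ - z * (u a : D) * z⁻¹ ∈ ball k z (i + 1)) :
    IsTwist u z' i δ := by
  intro a
  rw [ball_congr hv]
  have h1 := AddSubgroup.sub_mem _ (AddSubgroup.add_mem _ (hη a) (h a))
    (section_mul_mem_ball u (δ a) (pow_sub_pow_mem_ball hv hzz' i))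
  have h2 : z' * (u a : D) * z'⁻¹ - u a - (u (δ a) : D) * z' ^ i =
      z' * (u a : D) * z'⁻¹ - z * (u a : D) * z⁻¹ + (z * (u a : D) * z⁻¹ - u a -
        (u (δ a) : D) * z ^ i) - (u (δ a) : D) * (z' ^ i - z ^ i) := by noncomm_ring
  rwa [h2]

end IsTwist

/-- The leading coefficient of conjugation modulo a multiplicatively closed group satisfies the
product rule. -/
theorem product_rule_of_sub_mem (hz : IsParameter k z) {J : ℕ} (hJ : 0 < J) {G : AddSubgroup D}
    (hmul : ∀ x ∈ G, ∀ y ∈ G, x * y ∈ G) (hball : ball k z (J + 1) ≤ G)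
    (hinj : ∀ d, (u d : D) * z ^ J ∈ G → d = 0)
    (hconj : ∀ a, z * (u a : D) * z⁻¹ - u a ∈ ball k z 1)
    (hpow : ∀ a, z ^ J * (u a : D) - u a * z ^ J ∈ ball k z (J + 1)) {d : Residue k D → Residue k D}
    (hd : ∀ a, z * (u a : D) * z⁻¹ - (u (d a) : D) * z ^ J ∈ G) (a b : Residue k D) :
    d (a * b) = a * d b + d a * b := by
  rw [← sub_eq_zero]
  refine hinj _ ?_
  set A := z * (u a : D) * z⁻¹ with hA
  set B := z * (u b : D) * z⁻¹ with hB
  have hAB : z * (u (a * b) : D) * z⁻¹ = A * B := by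
    rw [hA, hB, map_mul, Subring.coe_mul]
    simp only [mul_assoc, inv_mul_cancel_left₀ hz.1]
  have h0 := hd (a * b)
  rw [hAB] at h0
  have h1 := hmul _ (hd a) _ (hd b)
  have h2 : (A - u a - (u (d a) : D) * z ^ J) * ((u (d b) : D) * z ^ J) ∈ ball k z (J + 1) := by
    rw [add_comm]
    exact mul_mem_ball (AddSubgroup.sub_mem _ (hconj a)
      (ball_anti hz hJ (section_mul_pow_mem_ball u z (d a) J))) (section_mul_pow_mem_ball u z (d b) J)
  have h3 : (u (d a) : D) * z ^ J * (B - u b) ∈ ball k z (J + 1) :=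
    mul_mem_ball (section_mul_pow_mem_ball u z (d a) J) (hconj b)
  have h4 := section_mul_mem_ball u (d a) (hpow b)
  -- The product of the reduced conjugates of `a` and `b` is compared with the reduced conjugate of
  -- `a * b`; the remaining cross terms have order above `J`.
  have h5 : (u (d (a * b) - (a * d b + d a * b)) : D) * z ^ J =
      (A - (u (d a) : D) * z ^ J) * (B - (u (d b) : D) * z ^ J) -
      (A * B - (u (d (a * b)) : D) * z ^ J) +
      ((A - u a - (u (d a) : D) * z ^ J) * ((u (d b) : D) * z ^ J) +
        (u (d a) : D) * z ^ J * (B - u b) + (u (d a) : D) * (z ^ J * u b - u b * z ^ J)) := by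
    simp only [map_sub, map_add, map_mul, AddSubgroupClass.coe_sub, Subring.coe_add, Subring.coe_mul]
    noncomm_ring
  rw [h5]
  exact AddSubgroup.add_mem _ (AddSubgroup.sub_mem _ h1 h0)
    (hball (AddSubgroup.add_mem _ (AddSubgroup.add_mem _ h2 h3) h4))

/-- Here the multiplicatively closed group is `u(D̄)` plus the elements of order above `i`. -/
theorem IsTwist.product_rule {i : ℕ} {δ : Residue k D → Residue k D} (h : IsTwist u z i δ)
    (hu : IsSection u) (hz : IsParameter k z) (hi : 0 < i) (a b : Residue k D) :
    δ (a * b) = a * δ b + δ a * b := by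
  let G : AddSubgroup D := (AddMonoidHom.range
    ((val k D).integer.subtype.comp u : Residue k D →+* D).toAddMonoidHom) ⊔ ball k z (i + 1)
  have hG : ∀ x, x ∈ G ↔ ∃ a, x - u a ∈ ball k z (i + 1) := by
    intro x
    constructor
    · intro hx
      obtain ⟨_, ⟨a, rfl⟩, r, hr, rfl⟩ := AddSubgroup.mem_sup.1 hx
      refine ⟨a, ?_⟩
      change (u a : D) + r - u a ∈ _
      rwa [add_sub_cancel_left]
    · rintro ⟨a, ha⟩
      rw [← sub_add_cancel x (u a : D)]
      exact AddSubgroup.add_mem _ (le_sup_right (a := AddMonoidHom.range _) ha)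
        (le_sup_left (b := ball k z (i + 1)) ⟨a, rfl⟩)
  refine product_rule_of_sub_mem hz hi (G := G) (fun x hx y hy => ?_) le_sup_right (fun d hd => ?_)
    (fun a => ball_anti hz hi (h.conj_section_sub_mem hz a))
    (fun a => ball_anti hz (by omega) (h.pow_mul_sub_mem hu hz (section_mem_ball u z a) i))
    (fun a => (hG _).2 ⟨a, by have := h a; rwa [sub_right_comm] at this⟩) a b
  · obtain ⟨a, ha⟩ := (hG x).1 hx
    obtain ⟨b, hb⟩ := (hG y).1 hy
    refine (hG _).2 ⟨a * b, ?_⟩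
    have h1 : val k D y ≤ 1 := by
      have := Valuation.map_add_le (val k D) (ball_anti hz (Nat.zero_le (i + 1)) hb)
        (section_mem_ball u z b)
      simpa using this
    have h2 : x * y - u (a * b) = (x - u a) * y + u a * (y - u b) := by
      rw [map_mul, Subring.coe_mul]; noncomm_ring
    rw [h2]
    exact AddSubgroup.add_mem _ (mul_mem_ball_of_integral ha h1) (section_mul_mem_ball u a hb)
  · obtain ⟨a, ha⟩ := (hG _).1 hd
    have h1 : a = 0 := by
      refine eq_zero_of_section_mul_pow_mem_ball hu hz (n := 0) ?_
      have := AddSubgroup.sub_mem _ (ball_anti hz hi (section_mul_pow_mem_ball u z d i))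
        (ball_anti hz (by omega : 1 ≤ i + 1) ha)
      rw [sub_sub_cancel] at this
      simpa using this
    rw [h1] at ha
    exact eq_zero_of_section_mul_pow_mem_ball hu hz (by simpa using ha)

/-- Here the group consists of the series in `z ^ p` modulo order `J + 1`; that `p ∤ J` makes the
coefficient of `z ^ J` visible modulo it. -/
theorem IsNormal.product_rule {J : ℕ} (h : IsNormal u p z J) (hp : 0 < p) (hJ : ¬ p ∣ J) {i : ℕ}
    {δ : Residue k D → Residue k D} (hδ : IsTwist u z i δ) (hu : IsSection u)
    (hz : IsParameter k z) (hi : 0 < i) (a b : Residue k D) :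
    delta u z 1 J (a * b) = a * delta u z 1 J b + delta u z 1 J a * b := by
  refine product_rule_of_sub_mem hz (Nat.pos_of_ne_zero (by rintro rfl; exact hJ (dvd_zero p)))
    (G := powSpanMod u p z (J + 1)) (fun x hx y hy => h.mul_mem hp hz hx hy)
    (ball_le_powSpanMod _) (fun d hd => eq_zero_of_mul_pow_mem hu hz hJ hd)
    (fun a => ball_anti hz hi (hδ.conj_section_sub_mem hz a))
    (fun a => ball_anti hz (by omega) (hδ.pow_mul_sub_mem hu hz (section_mem_ball u z a) J))
    (fun a => ?_) a b
  have := sub_coeff_mem_powSpanMod hu hz hJ (h a)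
  rwa [← delta_one] at this

/-- Apply `d` to `a * b = b * a`. -/
theorem mem_center_of_product_rule {d : Residue k D → Residue k D}
    (hd : ∀ a b, d (a * b) = a * d b + d a * b) {a : Residue k D} (ha : a ∈ ResidueCenter k D) :
    d a ∈ ResidueCenter k D := by
  rw [Subalgebra.mem_center_iff] at ha ⊢
  intro b
  have h1 := hd a b
  rw [← ha b, hd, ha (d b), add_comm] at h1
  exact add_left_cancel h1

theorem pow_eq_zero_of_product_rule {d : Residue k D → Residue k D}
    (hd : ∀ a b, d (a * b) = a * d b + d a * b) {a : Residue k D} (ha : d a = 0) (n : ℕ) :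
    d (a ^ n) = 0 := by
  induction n with
  | zero =>
    have := hd 1 1
    rw [mul_one, one_mul, mul_one, left_eq_add] at this
    rwa [pow_zero]
  | succ n ih => rw [pow_succ, hd, ha, ih, mul_zero, zero_mul, add_zero]

end

end SplitAlg

/-! ### Changing the parameter to remove a coefficient -/

namespace SplitAlg

attribute [local instance] residueDivisionRing centerField centerAlgebra

section

variable {k : Type*} [Field k] {D : Type*} [DivisionRing D] [Algebra k⸨X⸩ D]
  [FiniteDimensional k⸨X⸩ D] {u : Residue k D →+* (val k D).integer} {p : ℕ} {z : D} {i : ℕ}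
  {δ : Residue k D → Residue k D}

theorem val_lt_one_of_mem_ball (hz : IsParameter k z) {y : D} (hy : y ∈ ball k z 1) :
    val k D y < 1 := by
  rw [mem_ball, pow_one] at hy
  exact hy.trans_lt hz.2.1

theorem val_mul_one_add (hz : IsParameter k z) {y : D} (hy : y ∈ ball k z 1) :
    val k D (z * (1 + y)) = val k D z := by
  rw [map_mul, Valuation.map_one_add_of_lt (val k D) (val_lt_one_of_mem_ball hz hy), mul_one]

namespace IsTwist

/-- Conjugation by `1 + y` moves `u a` by `[y, u a] * (1 + y)⁻¹`, with the leading term of `[y, u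
a]`; the outer conjugation by `z` does not alter leading terms because `i > 0`. -/
theorem conj_mul_one_add_sub_mem (h : IsTwist u z i δ) (hu : IsSection u) (hz : IsParameter k z)
    (hi : 0 < i) {y : D} (hy : y ∈ ball k z 1) {J : ℕ} {a η : Residue k D}
    (hη : y * (u a : D) - u a * y - (u η : D) * z ^ J ∈ ball k z (J + 1)) :
    z * (1 + y) * (u a : D) * (z * (1 + y))⁻¹ - z * (u a : D) * z⁻¹ - (u η : D) * z ^ J ∈
      ball k z (J + 1) := by
  have hw1 := Valuation.map_one_add_of_lt (val k D) (val_lt_one_of_mem_ball hz hy)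
  have hw : 1 + y ≠ 0 := ne_zero_of_val_eq_one hw1
  set c := y * (u a : D) - u a * y with hc
  have hcJ : c ∈ ball k z J := by
    have := AddSubgroup.add_mem _ (ball_anti hz (Nat.le_succ J) hη)
      (section_mul_pow_mem_ball u z η J)
    rwa [sub_add_cancel] at this
  have hcw : c * (1 + y)⁻¹ ∈ ball k z J := mul_mem_ball_of_integral hcJ (by
    rw [map_inv₀, hw1, inv_one])
  have h1 : z * (1 + y) * (u a : D) * (z * (1 + y))⁻¹ - z * (u a : D) * z⁻¹ =
      z * (c * (1 + y)⁻¹) * z⁻¹ := by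
    have h2 : c = (1 + y) * u a - u a * (1 + y) := by rw [hc]; noncomm_ring
    rw [h2, mul_inv_rev, sub_mul _ _ (1 + y)⁻¹, mul_inv_cancel_right₀ hw, mul_sub, sub_mul]
    simp only [mul_assoc]
  have h3 : c * (1 + y)⁻¹ - c = -(c * (1 + y)⁻¹ * y) := by
    have h4 : c = c * (1 + y)⁻¹ * (1 + y) := (inv_mul_cancel_right₀ hw c).symm
    conv_lhs => rw [h4]
    rw [mul_inv_cancel_right₀ hw, mul_add, mul_one, sub_add_cancel_left]
  rw [h1, ← sub_add_sub_cancel _ (c * (1 + y)⁻¹) _,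
    ← sub_add_sub_cancel (c * (1 + y)⁻¹) c, h3]
  exact AddSubgroup.add_mem _ (ball_anti hz (by omega) (h.conj_sub_mem hu hz hcw))
    (AddSubgroup.add_mem _ (AddSubgroup.neg_mem _ (mul_mem_ball hcw hy)) hη)

end IsTwist

/-- The `p`-th power of a perturbed parameter. -/
theorem IsNormal.mul_one_add_pow_mem [Fact p.Prime] [CharP k p] {J : ℕ} (h : IsNormal u p z J)
    (hδ : IsTwist u z i δ) (hu : IsSection u) (hz : IsParameter k z) (b : Residue k D) {m : ℕ}
    (hm : 0 < m) (hmJ : J ≤ m + i) :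
    (z * (1 + (u b : D) * z ^ m)) ^ p ∈ powSpanMod u p z (J + 1) := by
  have : CharP D p := charP_of_constants (k := k) p
  have hp := (Fact.out : p.Prime).pos
  set y := (u b : D) * z ^ m with hy
  have hym : y ∈ ball k z m := section_mul_pow_mem_ball u z b m
  set w := 1 + y with hw
  have hwn : ∀ n, w ^ n - 1 ∈ ball k z m := by
    intro n
    induction n with
    | zero => simp
    | succ n ih =>
      have h1 : w ^ (n + 1) - 1 = (w ^ n - 1) + (w ^ n - 1) * y + y := by
        rw [pow_succ, hw]; noncomm_ring
      rw [h1]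
      exact AddSubgroup.add_mem _ (AddSubgroup.add_mem _ ih
        (ball_anti hz (Nat.le_add_right _ _) (mul_mem_ball ih hym))) hym
  have hz0 := hz.1
  -- Moving `z` to the right past `w ^ (n + 1)` costs order `m + i ≥ J`.
  have hv : ∀ n, ∃ v, (z * w) ^ n = v * z ^ n ∧ v - w ^ n ∈ ball k z J := by
    intro n
    induction n with
    | zero => exact ⟨1, by simp, by simp⟩
    | succ n ih =>
      obtain ⟨v, hv1, hv2⟩ := ih
      refine ⟨z * (w * v) * z⁻¹, ?_, ?_⟩
      · rw [pow_succ' (z * w), hv1, pow_succ' z]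
        simp only [mul_assoc, inv_mul_cancel_left₀ hz0]
      · have hw1 : val k D w ≤ 1 := by
          rw [Valuation.map_one_add_of_lt (val k D)
            (val_lt_one_of_mem_ball hz (ball_anti hz hm hym))]
        have h1 : w * (v - w ^ n) ∈ ball k z J := by
          have := mul_mem_ball (k := k) (z := z) (x := w) (m := 0) (by simpa [mem_ball] using hw1) hv2
          rwa [zero_add] at this
        have h3 : z * (w * v - w ^ (n + 1)) * z⁻¹ ∈ ball k z J := by
          rw [pow_succ', ← mul_sub]; exact conj_mem_ball hz0 h1
        have h4 := ball_anti hz hmJ (hδ.conj_sub_mem hu hz (hwn (n + 1)))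
        have h5 : z * (w * v) * z⁻¹ - w ^ (n + 1) = z * (w * v - w ^ (n + 1)) * z⁻¹ +
            (z * (w ^ (n + 1) - 1) * z⁻¹ - (w ^ (n + 1) - 1)) := by
          rw [mul_sub z (w ^ (n + 1)), sub_mul, mul_one, mul_inv_cancel₀ hz0]
          noncomm_ring
        rw [h5]
        exact AddSubgroup.add_mem _ h3 h4
  have hx : ∀ n, ∃ x ∈ powSpanMod u p z J, y ^ n = x * z ^ (m * n) := by
    intro n
    induction n with
    | zero => exact ⟨1, powSpan_le_powSpanMod _ one_mem_powSpan, by simp⟩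
    | succ n ih =>
      obtain ⟨x, hx, hxy⟩ := ih
      refine ⟨u b * (z ^ m * x * (z ^ m)⁻¹),
        section_mul_mem_powSpanMod b (h.conj_pow_mem hz hx m), ?_⟩
      rw [pow_succ', hxy, hy, mul_add, mul_one, add_comm (m * n), pow_add]
      simp only [mul_assoc, inv_mul_cancel_left₀ (pow_ne_zero m hz0)]
  obtain ⟨v, hv1, hv2⟩ := hv p
  obtain ⟨x, hxQ, hxy⟩ := hx p
  -- In characteristic `p` only `1` and `y ^ p` survive, and `y ^ p` carries the power `z ^ (p *
  -- m)`.
  have hwp : w ^ p = 1 + x * z ^ (p * m) := by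
    rw [hw, add_pow_char_of_commute p (Commute.one_left y), one_pow, hxy, mul_comm m p]
  have h6 : w ^ p ∈ powSpanMod u p z J := by
    rw [hwp]
    exact AddSubgroup.add_mem _ (powSpan_le_powSpanMod _ one_mem_powSpan)
      (powSpanMod_anti hz (Nat.le_add_right _ _) (mul_pow_mem_powSpanMod hxQ m))
  -- The factor `z ^ p` raises the precision from `J` to `J + p`.
  have h7 := mul_pow_mem_powSpanMod (mem_powSpanMod_of_sub_mem h6 hv2) 1
  rw [mul_one] at h7
  rw [hv1]
  exact powSpanMod_anti hz (by omega) h7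

/-- The effect of a change of the parameter on the first coefficient outside of the multiples
of `p`. -/
theorem IsNormal.mul_one_add [Fact p.Prime] [CharP k p] {J : ℕ} (h : IsNormal u p z J)
    (hδ : IsTwist u z i δ) (hu : IsSection u) (hz : IsParameter k z) (hi : 0 < i) (hiJ : i < J)
    (b : Residue k D) {m : ℕ} (hm : 0 < m) (hmJ : J ≤ m + i) {η : Residue k D → Residue k D}
    (hη : ∀ a, (u b : D) * z ^ m * u a - u a * (u b * z ^ m) - (u (η a) : D) * z ^ J ∈
      ball k z (J + 1)) :
    ∃ z', val k D z' = val k D z ∧ z' - z ∈ ball k z (m + 1) ∧ IsNormal u p z' J ∧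
      IsTwist u z' i δ ∧ (¬ p ∣ J → ∀ a, delta u z' 1 J a = delta u z 1 J a + η a) := by
  have hp := (Fact.out : p.Prime).pos
  have hy1 : (u b : D) * z ^ m ∈ ball k z 1 := ball_anti hz hm (section_mul_pow_mem_ball u z b m)
  have hconj := fun a => hδ.conj_mul_one_add_sub_mem hu hz hi hy1 (hη a)
  have hconj' : ∀ a, z * (1 + (u b : D) * z ^ m) * (u a : D) * (z * (1 + (u b : D) * z ^ m))⁻¹ -
      z * (u a : D) * z⁻¹ ∈ ball k z J := fun a => by
    have := AddSubgroup.add_mem _ (ball_anti hz (Nat.le_succ J) (hconj a))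
      (section_mul_pow_mem_ball u z (η a) J)
    rwa [sub_add_cancel] at this
  have hzz' : z * (1 + (u b : D) * z ^ m) - z ∈ ball k z (m + 1) := by
    rw [mul_add, mul_one, add_sub_cancel_left, add_comm]
    exact mul_mem_ball (by simpa using pow_mem_ball (k := k) z 1) (section_mul_pow_mem_ball u z b m)
  have hzz2 := ball_anti hz (by omega : 2 ≤ m + 1) hzz'
  have hv := val_mul_one_add hz hy1
  have hzp := h.mul_one_add_pow_mem hδ hu hz b hm hmJ
  exact ⟨_, hv, hzz', h.of_sub_mem hu hp hz hv hzz2 hzp hconj',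
    hδ.of_sub_mem hv hzz2 fun a => ball_anti hz hiJ (hconj' a),
    fun hJ => h.delta_eq hu hp hz hv hzz2 hJ hzp hconj⟩

/-- This exhibits the zero map as one of the maps `delta`, against which others can be compared when
`u` is determined by `s`. -/
theorem delta_zero_one (hu : IsSection u) (hz : IsParameter k z) (a : Residue k D) :
    delta u z 0 1 a = 0 := by
  refine delta_eq_of_val_le hu hz (c := fun j => if j = 0 then a else 0) (m := 2) ?_ one_lt_two
  simp [Finset.sum_range_succ]

/-- A map `delta` that vanishes on the powers of `s` vanishes on the centre. -/
theorem DeltaDetermined.eq_zero {s : Residue k D} (hdet : DeltaDetermined u s) (hu : IsSection u)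
    (hz : IsParameter k z) {l : ℤ} {j : ℕ} (h : ∀ n : ℕ, delta u z l j (s ^ n) = 0)
    {a : Residue k D} (ha : a ∈ ResidueCenter k D) : delta u z l j a = 0 := by
  rw [hdet z z l 0 j 1 hz hz (fun n => by rw [h, delta_zero_one hu hz]) a ha,
    delta_zero_one hu hz]

/-- Additive maps with the product rule that vanish on the centre are inner. -/
theorem exists_eq_commutator_of_product_rule {d : Residue k D → Residue k D}
    (hadd : ∀ a b, d (a + b) = d a + d b) (hmul : ∀ a b, d (a * b) = a * d b + d a * b)
    (hd : ∀ a ∈ ResidueCenter k D, d a = 0) : ∃ c, ∀ x, d x = c * x - x * c := by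
  have : Algebra.IsCentral (ResidueCenter k D) (Residue k D) := ⟨fun x hx =>
    ⟨⟨x, Subalgebra.mem_center_iff.2 (Subalgebra.mem_center_iff.1 hx)⟩, rfl⟩⟩
  have : FiniteDimensional (ResidueCenter k D) (Residue k D) :=
    Module.Finite.of_restrictScalars_finite k _ _
  let d' : Residue k D →ₗ[ResidueCenter k D] Residue k D :=
    { toFun := d
      map_add' := hadd
      map_smul' := fun c x => by
        change d ((c : Residue k D) * x) = (c : Residue k D) * d x
        rw [hmul, hd c c.2, zero_mul, add_zero] }
  exact exists_eq_commutator d' hmul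

/-- Improving a parameter by one step. -/
theorem IsNormal.exists_succ [Fact p.Prime] [CharP k p] {J : ℕ} (h : IsNormal u p z J)
    (hδ : IsTwist u z i δ) (hu : IsSection u) (hz : IsParameter k z) (hi : 0 < i) (hpi : p ∣ i)
    {s : Residue k D} (hsZ : s ∈ ResidueCenter k D) (hs : δ s ≠ 0) (hdet : DeltaDetermined u s)
    {m : ℕ} (hm : 0 < m) (hmJ : J = m + i) :
    ∃ z', val k D z' = val k D z ∧ z' - z ∈ ball k z (m + 1) ∧ IsNormal u p z' (J + 1) ∧
      IsTwist u z' i δ := by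
  have hp := (Fact.out : p.Prime).pos
  by_cases hJ : p ∣ J
  · exact ⟨z, rfl, by simp, h.succ hu hz fun hJ' => absurd hJ hJ', hδ⟩
  have hmp : (m : Residue k D) ≠ 0 := by
    have : CharP (Residue k D) p := charP_of_injective_algebraMap
      (algebraMap k (Residue k D)).injective p
    rw [Ne, CharP.cast_eq_zero_iff (Residue k D) p]
    exact fun hm' => hJ (hmJ ▸ dvd_add hm' hpi)
  have hδZ := mem_center_of_product_rule (hδ.product_rule hu hz hi) hsZ
  have hdZ := mem_center_of_product_rule (h.product_rule hp hJ hδ hu hz hi) hsZ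
  -- The solution of `delta u z 1 J s + b * (m * δ s) = 0`. It is central, so the commutator of `u b
  -- * z ^ m` with `u a` has order `J`, with leading coefficient `b * (m • δ a)`.
  set b := -(delta u z 1 J s * (m * δ s)⁻¹) with hb
  have hbZ : b ∈ ResidueCenter k D := by
    refine Subalgebra.neg_mem _ (Subalgebra.mul_mem _ hdZ ?_)
    have h1 : (m : Residue k D) * δ s ∈ ResidueCenter k D :=
      Subalgebra.mul_mem _ (natCast_mem _ m) hδZ
    rw [Subalgebra.mem_center_iff] at h1 ⊢
    intro x
    exact (Commute.inv_right₀ (h1 x : Commute x _)).eq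
  obtain ⟨z₁, hv₁, hz₁, hN₁, hT₁, hd₁⟩ := h.mul_one_add hδ hu hz hi (by omega) b hm hmJ.le
    (η := fun a => b * (m • δ a)) (fun a => by
      have h1 := section_mul_mem_ball u b (hδ.pow_mul_sub hu hz hi a m)
      have h2 : (u a : D) * u b = u b * u a := by
        rw [← Subring.coe_mul, ← Subring.coe_mul, ← map_mul, ← map_mul,
          Subalgebra.mem_center_iff.1 hbZ a]
      rw [add_comm i m, ← hmJ] at h1
      have h3 : (u b : D) * z ^ m * u a - u a * (u b * z ^ m) - (u (b * (m • δ a)) : D) * z ^ J =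
          u b * (z ^ m * u a - u a * z ^ m - (u (m • δ a) : D) * z ^ J) := by
        rw [← mul_assoc (u a : D), h2, map_mul, Subring.coe_mul]
        noncomm_ring
      rwa [h3])
  have hz₁' := isParameter_of_val_eq hz hv₁
  have hrule := hN₁.product_rule hp hJ hT₁ hu hz₁' hi
  have hs₁ : delta u z₁ 1 J s = 0 := by
    rw [hd₁ hJ, hb, nsmul_eq_mul, neg_mul, mul_assoc,
      inv_mul_cancel₀ (mul_ne_zero hmp hs), mul_one, add_neg_cancel]
  -- The new coefficient is a derivation killing `s`, hence its powers, hence the centre, so it is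
  -- inner.
  obtain ⟨c, hc⟩ := exists_eq_commutator_of_product_rule (delta_add hu hz₁' 1 J) hrule
    fun a ha => hdet.eq_zero hu hz₁' (pow_eq_zero_of_product_rule hrule hs₁) ha
  -- A factor `1 - u c * z₁ ^ J` subtracts the inner derivation: to order `J` its commutator with `u
  -- a` involves coefficients only.
  obtain ⟨z₂, hv₂, hz₂, hN₂, hT₂, hd₂⟩ := hN₁.mul_one_add hT₁ hu hz₁' hi (by omega) (-c)
    (m := J) (by omega) (by omega) (η := fun a => -(c * a - a * c)) (fun a => by
      have h1 := section_mul_mem_ball u c (hT₁.pow_mul_sub_mem hu hz₁' (section_mem_ball u z₁ a) J)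
      have h3 : (u (-c) : D) * z₁ ^ J * u a - u a * (u (-c) * z₁ ^ J) -
          (u (-(c * a - a * c)) : D) * z₁ ^ J = -(u c * (z₁ ^ J * u a - u a * z₁ ^ J)) := by
        simp only [map_neg, map_sub, map_mul, NegMemClass.coe_neg, AddSubgroupClass.coe_sub,
          Subring.coe_mul]
        noncomm_ring
      rw [h3]
      exact AddSubgroup.neg_mem _ (ball_anti hz₁' (by omega) h1))
  rw [ball_congr hv₁] at hz₂
  refine ⟨z₂, hv₂.trans hv₁, ?_, hN₂.succ hu (isParameter_of_val_eq hz₁' hv₂) fun _ a => ?_, hT₂⟩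
  · rw [← sub_add_sub_cancel z₂ z₁ z]
    exact AddSubgroup.add_mem _ (ball_anti hz (by omega) hz₂) hz₁
  · rw [hd₂ hJ, hc, add_neg_cancel]

end

end SplitAlg

/-! ### The limit parameter and the algebra of series in `z ^ p` -/

namespace SplitAlg

attribute [local instance] residueDivisionRing centerField centerAlgebra

section

variable {k : Type*} [Field k] {D : Type*} [DivisionRing D] [Algebra k⸨X⸩ D]
  [FiniteDimensional k⸨X⸩ D] {u : Residue k D →+* (val k D).integer} {p : ℕ} {z : D} {i : ℕ}
  {δ : Residue k D → Residue k D}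

theorem exists_limit (hz : IsParameter k z) (x : ℕ → D) (h0 : val k D (x 0) ≤ 1)
    (hx : ∀ n, x (n + 1) - x n ∈ ball k z (n + 1)) : ∃ y, ∀ n, y - x n ∈ ball k z (n + 1) := by
  obtain ⟨y, hy⟩ := exists_val_sub_sum_le hz
    (fun n => Nat.casesOn (motive := fun _ => D) n (x 0) fun n => x (n + 1) - x n) (by
      rintro (_ | n)
      · simpa using h0
      · exact hx n)
  refine ⟨y, fun n => ?_⟩
  have h1 := hy (n + 1)
  rw [Finset.sum_range_succ'] at h1
  simp only [Finset.sum_range_sub x n] at h1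
  change val k D (y - (x n - x 0 + x 0)) ≤ _ at h1
  rwa [sub_add_cancel] at h1

theorem pow_sub_pow_mem_ball_of_integral {x y : D} {n : ℕ} (hx : val k D x ≤ 1)
    (hy : val k D y ≤ 1) (h : x - y ∈ ball k z n) (m : ℕ) : x ^ m - y ^ m ∈ ball k z n := by
  induction m with
  | zero => simp
  | succ m ih =>
    have h1 : x ^ (m + 1) - y ^ (m + 1) = x ^ m * (x - y) + (x ^ m - y ^ m) * y := by
      rw [pow_succ, pow_succ]; noncomm_ring
    have h2 := mul_mem_ball (k := k) (z := z) (x := x ^ m) (m := 0)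
      (by rw [mem_ball, map_pow, pow_zero]; exact pow_le_one₀ zero_le hx) h
    rw [zero_add] at h2
    rw [h1]
    exact AddSubgroup.add_mem _ h2 (mul_mem_ball_of_integral ih hy)

/-- A parameter normalizing the series in `z ^ p` exactly. -/
theorem IsNormal.exists_forall [Fact p.Prime] [CharP k p] (h : IsNormal u p z (i + 1))
    (hδ : IsTwist u z i δ) (hu : IsSection u) (hz : IsParameter k z) (hi : 0 < i) (hpi : p ∣ i)
    {s : Residue k D} (hsZ : s ∈ ResidueCenter k D) (hs : δ s ≠ 0) (hdet : DeltaDetermined u s) :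
    ∃ z', IsParameter k z' ∧ IsTwist u z' i δ ∧ ∀ J, IsNormal u p z' J := by
  have hp := (Fact.out : p.Prime).pos
  -- Stage `n` is normal modulo order `n + 1 + i`; the passage to the next stage uses `m = n + 1`
  -- and changes the parameter by order `n + 2`, so the stages converge.
  let Q : ℕ → D → Prop := fun n x =>
    val k D x = val k D z ∧ IsNormal u p x (n + 1 + i) ∧ IsTwist u x i δ
  have step : ∀ n x, Q n x → ∃ x', x' - x ∈ ball k z (n + 2) ∧ Q (n + 1) x' := by
    rintro n x ⟨hv, hN, hT⟩
    obtain ⟨x', hv', hx', hN', hT'⟩ := hN.exists_succ hT hu (isParameter_of_val_eq hz hv) hi hpi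
      hsZ hs hdet (m := n + 1) (Nat.succ_pos n) rfl
    rw [ball_congr hv] at hx'
    rw [add_right_comm] at hN'
    exact ⟨x', hx', hv'.trans hv, hN', hT'⟩
  choose H hH1 hH2 using step
  let q : (n : ℕ) → {x : D // Q n x} := fun n =>
    Nat.rec ⟨z, rfl, by rw [add_comm i] at h; exact h, hδ⟩
      (fun n x => ⟨H n x.1 x.2, hH2 n x.1 x.2⟩) n
  have hq : ∀ n, (q (n + 1)).1 - (q n).1 ∈ ball k z (n + 2) := fun n => hH1 n _ _
  obtain ⟨ζ, hζ⟩ := exists_limit hz (fun n => (q n).1) (hz.2.1.le)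
    (fun n => ball_anti hz (Nat.le_succ _) (hq n))
  have hζ' : ∀ n, ζ - (q n).1 ∈ ball k z (n + 2) := fun n => by
    rw [← sub_add_sub_cancel ζ (q (n + 1)).1]
    exact AddSubgroup.add_mem _ (hζ (n + 1)) (hq n)
  have hvζ : val k D ζ = val k D z := by
    have h1 : val k D (ζ - z) < val k D z := by
      refine (show val k D (ζ - z) ≤ _ from hζ' 0).trans_lt ?_
      conv_rhs => rw [← pow_one (val k D z)]
      exact pow_lt_pow_right_of_lt_one₀
        (zero_lt_iff.2 ((Valuation.ne_zero_iff (val k D)).2 hz.1)) hz.2.1 (by omega)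
    have := Valuation.map_add_eq_of_lt_left (val k D) h1
    rwa [add_sub_cancel] at this
  -- Writing `ζ` as the `n`-th stage times `1 + y` with `y` of order `n + 1` bounds the change of
  -- conjugation.
  have hconj : ∀ n a, ζ * (u a : D) * ζ⁻¹ - (q n).1 * (u a : D) * (q n).1⁻¹ ∈
      ball k z (n + 1) := by
    intro n a
    have hzn := isParameter_of_val_eq hz (q n).2.1
    have h1 : ζ = (q n).1 * (1 + ((q n).1⁻¹ * ζ - 1)) := by
      rw [add_sub_cancel, mul_inv_cancel_left₀ hzn.1]
    have h2 : (q n).1⁻¹ * ζ - 1 ∈ ball k z (n + 1) := by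
      have h3 : (q n).1⁻¹ * ζ - 1 = (q n).1⁻¹ * (ζ - (q n).1) := by
        rw [mul_sub, inv_mul_cancel₀ hzn.1]
      have h4 : val k D (ζ - (q n).1) ≤ _ := hζ' n
      rw [h3, mem_ball, map_mul, map_inv₀, (q n).2.1]
      rw [pow_succ' _ (n + 1)] at h4
      exact (inv_mul_le_iff₀ (zero_lt_iff.2 ((Valuation.ne_zero_iff (val k D)).2 hz.1))).2 h4
    have h5 := (q n).2.2.2.conj_mul_one_add_sub_mem hu hzn hi
      (y := (q n).1⁻¹ * ζ - 1) (J := n) (a := a) (η := 0)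
      (by rw [ball_congr (q n).2.1]; exact ball_anti hz (by omega) h2) (by
        rw [ball_congr (q n).2.1]
        refine AddSubgroup.sub_mem _ (AddSubgroup.sub_mem _ (mul_mem_ball_of_integral h2 (u a).2)
          (section_mul_mem_ball u a h2)) (by simp))
    rw [← h1, ball_congr (q n).2.1] at h5
    simpa using h5
  refine ⟨ζ, isParameter_of_val_eq hz hvζ, ?_, fun J => ?_⟩
  · have hzn := isParameter_of_val_eq hz (q i).2.1
    refine (q i).2.2.2.of_sub_mem (hvζ.trans (q i).2.1.symm) ?_ fun a => ?_
    · rw [ball_congr (q i).2.1]; exact ball_anti hz (by omega) (hζ' i)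
    · rw [ball_congr (q i).2.1]; exact hconj i a
  · have hzn := isParameter_of_val_eq hz (q J).2.1
    refine ((q J).2.2.1.mono hzn (by omega : J ≤ J + 1 + i)).of_sub_mem hu hp hzn
      (hvζ.trans (q J).2.1.symm) ?_ ?_ fun a => ?_
    · rw [ball_congr (q J).2.1]; exact ball_anti hz (by omega) (hζ' J)
    · refine mem_powSpanMod_of_sub_mem (y := (q J).1 ^ p) (powSpan_le_powSpanMod _ ?_) ?_
      · simpa using mul_pow_mem_powSpan (u := u) (p := p) (z := (q J).1) 1 1
      · rw [ball_congr (q J).2.1]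
        exact ball_anti hz (by omega) (pow_sub_pow_mem_ball_of_integral (hvζ ▸ hz.2.1.le)
          hzn.2.1.le (hζ' J) p)
    · rw [ball_congr (q J).2.1]; exact ball_anti hz (by omega) (hconj J a)

/-- An element of the valuation ring that commutes with `u s` is a series in `z ^ p`. -/
theorem mem_powSpanMod_of_commute [Fact p.Prime] [CharP k p] (hN : ∀ J, IsNormal u p z J)
    (hδ : IsTwist u z i δ) (hu : IsSection u) (hz : IsParameter k z) (hi : 0 < i) (hpi : p ∣ i)
    {s : Residue k D} (hsZ : s ∈ ResidueCenter k D) (hs : δ s ≠ 0) {f : D} (hf : val k D f ≤ 1)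
    (hfs : (u s : D) * f = f * u s) (J : ℕ) : f ∈ powSpanMod u p z J := by
  have hp := (Fact.out : p.Prime).pos
  induction J with
  | zero => exact ball_le_powSpanMod _ (by simpa [mem_ball] using hf)
  | succ J ih =>
    by_cases hJ : p ∣ J
    · exact mem_powSpanMod_succ_of_dvd hu hz hJ ih
    have h1 := sub_coeff_mem_powSpanMod hu hz hJ ih
    set d := coeff u z f J with hd
    set q := f - (u d : D) * z ^ J with hq
    -- The commutator of `u s` with the part of `q` that is a series in `z ^ p` is again such a
    -- series, and with the remainder it gains order `i`.
    have h2 : (u s : D) * q - q * u s ∈ powSpanMod u p z (i + J + 1) := by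
      obtain ⟨w, hw, hr⟩ := exists_of_mem_powSpanMod h1
      have hw' := powSpan_le_powSpanMod (i + J + 1) hw
      have hs' := powSpan_le_powSpanMod (i + J + 1)
        (section_mem_powSpan (u := u) (p := p) (z := z) s)
      refine mem_powSpanMod_of_sub_mem (AddSubgroup.sub_mem _
        ((hN (i + J)).mul_mem hp hz hs' hw') ((hN (i + J)).mul_mem hp hz hw' hs')) ?_
      have h3 : (u s : D) * q - q * u s - (u s * w - w * u s) =
          u s * (q - w) - (q - w) * u s := by noncomm_ring
      rw [h3]
      exact ball_anti hz (by omega) (hδ.commutator_mem hu hz hsZ hr)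
    have h4 := section_mul_mem_ball u d (hδ.pow_mul_sub hu hz hi s J)
    -- As `f` commutes with `u s`, the commutator of `q` comes from `u d * z ^ J` alone, with
    -- leading coefficient `d * (J • δ s)` at order `i + J`. This order is prime to `p`, so the
    -- coefficient vanishes, and with it `d`.
    have h5 : (u (d * (J • δ s)) : D) * z ^ (i + J) ∈ powSpanMod u p z (i + J + 1) := by
      refine mem_powSpanMod_of_sub_mem h2 ?_
      have h6 : (u s : D) * u d = u d * u s := by
        rw [← Subring.coe_mul, ← Subring.coe_mul, ← map_mul, ← map_mul,
          Subalgebra.mem_center_iff.1 hsZ d]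
      have h7 : (u s : D) * q - q * u s = u d * (z ^ J * u s - u s * z ^ J) := by
        rw [hq, mul_sub, sub_mul, hfs, ← mul_assoc (u s : D), h6]
        noncomm_ring
      rw [h7, map_mul, Subring.coe_mul, mul_assoc, ← mul_sub, ← neg_sub, mul_neg]
      exact AddSubgroup.neg_mem _ h4
    have h6 := eq_zero_of_mul_pow_mem hu hz (fun h => hJ ((Nat.dvd_add_right hpi).1 h)) h5
    have hJk : (J : Residue k D) ≠ 0 := by
      have : CharP (Residue k D) p := charP_of_injective_algebraMap
        (algebraMap k (Residue k D)).injective p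
      rwa [Ne, CharP.cast_eq_zero_iff (Residue k D) p]
    rw [nsmul_eq_mul] at h6
    have h7 : d = 0 := (mul_eq_zero.1 h6).resolve_right (mul_ne_zero hJk hs)
    rw [hq, h7] at h1
    simpa using h1

/-- The subalgebra of series in `z ^ p`. -/
theorem exists_subalgebra_forall_mem [Fact p.Prime] [CharP k p] (hN : ∀ J, IsNormal u p z J)
    (hδ : IsTwist u z i δ) (hu : IsSection u) (hz : IsParameter k z) (hi : 0 < i) (hpi : p ∣ i)
    {s : Residue k D} (hsZ : s ∈ ResidueCenter k D) (hs : δ s ≠ 0) :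
    ∃ B : Subalgebra k⸨X⸩ D, ∀ x, x ∈ B ↔ ∃ n : ℕ, ∀ J, unif k D ^ n * x ∈ powSpanMod u p z J := by
  have hp := (Fact.out : p.Prime).pos
  have hcomm : ∀ (n : ℕ) (x : D), x * unif k D ^ n = unif k D ^ n * x := fun n x =>
    ((show Commute (unif k D) x from unif_mul_comm k D x).pow_left n).eq.symm
  have hint : ∀ f : D, val k D f ≤ 1 → (∀ d, d * f = f * d) → ∀ J, f ∈ powSpanMod u p z J :=
    fun f hf hfd => mem_powSpanMod_of_commute hN hδ hu hz hi hpi hsZ hs hf (hfd _)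
  have hmul : ∀ {x y : D}, (∀ J, x ∈ powSpanMod u p z J) → (∀ J, y ∈ powSpanMod u p z J) →
      ∀ J, x * y ∈ powSpanMod u p z J := fun hx hy J =>
    powSpanMod_anti hz (Nat.le_succ J) ((hN J).mul_mem hp hz (hx _) (hy _))
  have hunif : ∀ n J, unif k D ^ n ∈ powSpanMod u p z J := fun n => hint _ (by
    rw [map_pow]; exact pow_le_one₀ zero_le (val_unif_lt_one k D).le) (hcomm n)
  -- Powers of `X` serve as denominators: they are central, hence themselves series in `z ^ p`.
  refine ⟨{ carrier := {x | ∃ n : ℕ, ∀ J, unif k D ^ n * x ∈ powSpanMod u p z J}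
            mul_mem' := ?_, add_mem' := ?_, algebraMap_mem' := ?_ }, fun x => Iff.rfl⟩
  · rintro x y ⟨m, hm⟩ ⟨n, hn⟩
    refine ⟨m + n, fun J => ?_⟩
    have := hmul hm hn J
    rwa [mul_assoc, ← mul_assoc x, hcomm n x, mul_assoc (unif k D ^ n), ← mul_assoc,
      ← pow_add] at this
  · rintro x y ⟨m, hm⟩ ⟨n, hn⟩
    refine ⟨m + n, fun J => ?_⟩
    have h1 := AddSubgroup.add_mem _ (hmul (hunif n) hm J) (hmul (hunif m) hn J)
    rwa [← mul_assoc, ← mul_assoc, ← pow_add, ← pow_add, add_comm n m, ← mul_add] at h1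
  · intro f
    obtain ⟨n, hn⟩ := exists_unif_pow_mul_integral (k := k) (algebraMap k⸨X⸩ D f)
    refine ⟨n, hint _ hn fun d => ?_⟩
    rw [← mul_assoc, hcomm, mul_assoc, mul_assoc, Algebra.commutes f d]

end

end SplitAlg

/-! ### The algebra in `z ^ p` and the main theorem -/

namespace SplitAlg

attribute [local instance] residueDivisionRing centerField centerAlgebra

/-- If the semilocal height is divisible by `p`, some `u(D̄)((z ^ p))`, for an appropriate
parameter `z`, is a subalgebra whose centre is cyclic of degree `p`. -/
theorem exists_laurentSet_cyclic_of_dvd {p : ℕ} [Fact p.Prime] {k : Type*} [Field k] [CharP k p]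
    {D : Type*} [DivisionRing D] [Algebra k⸨X⸩ D] [FiniteDimensional k⸨X⸩ D]
    [Algebra.IsCentral k⸨X⸩ D] {s : Residue k D} (hsZ : s ∈ ResidueCenter k D)
    {u : Residue k D →+* (val k D).integer} (hu : IsSection u) (hdet : DeltaDetermined u s)
    {i : ℕ} (hiu : IsSemilocalHeight u i) (hpi : p ∣ i) :
    ∃ z, IsAppropriate u z i ∧ ∃ A : Subalgebra k⸨X⸩ D,
      (A : Set D) = laurentSet u (z ^ p) ∧ HasCyclicGaloisCenter k⸨X⸩ A p := by
  have hp := (Fact.out : p.Prime).pos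
  obtain ⟨z₀, hz₀, hz₀1, ⟨hz₀i, a₀, ha₀⟩, a₁, ha₁Z, ha₁⟩ := hiu
  -- As conjugation by `z₀` is trivial on residues, all differences `z₀ * u a * z₀⁻¹ - u a` have
  -- positive order.
  have hi : 0 < i := by
    refine Nat.pos_of_ne_zero ?_
    rintro rfl
    have h1 := val_sub_sum_delta_le hu hz₀ 1 a₀ 1
    rw [Finset.sum_range_one, hz₀1, pow_zero, mul_one, zpow_one, zpow_neg_one, ha₀, pow_zero,
      pow_one] at h1
    exact absurd hz₀.2.1 h1.not_gt
  choose δ hδ₀ using fun a => exists_sub_mem_ball hu hz₀ (hz₀i a)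
  have hT₀ : IsTwist u z₀ i δ := hδ₀
  -- Otherwise the derivation `δ` kills all powers of `s`, and therefore the centre, contrary to
  -- appropriateness.
  have hs : δ s ≠ 0 := by
    intro h0
    refine ha₁ (hdet.eq_zero hu hz₀ (fun n => ?_) ha₁Z)
    rw [hT₀.delta_eq hu hz₀ hi,
      pow_eq_zero_of_product_rule (hT₀.product_rule hu hz₀ hi) h0]
  -- The leading term `u (δ a) * z₀ ^ i` is already a term in `z₀ ^ p`, because `p ∣ i`.
  have hN₀ : IsNormal u p z₀ (i + 1) := by
    intro a
    obtain ⟨j, hj⟩ := hpi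
    refine mem_powSpanMod_of_sub_mem (powSpan_le_powSpanMod _ (AddSubgroup.add_mem _
      (section_mem_powSpan a) (mul_pow_mem_powSpan (δ a) j))) ?_
    rw [← hj, ← sub_sub]
    exact hδ₀ a
  obtain ⟨z, hz, hT, hN⟩ := hN₀.exists_forall hT₀ hu hz₀ hi hpi hsZ hs hdet
  obtain ⟨B, hB⟩ := exists_subalgebra_forall_mem hN hT hu hz hi hpi hsZ hs
  have huB : ∀ a, (u a : D) ∈ B := fun a =>
    (hB _).2 ⟨0, fun J => by simpa using powSpan_le_powSpanMod J (section_mem_powSpan a)⟩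
  have hzB : z ^ p ∈ B := (hB _).2 ⟨0, fun J => by
    simpa using powSpan_le_powSpanMod J (mul_pow_mem_powSpan (u := u) (p := p) (z := z) 1 1)⟩
  have hcomm : ∀ x, (u s : D) * x = x * u s → x ∈ B := by
    intro x hx
    obtain ⟨n, hn⟩ := exists_unif_pow_mul_integral (k := k) x
    refine (hB _).2 ⟨n, mem_powSpanMod_of_commute hN hT hu hz hi hpi hsZ hs hn ?_⟩
    have h1 : (u s : D) * unif k D ^ n = unif k D ^ n * u s :=
      ((show Commute (unif k D) (u s : D) from unif_mul_comm k D _).pow_left n).eq.symm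
    rw [← mul_assoc, h1, mul_assoc, hx, mul_assoc]
  -- Leading terms occur only at multiples of `p`; for `X` this yields `X` and `z ^ (p * e)` of
  -- equal value.
  have hdvd : ∀ x : D, x ≠ 0 → (∀ J, x ∈ powSpanMod u p z J) →
      ∃ m : ℕ, val k D x = val k D z ^ (p * m) := by
    intro x hx0 hx
    obtain ⟨m, hm⟩ := hz.2.2 x hx0
    have hm0 : 0 ≤ m := by
      have h1 := val_le_one_of_mem_powSpanMod hz (hx 0)
      rw [hm, ← zpow_zero (val k D z), zpow_val_le_iff hz.1 hz.2.1] at h1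
      exact h1
    lift m to ℕ using hm0
    rw [zpow_natCast] at hm
    obtain ⟨j, rfl⟩ := dvd_of_mem_powSpanMod hu hz (Nat.lt_succ_self m) (hx _) hm.le (fun h1 => by
      rw [mem_ball, hm] at h1
      exact absurd (pow_lt_pow_right_of_lt_one₀
        (zero_lt_iff.2 ((Valuation.ne_zero_iff (val k D)).2 hz.1)) hz.2.1 (Nat.lt_succ_self m))
        h1.not_gt)
    exact ⟨j, hm⟩
  have hunif : ∀ J, unif k D ∈ powSpanMod u p z J :=
    mem_powSpanMod_of_commute hN hT hu hz hi hpi hsZ hs (val_unif_lt_one k D).le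
      (unif_mul_comm k D _).symm
  obtain ⟨e, he⟩ := hdvd _ (unif_ne_zero k D) hunif
  have hz0 : val k D z ≠ 0 := (Valuation.ne_zero_iff (val k D)).2 hz.1
  have hgen : IsGenerator B (z ^ p) := by
    refine ⟨hzB, pow_ne_zero _ hz.1, ?_, fun x hx hx0 => ?_⟩
    · rw [map_pow]
      exact pow_lt_one₀ zero_le hz.2.1 hp.ne'
    · obtain ⟨n, hn⟩ := (hB x).1 hx
      obtain ⟨m, hm⟩ := hdvd _ (mul_ne_zero (pow_ne_zero n (unif_ne_zero k D)) hx0) hn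
      refine ⟨(m : ℤ) - e * n, ?_⟩
      rw [map_mul, map_pow, he, ← pow_mul, mul_assoc] at hm
      rw [map_pow, zpow_sub₀ (pow_ne_zero _ hz0), eq_div_iff
        (zpow_ne_zero _ (pow_ne_zero _ hz0)), ← Int.natCast_mul, zpow_natCast, zpow_natCast,
        ← pow_mul, ← pow_mul, mul_comm, hm]
  -- Integral elements of `B` need no denominator: they expand along `z ^ p`, which generates the
  -- values of `B`.
  have hint : ∀ x ∈ B, val k D x ≤ 1 → ∀ J, x ∈ powSpanMod u p z J := by
    intro x hx hx1 J
    refine mem_powSpanMod_of_sub_mem (powSpan_le_powSpanMod _ (AddSubgroup.sum_mem _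
      (t := Finset.range J) (f := fun j => (u (coeff u (z ^ p) x j) : D) * (z ^ p) ^ j)
      fun j _ => ?_)) ((hgen.val_sub_sum_coeff_le hu huB hx hx1 J).trans ?_)
    · rw [← pow_mul]
      exact mul_pow_mem_powSpan _ j
    · rw [map_pow, ← pow_mul]
      exact pow_le_pow_right_of_le_one' hz.2.1.le (Nat.le_mul_of_pos_left J hp)
  refine ⟨z, hT.isAppropriate hu hz hi hsZ hs, B, laurentSet_eq hgen hu huB fun x hx => ?_,
    hasCyclicGaloisCenter_of_conj B hz.1 (fun a ha => ?_) (fun c hc => ?_) (fun w hw hwz => ?_) ?_⟩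
  · obtain ⟨n, hn⟩ := exists_unif_pow_mul_integral (k := k) x
    refine (hB x).2 ⟨n, fun J => ?_⟩
    obtain ⟨c, hc, hcx⟩ := hx J
    have h1 : unif k D ^ n * x - unif k D ^ n * c ∈ ball k z J := by
      rw [← mul_sub, mem_ball, map_mul, map_pow]
      refine (mul_le_of_le_one_left zero_le (pow_le_one₀ zero_le (val_unif_lt_one k D).le)).trans
        (hcx.trans ?_)
      rw [map_pow, ← pow_mul]
      exact pow_le_pow_right_of_le_one' hz.2.1.le (Nat.le_mul_of_pos_left J hp)
    refine mem_powSpanMod_of_sub_mem (hint _ (B.mul_mem (B.pow_mem (unif_mem B) n) hc) ?_ J) h1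
    have h2 := ball_anti hz (Nat.zero_le J) h1
    rw [mem_ball, pow_zero] at h2
    have h3 := Valuation.map_sub_le (v := val k D) hn h2
    rwa [sub_sub_cancel] at h3
  · obtain ⟨n, hn⟩ := (hB a).1 ha
    refine (hB _).2 ⟨n, fun J => ?_⟩
    have h1 := (hN J).conj_mem hz (hn J)
    have h2 : z * unif k D ^ n = unif k D ^ n * z :=
      ((show Commute (unif k D) z from unif_mul_comm k D _).pow_left n).eq.symm
    rw [← mul_assoc, h2] at h1
    simpa only [mul_assoc] using h1
  · rw [Subalgebra.mem_centralizer_iff] at hc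
    exact hcomm c (hc _ (huB s))
  · exact mem_bot_of_commute hz hu (fun a => hw _ (huB a)) hwz
  -- The residue algebra of `B` is everything and its ramification index is `e`, that of `D` being
  -- `p e`; so the centralizer has degree `p`.
  · have h1 := finrank_mul_finrank_centralizer B
    have h2 := hgen.finrank_eq (e := e) (by rw [he, map_pow, pow_mul])
    rw [residueSubmodule_eq_top hu huB, finrank_top] at h2
    have h3 := hz.finrank_eq he
    rw [mul_assoc, ← h2, ← h1, mul_comm p] at h3
    exact Nat.eq_of_mul_eq_mul_left finrank_pos h3

end SplitAlg

open SplitAlg in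
theorem mainTheorem9 (p : ℕ) [Fact p.Prime] (k : Type*) [Field k] [CharP k p]
    (D : Type*) [DivisionRing D] [Algebra k⸨X⸩ D] [FiniteDimensional k⸨X⸩ D]
    [Algebra.IsCentral k⸨X⸩ D]
    (hp : ∃ r : ℕ, Module.finrank k⸨X⸩ D = p ^ r)
    (hD : Splittable k D)
    (s : Residue k D) (hs : ResidueCenter k D = Algebra.adjoin k {s}) :
    (∃ u : Residue k D →+* (val k D).integer, IsSection u ∧ DeltaDetermined u s) ∧
    Module.finrank k (ResidueCenter k D) = ramificationIndex k D ∧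
    ∀ u : Residue k D →+* (val k D).integer, IsSection u → DeltaDetermined u s →
      ((∃ z, IsParameter k z ∧ ∃ a ∈ ResidueCenter k D, delta u z 1 0 a ≠ a) →
        ∃ z, IsParameter k z ∧ ∃ A : Subalgebra k⸨X⸩ D,
          (A : Set D) = laurentSet u (z ^ Nat.card Gal(ResidueCenter k D/k)) ∧
          HasCyclicGaloisCenter k⸨X⸩ A (Nat.card Gal(ResidueCenter k D/k))) ∧
      (∀ i : ℕ, IsSemilocalHeight u i → p ∣ i →
        ∃ z, IsAppropriate u z i ∧ ∃ A : Subalgebra k⸨X⸩ D,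
          (A : Set D) = laurentSet u (z ^ p) ∧ HasCyclicGaloisCenter k⸨X⸩ A p) := by
  refine ⟨exists_section_deltaDetermined p hD s hs, finrank_residueCenter_eq_ramificationIndex hD,
    fun u hu hdet => ⟨fun _ => exists_laurentSet_cyclic_of_gal hu, fun i hiu hpi =>
      exists_laurentSet_cyclic_of_dvd ?_ hu hdet hiu hpi⟩⟩
  rw [hs]
  exact Algebra.self_mem_adjoin_singleton k s
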